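/- \textbf{Setting.} Let $\phi_1>0$, $0<\phi_2<1$. A \emph{power-law field} with parameters $(\phi_1,\phi_2)$ on $D\subset\mathbb R^2$ is a family $(X(s))_{s\in D}$ of random variables such that every finite combination $\sum_i c_iX(s_i)$ with $s_i\in D$, $\sum_i c_i=0$, is centred Gaussian with variance $\sum_{i,j}c_ic_jK(s_i-s_j)$, where $K(h)=\phi_1\Gamma(-\phi_2)\|h\|^{2\phi_2}$ (Euclidean norm). For data $x$ on $\Lambda_n=\{0,\dots,n-1\}^2$, $n\ge5$, and $r\in\{1,2\}$, let $(D_rx)_t=x_t-x_{t+re_1}-x_{t+re_2}+x_{t+re_1+re_2}$ and $Q_r=|\Lambda_{n-2r}|^{-1}\sum_{t\in\Lambda_{n-2r}}(D_rx)_t^2$. Let $a_1(\phi)=|\Gamma(-\phi)|(8-4\cdot2^{\phi})$ and $$h(y_1,y_2)=\Bigl(\frac{y_1}{a_1(\frac12\log_2(y_2/y_1))},\ \tfrac12\log_2(y_2/y_1)\Bigr).$$ The moment estimators of scale and roughness are the two coordinates of $h(Q_1,Q_2)$. Put $N=n^2$ and $\tau_1=\phi_1N^{-\phi_2}$, $\tau_2=\phi_2$.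 Let $(\hat\tau_1,\hat\tau_2)$ be these estimators computed from $x_t=X(t/n)$, $t\in\Lambda_n$, where $X$ is a power-law field with parameters $(\phi_1,\phi_2)$ on $[0,1]^2$ (fixed domain), and $(\hat\phi_1,\hat\phi_2)$ those computed from $x_t=Y(t)$, where $Y$ is a power-law field with the same parameters on $\mathbb Z^2$ (increasing domain). Let $\mathbb T^2=(-\pi,\pi]^2$, $\mu(d\lambda)=(2\pi)^{-2}d\lambda$, $f_0(\lambda)=2^{2\phi_2+2}\pi\,\Gamma(1+\phi_2)\,\phi_1\|\lambda\|^{-(2+2\phi_2)}$, $f_X(\lambda)=\sum_{m\in\mathbb Z^2}f_0(\lambda+2\pi m)$, $g_r(\lambda)=(1-e^{ir\lambda_1})(1-e^{ir\lambda_2})$, $q_r=\int_{\mathbb T^2}|g_r|^2f_X\,d\mu$ $(=\mathbb E\,Q_r$ for data $Y)$, $b_1\equiv1$, $b_2(\lambda)=16\cos^2(\lambda_1/2)\cos^2(\lambda_2/2)$, and $$\Sigma_{\ell m}=2\int_{\mathbb T^2}b_\ell b_m\,\bigl(|g_1|^2f_X\bigr)^2d\mu,\qquad \mathcal K=\begin{pmatrix}1/\phi_1&0\\0&1\end{pmatrix}\nabla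 h(q_1,q_2),\qquad \Omega=\mathcal K\,\Sigma\,\mathcal K^{\top},$$ with $\nabla h$ the Jacobian matrix. Below $\log x$ is read as $\log|x|$ (the argument is positive with probability tending to $1$). \textbf{Theorem.} \begin{enumerate} \item For every $n\ge5$, $(\hat\tau_1/\tau_1,\hat\tau_2)\stackrel d=(\hat\phi_1/\phi_1,\hat\phi_2)$. \item $\Omega$ is positive semidefinite with $\Omega_{22}>0$, and as $n\to\infty$ $$\sqrt N\begin{pmatrix}\hat\tau_1/\tau_1-1\\ \hat\tau_2-\tau_2\end{pmatrix}\Rightarrow\mathcal N(0,\Omega).$$ \item With the plug-in scale estimator $N^{\hat\tau_2}\hat\tau_1$ of $\phi_1$ and $W_N=N^{\hat\tau_2}\hat\tau_1/\phi_1-1$, $$\sqrt N\begin{pmatrix}W_N-(\log N)(\hat\tau_2-\tau_2)\\ \hat\tau_2-\tau_2\end{pmatrix}\Rightarrow\mathcal N(0,\Omega).$$ \item With $A_N=\begin{pmatrix}1&-\log N\\0&1\end{pmatrix}$, $$\sqrt N\,A_N\begin{pmatrix}\log\bigl(N^{\hat\tau_2}\hat\tau_1/\phi_1\bigr)\\ \hat\tau_2-\tau_2\end{pmatrix}\Rightarrow\mathcal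 N(0,\Omega).$$ \item The scale estimator converges at the exact rate $N^{-1/2}\log N$: $\ \dfrac{\sqrt N}{\log N}\,W_N\Rightarrow\mathcal N(0,\Omega_{22})$. \item For all large $n$, $\log(N^{\hat\tau_2}\hat\tau_1)$ and $\hat\tau_2$ have finite second moments, and $\mathrm{Corr}\bigl(\log(N^{\hat\tau_2}\hat\tau_1),\hat\tau_2\bigr)\to1$. \end{enumerate} -/

import Mathlib

open MeasureTheory ProbabilityTheory Filter Topology Matrix

noncomputable section

namespace PowerLaw

/-- The Euclidean plane. -/
abbrev Plane : Type := EuclideanSpace ℝ (Fin 2)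

/-! ### The Gaussian power-law field (intrinsic of order 0) -/

/-- The power-law generalized covariance `K(h) = φ₁ Γ(-φ₂) ‖h‖^(2 φ₂)` (non-integer `φ₂`). -/
def genCov (φ₁ φ₂ : ℝ) (h : Plane) : ℝ :=
  φ₁ * Real.Gamma (-φ₂) * ‖h‖ ^ (2 * φ₂)

/-- `X` is, on the set `D`, a Gaussian intrinsic random function of order 0 with generalized
covariance `K`: every finite linear combination `∑ c(s) X(s)` over points of `D` with
`∑ c(s) = 0` is centred Gaussian with variance `∑ ∑ c(s) c(t) K(s - t)`. (The combinations are
closed under linear combinations, so this determines all joint laws of increments; nothing is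
assumed about `X` beyond its increments.) -/
def IsPowerLawField {Ω : Type*} [MeasurableSpace Ω] (φ₁ φ₂ : ℝ) (D : Set Plane)
    (X : Plane → Ω → ℝ) (P : Measure Ω) : Prop :=
  ∀ c : Plane →₀ ℝ, (c.support : Set Plane) ⊆ D → ∑ s ∈ c.support, c s = 0 →
    HasLaw (fun ω => ∑ s ∈ c.support, c s * X s ω)
      (gaussianReal 0
        (∑ s ∈ c.support, ∑ t ∈ c.support, c s * c t * genCov φ₁ φ₂ (s - t)).toNNReal) P

/-- The square `[0,1]²`. -/
def unitSquare : Set Plane := {x | ∀ i, x i ∈ Set.Icc (0 : ℝ) 1}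

/-- The integer lattice `ℤ²`. -/
def integerLattice : Set Plane := {x | ∀ i, ∃ k : ℤ, x i = k}

/-- The sample `t ↦ X(δ t)` of a field on the grid with spacing `δ`, at the outcome `ω`. -/
def sample {Ω : Type*} (δ : ℝ) (X : Plane → Ω → ℝ) (ω : Ω) (t : ℕ × ℕ) : ℝ :=
  X !₂[δ * t.1, δ * t.2] ω

/-! ### Bilinear differences, quadratic variations and the moment estimators -/

/-- `Λ_n = {0, …, n-1}²`. -/
def grid (n : ℕ) : Finset (ℕ × ℕ) := Finset.range n ×ˢ Finset.range n

/-- The first-order bilinear difference with step `r`. -/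
def bilinDiff (r : ℕ) (x : ℕ × ℕ → ℝ) (t : ℕ × ℕ) : ℝ :=
  x t - x (t.1 + r, t.2) - x (t.1, t.2 + r) + x (t.1 + r, t.2 + r)

/-- `Q_r`, the average of the squared differences over `Λ_{n-2r}` (meaningful for `n > 2r`). -/
def quadVar (n r : ℕ) (x : ℕ × ℕ → ℝ) : ℝ :=
  (∑ t ∈ grid (n - 2 * r), bilinDiff r x t ^ 2) / (grid (n - 2 * r)).card

/-- `a₁(φ) = |Γ(-φ)| (8 - 4 · 2^φ)`. -/
def aOne (φ : ℝ) : ℝ := |Real.Gamma (-φ)| * (8 - 4 * (2 : ℝ) ^ φ)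

/-- The map `h(y₁, y₂) = (y₁ / a₁(½ log₂ (y₂/y₁)), ½ log₂ (y₂/y₁))`. -/
def momentMap (y : Fin 2 → ℝ) : Fin 2 → ℝ :=
  ![y 0 / aOne (1 / 2 * Real.logb 2 (y 1 / y 0)), 1 / 2 * Real.logb 2 (y 1 / y 0)]

/-- The scale estimator computed from unit-lattice data `x` on `Λ_n`. -/
def scaleEst (n : ℕ) (x : ℕ × ℕ → ℝ) : ℝ := momentMap ![quadVar n 1 x, quadVar n 2 x] 0

/-- The roughness estimator `½ log₂ (Q₂/Q₁)` computed from unit-lattice data `x` on `Λ_n`. -/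
def roughEst (n : ℕ) (x : ℕ × ℕ → ℝ) : ℝ := momentMap ![quadVar n 1 x, quadVar n 2 x] 1

/-! ### Spectral quantities and the limiting covariance -/

/-- The spectral density of the power-law field on the plane, for the convention in which
covariances of increments are integrals against `(2π)⁻² dw`. -/
def planeDensity (φ₁ φ₂ : ℝ) (w : Plane) : ℝ :=
  (2 : ℝ) ^ (2 * φ₂ + 2) * Real.pi * Real.Gamma (1 + φ₂) * φ₁ * ‖w‖ ^ (-(2 + 2 * φ₂))

/-- The aliased spectral density `f_X(w) = ∑_{m ∈ ℤ²} f₀(w + 2π m)`. -/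
def latticeDensity (φ₁ φ₂ : ℝ) (w : Plane) : ℝ :=
  ∑' m : ℤ × ℤ,
    planeDensity φ₁ φ₂ (w + !₂[2 * Real.pi * (m.1 : ℝ), 2 * Real.pi * (m.2 : ℝ)])

/-- The symbol `(1 - e^{i r w₁}) (1 - e^{i r w₂})` of the bilinear difference with step `r`. -/
def symbol (r : ℕ) (w : Plane) : ℂ :=
  (1 - Complex.exp (Complex.I * r * (w 0 : ℂ))) * (1 - Complex.exp (Complex.I * r * (w 1 : ℂ)))

/-- The torus `(-π, π]²`. -/
def torus : Set Plane := {w | ∀ i, w i ∈ Set.Ioc (-Real.pi) Real.pi}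

/-- Integration over the torus with respect to `(2π)⁻² dw`. -/
def torusIntegral (F : Plane → ℝ) : ℝ := ((2 * Real.pi) ^ 2)⁻¹ * ∫ w in torus, F w

/-- The mean `q_r` of `Q_r` for the unit-lattice field:
the integral of `|symbol r|² f_X` over the torus. -/
def meanQV (φ₁ φ₂ : ℝ) (r : ℕ) : ℝ :=
  torusIntegral fun w => ‖symbol r w‖ ^ 2 * latticeDensity φ₁ φ₂ w

/-- The symbols `b₁ = 1` and `b₂(w) = 16 cos²(w₁/2) cos²(w₂/2)`. -/
def bSymbol (l : Fin 2) (w : Plane) : ℝ :=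
  ![1, 16 * Real.cos (w 0 / 2) ^ 2 * Real.cos (w 1 / 2) ^ 2] l

/-- The limiting covariance matrix `Σ` of `√N (Q₁ - q₁, Q₂ - q₂)`. -/
def covQV (φ₁ φ₂ : ℝ) : Matrix (Fin 2) (Fin 2) ℝ :=
  Matrix.of fun l m => 2 * torusIntegral fun w =>
    bSymbol l w * bSymbol m w * (‖symbol 1 w‖ ^ 2 * latticeDensity φ₁ φ₂ w) ^ 2

/-- The Jacobian matrix of partial derivatives of `F` at `q`. -/
def jacobian (F : (Fin 2 → ℝ) → Fin 2 → ℝ) (q : Fin 2 → ℝ) : Matrix (Fin 2) (Fin 2) ℝ :=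
  Matrix.of fun i j => deriv (fun s => F (Function.update q j s) i) (q j)

/-- The Jacobian `K = diag(1/φ₁, 1) · ∇h(q₁, q₂)`. -/
def ratioJacobian (φ₁ φ₂ : ℝ) : Matrix (Fin 2) (Fin 2) ℝ :=
  Matrix.diagonal ![1 / φ₁, 1] * jacobian momentMap ![meanQV φ₁ φ₂ 1, meanQV φ₁ φ₂ 2]

/-- The limiting covariance matrix `K Σ Kᵀ` of the ratio estimators. -/
def limitCov (φ₁ φ₂ : ℝ) : Matrix (Fin 2) (Fin 2) ℝ :=
  ratioJacobian φ₁ φ₂ * covQV φ₁ φ₂ * (ratioJacobian φ₁ φ₂)ᵀ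

/-- The stabilizing matrix `A_N`. -/
def stabMatrix (N : ℝ) : Matrix (Fin 2) (Fin 2) ℝ := !![1, -Real.log N; 0, 1]

/-- The correlation coefficient of two real random variables. -/
def corr {Ω : Type*} [MeasurableSpace Ω] (U V : Ω → ℝ) (P : Measure Ω) : ℝ :=
  cov[U, V; P] / (√(Var[U; P]) * √(Var[V; P]))

end PowerLaw

end

open PowerLaw

/-! Everything reduces to the Gaussian vector of bilinear differences. The generalized covariance is
homogeneous of degree `2 φ₂`, so the differences on a grid of spacing `δ`, multiplied by `δ ^
(-φ₂)`, have a law free of `δ` (`hasLaw_diffVector`). The roughness estimator ignores a rescaling of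
the data and the scale estimator picks up a known factor; this gives the equality in law and allows
the fixed-domain estimators to be studied through the normalized variations `normQV`.

The covariances of the differences are the Fourier coefficients of `g_a conj(g_b) f_X` on the torus.
This function is bounded, because the zero of `g_r` at the origin beats the singularity of `f_X`
when `φ₂ < 1`. Boundedness has two consequences: Parseval makes the squared covariances summable,
with sum half the entry of `Σ` (`hasSum_covQV`), and the covariance matrices have uniformly bounded
spectral norm (`exists_sum_diffCov_le`). A combination `θ₁ Q₁ + θ₂ Q₂` diagonalizes as `∑ l_i z_i²`
in independent standard Gaussians, with `max |l_i| = O(n⁻²)` and `2 n² ∑ l_i² → θ · Σ θ`; comparing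
characteristic functions gives the central limit theorem for `n (Q - q)`, and the same coefficients
give uniform exponential moments.

Since `h(q) = (φ₁, φ₂)`, the delta method yields the ratio statement. The plug-in ratio is `e^{L S}
(1 + u)` with `L = log N`, where `S` and `u` are the errors of roughness and of the scale ratio,
both `O(1/n)` in probability. Its expansion is `1 + L S + u` up to `O(L² / n²)`: subtracting `L S`
leaves `u`, while dividing by `L` leaves `S`. Positivity of `Ω₂₂` holds because the relevant
combination of `b₁` and `b₂` does not vanish near `(π, π)`.

The correlation needs moments, not only weak limits. The log estimator is `L τ̂₂ + log(τ̂₁/τ₁)` plus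
a constant, so it suffices that `n² Var τ̂₂` is bounded below, which follows from the weak limit,
and that `n² E log(τ̂₁/τ₁)²` is bounded above (`momentBdd_sq_log_ratioMap`). The logarithm is
singular where `Q₁`, `Q₂` or `Q₂ - 4^k Q₁`, `k = 0, 1, 2`, vanishes; the pathwise bound `Q₂ ≤ 36 Q₁`
excludes further poles of `Γ(-φ)`. Each of these five forms has nonzero mean, hence a negative
moment of order `1/4` growing at most polynomially in `n`, and this is beaten by the exponentially
small probability of leaving a neighbourhood of `q`. -/

noncomputable section
namespace PowerLaw

/-! ### The spectral representation of the power-law variogram -/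

lemma integral_cos_inner_mul_gaussian {t : ℝ} (ht : 0 < t) (h : Plane) :
    ∫ w : Plane, Real.cos (inner ℝ h w) * Real.exp (-t * ‖w‖ ^ 2) =
      Real.pi / t * Real.exp (-(‖h‖ ^ 2 / (4 * t))) := by
  have h1 := GaussianFourier.integral_cexp_neg_mul_sq_norm_add (b := (t : ℂ)) (by simpa using ht)
    Complex.I h
  have h2 := GaussianFourier.integrable_cexp_neg_mul_sq_norm_add (b := (t : ℂ)) (by simpa using ht)
    Complex.I h
  have h3 := congrArg Complex.re h1
  rw [← RCLike.re_eq_complex_re, ← integral_re h2] at h3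
  convert h3 using 1
  · refine integral_congr_ae (ae_of_all _ fun w => ?_)
    simp [Complex.exp_re, ← Complex.ofReal_pow, mul_comm]
  · simp only [finrank_euclideanSpace, Fintype.card_fin, Nat.cast_ofNat, RCLike.re_eq_complex_re]
    rw [show ((2 : ℂ) / 2) = 1 by norm_num, Complex.cpow_one, Complex.I_sq,
      show (-1 : ℂ) * (‖h‖ : ℂ) ^ 2 / (4 * (t : ℂ)) = ((-(‖h‖ ^ 2 / (4 * t)) : ℝ) : ℂ) by
        push_cast; ring, ← Complex.ofReal_exp, ← Complex.ofReal_div, ← Complex.ofReal_mul,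
      Complex.ofReal_re]

lemma integrable_gaussian_plane {t : ℝ} (ht : 0 < t) :
    Integrable fun w : Plane => Real.exp (-t * ‖w‖ ^ 2) := by
  have h2 := (GaussianFourier.integrable_cexp_neg_mul_sq_norm_add (b := (t : ℂ)) (by simpa using ht)
    0 (0 : Plane)).norm
  refine h2.congr (ae_of_all _ fun w => ?_)
  simp [Complex.norm_exp, ← Complex.ofReal_pow]

lemma integrable_cos_inner_mul_gaussian {t : ℝ} (ht : 0 < t) (h : Plane) :
    Integrable fun w : Plane => Real.cos (inner ℝ h w) * Real.exp (-t * ‖w‖ ^ 2) := by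
  refine (integrable_gaussian_plane ht).mono (by fun_prop) (ae_of_all _ fun w => ?_)
  rw [norm_mul]
  exact mul_le_of_le_one_left (norm_nonneg _) (by simpa using Real.abs_cos_le_one _)

lemma integral_one_sub_cos_mul_gaussian {t : ℝ} (ht : 0 < t) (h : Plane) :
    ∫ w : Plane, (1 - Real.cos (inner ℝ h w)) * Real.exp (-t * ‖w‖ ^ 2) =
      Real.pi / t * (1 - Real.exp (-(‖h‖ ^ 2 / (4 * t)))) := by
  have h0 := integral_cos_inner_mul_gaussian ht 0
  simp at h0
  simp_rw [sub_mul, one_mul]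
  rw [integral_sub (integrable_gaussian_plane ht) (integrable_cos_inner_mul_gaussian ht h),
    integral_cos_inner_mul_gaussian ht]
  simp only [neg_mul] at h0 ⊢
  rw [h0]; ring

/-- Near `0` the factor `1 - e^{-cu}` is at most `c u`, leaving `u ^ (-s)`, integrable as `s < 1`;
beyond `1` it is at most `1`, leaving `u ^ (-s - 1)`, integrable as `0 < s`. -/
lemma integrableOn_one_sub_exp_mul_rpow {s c : ℝ} (hs : 0 < s) (hs' : s < 1) (hc : 0 ≤ c) :
    IntegrableOn (fun u : ℝ => (1 - Real.exp (-(c * u))) * u ^ (-s - 1)) (Set.Ioi 0) := by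
  rw [← Set.Ioc_union_Ioi_eq_Ioi (zero_le_one (α := ℝ))]
  have hm : Measurable fun u : ℝ => (1 - Real.exp (-(c * u))) * u ^ (-s - 1) := by fun_prop
  refine IntegrableOn.union ?_ ?_
  · have hi : IntegrableOn (fun u : ℝ => c * u ^ (-s)) (Set.Ioc 0 1) := by
      have := (intervalIntegral.intervalIntegrable_rpow' (a := 0) (b := 1) (r := -s) (by linarith))
      rw [intervalIntegrable_iff_integrableOn_Ioc_of_le zero_le_one] at this
      exact this.const_mul c
    refine hi.mono' hm.aestronglyMeasurable ?_
    filter_upwards [ae_restrict_mem measurableSet_Ioc] with u hu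
    have hu0 : 0 < u := hu.1
    have h1 : 0 ≤ 1 - Real.exp (-(c * u)) := by
      rw [sub_nonneg, Real.exp_le_one_iff]; simpa using mul_nonneg hc hu0.le
    have h2 : 1 - Real.exp (-(c * u)) ≤ c * u := by
      have := Real.add_one_le_exp (-(c * u)); linarith
    rw [Real.norm_of_nonneg (mul_nonneg h1 (Real.rpow_nonneg hu0.le _))]
    calc _ ≤ c * u * u ^ (-s - 1) := by gcongr
      _ = c * u ^ (-s) := by
        rw [mul_assoc, ← Real.rpow_one_add' hu0.le (by linarith)]; ring_nf
  · refine (integrableOn_Ioi_rpow_of_lt (a := -s - 1) (by linarith) one_pos).mono'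
      hm.aestronglyMeasurable ?_
    filter_upwards [ae_restrict_mem measurableSet_Ioi] with u hu
    have hu0 : 0 < u := lt_trans one_pos hu
    have h1 : 0 ≤ 1 - Real.exp (-(c * u)) := by
      rw [sub_nonneg, Real.exp_le_one_iff]; simpa using mul_nonneg hc hu0.le
    rw [Real.norm_of_nonneg (mul_nonneg h1 (Real.rpow_nonneg hu0.le _))]
    exact mul_le_of_le_one_left (Real.rpow_nonneg hu0.le _) (by linarith [Real.exp_pos (-(c * u))])

/-- Integration by parts against the antiderivative `-s⁻¹ u ^ (-s)`: both boundary terms vanish,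
what remains is the integral of `Γ(1 - s)`, and `-Γ(-s) = Γ(1 - s) / s`. -/
lemma integral_one_sub_exp_mul_rpow {s c : ℝ} (hs : 0 < s) (hs' : s < 1) (hc : 0 < c) :
    ∫ u in Set.Ioi (0 : ℝ), (1 - Real.exp (-(c * u))) * u ^ (-s - 1) =
      c ^ s * -Real.Gamma (-s) := by
  have hG : -Real.Gamma (-s) = Real.Gamma (1 - s) / s := by
    have := Real.Gamma_add_one (s := -s) (by linarith)
    rw [show 1 - s = -s + 1 by ring, this]; field_simp
  have hint : IntegrableOn (fun u : ℝ => c * Real.exp (-(c * u)) * (-s⁻¹ * u ^ (-s)))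
      (Set.Ioi 0) := by
    have := Real.GammaIntegral_convergent (s := 1 - s) (by linarith)
    have h2 := (integrableOn_Ioi_comp_mul_left_iff
      (fun x => Real.exp (-x) * x ^ (1 - s - 1)) 0 hc).2 (by simpa using this)
    have h3 : IntegrableOn (fun x => -c * s⁻¹ * c ^ s * (Real.exp (-(c * x)) *
        (c * x) ^ (1 - s - 1))) (Set.Ioi 0) := h2.const_mul _
    refine h3.congr_fun (fun u hu => ?_) measurableSet_Ioi
    have hu0 : (0 : ℝ) < u := hu
    simp only
    rw [show 1 - s - 1 = -s by ring, Real.mul_rpow hc.le hu0.le, Real.rpow_neg hc.le]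
    have : c ^ s ≠ 0 := (Real.rpow_pos_of_pos hc s).ne'
    field_simp
  have key := integral_Ioi_mul_deriv_eq_deriv_mul (a := 0) (a' := (0 : ℝ)) (b' := 0)
    (u := fun u => 1 - Real.exp (-(c * u))) (v := fun u => -s⁻¹ * u ^ (-s))
    (u' := fun u => c * Real.exp (-(c * u))) (v' := fun u => u ^ (-s - 1)) ?_ ?_ ?_ ?_ ?_ ?_
  · rw [key]
    have h4 := Real.integral_rpow_mul_exp_neg_mul_Ioi (a := 1 - s) (r := c) (by linarith) hc
    have h5 : ∫ u in Set.Ioi (0 : ℝ), c * Real.exp (-(c * u)) * (-s⁻¹ * u ^ (-s)) =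
        (-c * s⁻¹) * ∫ u in Set.Ioi (0 : ℝ), u ^ (1 - s - 1) * Real.exp (-(c * u)) := by
      rw [← integral_const_mul]
      refine setIntegral_congr_fun measurableSet_Ioi (fun u hu => ?_)
      rw [show 1 - s - 1 = -s by ring]; ring
    rw [h5, h4, hG, one_div, Real.inv_rpow hc.le, Real.rpow_sub hc, Real.rpow_one]
    have : c ^ s ≠ 0 := (Real.rpow_pos_of_pos hc s).ne'
    field_simp; ring
  · intro x hx
    have := ((hasDerivAt_id x).const_mul c).neg.exp.const_sub 1
    refine this.congr_deriv ?_
    simp only [Pi.neg_apply, id, mul_one]; ring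
  · intro x hx
    have := (Real.hasDerivAt_rpow_const (x := x) (p := -s) (Or.inl (ne_of_gt hx))).const_mul (-s⁻¹)
    convert this using 1; field_simp
  · exact integrableOn_one_sub_exp_mul_rpow hs hs' hc.le
  · exact hint
  · have h1 : Tendsto (fun u : ℝ => c * s⁻¹ * u ^ (1 - s)) (𝓝[>] 0) (𝓝 0) := by
      have : ContinuousAt (fun u : ℝ => c * s⁻¹ * u ^ (1 - s)) 0 :=
        continuousAt_const.mul (Real.continuousAt_rpow_const _ _ (Or.inr (by linarith)))
      have h := this.tendsto
      simp only [Real.zero_rpow (by linarith : 1 - s ≠ 0), mul_zero] at h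
      exact h.mono_left nhdsWithin_le_nhds
    refine squeeze_zero_norm' ?_ h1
    filter_upwards [self_mem_nhdsWithin] with u hu
    have hu0 : (0 : ℝ) < u := hu
    have h1 : 0 ≤ 1 - Real.exp (-(c * u)) := by
      rw [sub_nonneg, Real.exp_le_one_iff]; simpa using mul_nonneg hc.le hu0.le
    have h2 : 1 - Real.exp (-(c * u)) ≤ c * u := by
      have := Real.add_one_le_exp (-(c * u)); linarith
    simp only [Pi.mul_apply, norm_mul, norm_neg]
    rw [Real.norm_of_nonneg h1, Real.norm_of_nonneg (inv_nonneg.2 hs.le),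
      Real.norm_of_nonneg (Real.rpow_nonneg hu0.le _)]
    calc _ ≤ c * u * (s⁻¹ * u ^ (-s)) := by gcongr
      _ = c * s⁻¹ * (u ^ (1 : ℝ) * u ^ (-s)) := by rw [Real.rpow_one]; ring
      _ = _ := by rw [← Real.rpow_add hu0]; ring_nf
  · have h1 : Tendsto (fun u : ℝ => s⁻¹ * u ^ (-s)) atTop (𝓝 0) := by
      simpa using (tendsto_rpow_neg_atTop hs).const_mul s⁻¹
    refine squeeze_zero_norm' ?_ h1
    filter_upwards [eventually_gt_atTop 0] with u hu0
    have h1 : 0 ≤ 1 - Real.exp (-(c * u)) := by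
      rw [sub_nonneg, Real.exp_le_one_iff]; simpa using mul_nonneg hc.le hu0.le
    simp only [Pi.mul_apply, norm_mul, norm_neg]
    rw [Real.norm_of_nonneg h1, Real.norm_of_nonneg (inv_nonneg.2 hs.le),
      Real.norm_of_nonneg (Real.rpow_nonneg hu0.le _)]
    exact mul_le_of_le_one_left (by positivity) (by linarith [Real.exp_pos (-(c * u))])

lemma integral_rpow_mul_one_sub_exp_div {s c : ℝ} (hs : 0 < s) (hs' : s < 1) (hc : 0 < c) :
    IntegrableOn (fun t : ℝ => t ^ (s - 1) * (1 - Real.exp (-(c / t)))) (Set.Ioi 0) ∧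
    ∫ t in Set.Ioi (0 : ℝ), t ^ (s - 1) * (1 - Real.exp (-(c / t))) =
      c ^ s * -Real.Gamma (-s) := by
  have h1 := integral_comp_rpow_Ioi
    (fun u : ℝ => (1 - Real.exp (-(c * u))) * u ^ (-s - 1)) (p := -1) (by norm_num)
  have h2 := (integrableOn_Ioi_comp_rpow_iff
    (fun u : ℝ => (1 - Real.exp (-(c * u))) * u ^ (-s - 1)) (p := -1) (by norm_num)).2
    (integrableOn_one_sub_exp_mul_rpow hs hs' hc.le)
  have h3 : ∀ t ∈ Set.Ioi (0 : ℝ), (|(-1 : ℝ)| * t ^ (-1 - 1 : ℝ)) •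
      ((1 - Real.exp (-(c * t ^ (-1 : ℝ)))) * (t ^ (-1 : ℝ)) ^ (-s - 1)) =
      t ^ (s - 1) * (1 - Real.exp (-(c / t))) := by
    intro t ht
    have ht0 : (0 : ℝ) < t := ht
    rw [smul_eq_mul, ← Real.rpow_mul ht0.le, abs_neg, abs_one, one_mul, Real.rpow_neg_one,
      ← div_eq_mul_inv, mul_left_comm, ← Real.rpow_add ht0, mul_comm]
    ring_nf
  rw [integral_one_sub_exp_mul_rpow hs hs' hc] at h1
  exact ⟨h2.congr_fun h3 measurableSet_Ioi, by
    rw [← h1]; exact (setIntegral_congr_fun measurableSet_Ioi h3).symm⟩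

lemma integrableOn_rpow_mul_exp_neg_mul {a r : ℝ} (ha : 0 < a) (hr : 0 < r) :
    IntegrableOn (fun t : ℝ => t ^ (a - 1) * Real.exp (-(r * t))) (Set.Ioi 0) := by
  -- A non-integrable function has Bochner integral `0`, against a positive known value.
  by_contra h
  have h1 := Real.integral_rpow_mul_exp_neg_mul_Ioi ha hr
  rw [integral_undef h] at h1
  have := Real.Gamma_pos_of_pos ha
  have : 0 < (1 / r) ^ a * Real.Gamma a := by positivity
  linarith

lemma one_sub_cos_nonneg (x : ℝ) : 0 ≤ 1 - Real.cos x := by linarith [Real.cos_le_one x]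

/-- Subordination: `Γ(1 + s) ‖w‖ ^ (-(2 + 2 s))` is the integral of `t ^ s e^{-t ‖w‖²}` over `t >
0`, and Tonelli leaves a Gaussian integral in `w` for each `t`. With lower integrals the exchange
needs no integrability, and finiteness is a by-product. -/
lemma lintegral_one_sub_cos_mul_rpow {s : ℝ} (hs : 0 < s) (hs' : s < 1) (h : Plane) :
    ∫⁻ w : Plane, ENNReal.ofReal ((1 - Real.cos (inner ℝ h w)) * ‖w‖ ^ (-(2 + 2 * s))) =
      ENNReal.ofReal (Real.pi * -Real.Gamma (-s) / (4 ^ s * Real.Gamma (1 + s)) *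
        ‖h‖ ^ (2 * s)) := by
  rcases eq_or_ne h 0 with rfl | hh
  · simp [Real.zero_rpow (by linarith : 2 * s ≠ 0)]
  have hh0 : 0 < ‖h‖ := norm_pos_iff.2 hh
  have hG : 0 < Real.Gamma (1 + s) := Real.Gamma_pos_of_pos (by linarith)
  set c : ℝ := ‖h‖ ^ 2 / 4 with hc_def
  have hc : 0 < c := by positivity
  have h1 : ∀ᵐ w : Plane, ENNReal.ofReal ((1 - Real.cos (inner ℝ h w)) * ‖w‖ ^ (-(2 + 2 * s))) =
      ∫⁻ t in Set.Ioi (0 : ℝ), ENNReal.ofReal ((Real.Gamma (1 + s))⁻¹ * t ^ s *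
        ((1 - Real.cos (inner ℝ h w)) * Real.exp (-t * ‖w‖ ^ 2))) := by
    have hne : ∀ᵐ w : Plane, w ≠ 0 := by
      simp [ae_iff, measure_singleton]
    filter_upwards [hne] with w hw
    have hw0 : 0 < ‖w‖ := norm_pos_iff.2 hw
    have e1 := Real.integral_rpow_mul_exp_neg_mul_Ioi (a := 1 + s) (r := ‖w‖ ^ 2) (by linarith)
      (by positivity)
    have e2 := integrableOn_rpow_mul_exp_neg_mul (a := 1 + s) (r := ‖w‖ ^ 2) (by linarith)
      (by positivity)
    have e3 : ∀ t : ℝ, (Real.Gamma (1 + s))⁻¹ * t ^ s *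
        ((1 - Real.cos (inner ℝ h w)) * Real.exp (-t * ‖w‖ ^ 2)) =
        ((Real.Gamma (1 + s))⁻¹ * (1 - Real.cos (inner ℝ h w))) *
          (t ^ (1 + s - 1) * Real.exp (-(‖w‖ ^ 2 * t))) := by
      intro t
      rw [show 1 + s - 1 = s by ring, show -t * ‖w‖ ^ 2 = -(‖w‖ ^ 2 * t) by ring]; ring
    simp_rw [e3]
    rw [← ofReal_integral_eq_lintegral_ofReal (e2.const_mul _), integral_const_mul, e1]
    · congr 1
      rw [show -(2 + 2 * s) = -(2 * (1 + s)) by ring, Real.rpow_neg hw0.le, Real.rpow_mul hw0.le,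
        one_div, Real.inv_rpow (by positivity), Real.rpow_two]
      field_simp
    · filter_upwards [ae_restrict_mem measurableSet_Ioi] with t ht
      have := one_sub_cos_nonneg (inner ℝ h w)
      have ht0 : (0 : ℝ) < t := ht
      simp only [Pi.zero_apply]; positivity
  rw [lintegral_congr_ae h1, lintegral_lintegral_swap]
  · have h2 : ∀ t ∈ Set.Ioi (0 : ℝ), ∫⁻ w : Plane, ENNReal.ofReal ((Real.Gamma (1 + s))⁻¹ * t ^ s *
        ((1 - Real.cos (inner ℝ h w)) * Real.exp (-t * ‖w‖ ^ 2))) =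
        ENNReal.ofReal ((Real.Gamma (1 + s))⁻¹ * Real.pi *
          (t ^ (s - 1) * (1 - Real.exp (-(c / t))))) := by
      intro t ht
      have ht0 : (0 : ℝ) < t := ht
      have hi : Integrable fun w : Plane =>
          (1 - Real.cos (inner ℝ h w)) * Real.exp (-t * ‖w‖ ^ 2) := by
        simp_rw [sub_mul, one_mul]
        exact (integrable_gaussian_plane ht0).sub (integrable_cos_inner_mul_gaussian ht0 h)
      rw [← ofReal_integral_eq_lintegral_ofReal (hi.const_mul _), integral_const_mul,
        integral_one_sub_cos_mul_gaussian ht0]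
      · congr 1
        rw [Real.rpow_sub_one ht0.ne', hc_def, div_div]; ring
      · refine ae_of_all _ fun w => ?_
        have := one_sub_cos_nonneg (inner ℝ h w)
        simp only [Pi.zero_apply]; positivity
    obtain ⟨i1, i2⟩ := integral_rpow_mul_one_sub_exp_div hs hs' hc
    rw [setLIntegral_congr_fun measurableSet_Ioi h2,
      ← ofReal_integral_eq_lintegral_ofReal (i1.const_mul _), integral_const_mul, i2]
    · congr 1
      rw [hc_def, Real.div_rpow (by positivity) (by norm_num), Real.rpow_mul hh0.le, Real.rpow_two]
      field_simp
    · filter_upwards [ae_restrict_mem measurableSet_Ioi] with t ht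
      have ht0 : (0 : ℝ) < t := ht
      have : 0 ≤ 1 - Real.exp (-(c / t)) := by
        rw [sub_nonneg, Real.exp_le_one_iff, neg_nonpos]; positivity
      simp only [Pi.zero_apply]; positivity
  · refine Measurable.aemeasurable ?_
    simp only [Function.uncurry_def]
    fun_prop

lemma neg_Gamma_neg_pos {s : ℝ} (hs : 0 < s) (hs' : s < 1) : 0 < -Real.Gamma (-s) := by
  have := Real.Gamma_add_one (s := -s) (by linarith)
  have h2 : 0 < Real.Gamma (-s + 1) := Real.Gamma_pos_of_pos (by linarith)
  rw [this] at h2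
  nlinarith

variable {φ₁ φ₂ : ℝ}

lemma planeDensity_nonneg (hφ₁ : 0 < φ₁) (hφ₂ : 0 < φ₂) (w : Plane) :
    0 ≤ planeDensity φ₁ φ₂ w := by
  have := Real.Gamma_pos_of_pos (show 0 < 1 + φ₂ by linarith)
  unfold planeDensity; positivity

lemma measurable_planeDensity : Measurable (planeDensity φ₁ φ₂) := by
  unfold planeDensity; fun_prop

lemma integrable_one_sub_cos_mul_planeDensity (hφ₂ : 0 < φ₂) (hφ₂' : φ₂ < 1) (h : Plane) :
    Integrable fun w : Plane => (1 - Real.cos (inner ℝ h w)) * planeDensity φ₁ φ₂ w := by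
  have hm : AEStronglyMeasurable (fun w : Plane => (1 - Real.cos (inner ℝ h w)) *
      ‖w‖ ^ (-(2 + 2 * φ₂))) := by
    refine Measurable.aestronglyMeasurable ?_; fun_prop
  have : Integrable fun w : Plane => (1 - Real.cos (inner ℝ h w)) * ‖w‖ ^ (-(2 + 2 * φ₂)) := by
    refine ⟨hm, ?_⟩
    rw [hasFiniteIntegral_iff_ofReal, lintegral_one_sub_cos_mul_rpow hφ₂ hφ₂']
    · exact ENNReal.ofReal_lt_top
    · refine ae_of_all _ fun w => ?_
      have := one_sub_cos_nonneg (inner ℝ h w)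
      simp only [Pi.zero_apply]; positivity
  refine (this.const_mul ((2 : ℝ) ^ (2 * φ₂ + 2) * Real.pi * Real.Gamma (1 + φ₂) * φ₁)).congr
    (ae_of_all _ fun w => ?_)
  simp only [planeDensity]; ring

/-- The generalized covariance is minus the spectral integral of `1 - cos`. -/
theorem integral_one_sub_cos_mul_planeDensity (hφ₂ : 0 < φ₂) (hφ₂' : φ₂ < 1)
    (h : Plane) :
    ((2 * Real.pi) ^ 2)⁻¹ * ∫ w : Plane, (1 - Real.cos (inner ℝ h w)) * planeDensity φ₁ φ₂ w =
      -genCov φ₁ φ₂ h := by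
  have e1 : ∫ w : Plane, (1 - Real.cos (inner ℝ h w)) * ‖w‖ ^ (-(2 + 2 * φ₂)) =
      Real.pi * -Real.Gamma (-φ₂) / (4 ^ φ₂ * Real.Gamma (1 + φ₂)) * ‖h‖ ^ (2 * φ₂) := by
    rw [integral_eq_lintegral_of_nonneg_ae, lintegral_one_sub_cos_mul_rpow hφ₂ hφ₂',
      ENNReal.toReal_ofReal]
    · have := neg_Gamma_neg_pos hφ₂ hφ₂'
      have := Real.Gamma_pos_of_pos (show 0 < 1 + φ₂ by linarith)
      positivity
    · refine ae_of_all _ fun w => ?_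
      have := one_sub_cos_nonneg (inner ℝ h w)
      simp only [Pi.zero_apply]; positivity
    · refine Measurable.aestronglyMeasurable ?_; fun_prop
  have e2 : ∀ w : Plane, (1 - Real.cos (inner ℝ h w)) * planeDensity φ₁ φ₂ w =
      ((2 : ℝ) ^ (2 * φ₂ + 2) * Real.pi * Real.Gamma (1 + φ₂) * φ₁) *
        ((1 - Real.cos (inner ℝ h w)) * ‖w‖ ^ (-(2 + 2 * φ₂))) := by
    intro w; simp only [planeDensity]; ring
  simp_rw [e2]
  rw [integral_const_mul, e1, genCov]
  have := (Real.Gamma_pos_of_pos (show 0 < 1 + φ₂ by linarith)).ne'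
  have h4 : (2 : ℝ) ^ (2 * φ₂ + 2) = 4 * 4 ^ φ₂ := by
    rw [Real.rpow_add two_pos, Real.rpow_mul two_pos.le, Real.rpow_two]; norm_num
    ring
  have h5 : (4 : ℝ) ^ φ₂ ≠ 0 := (Real.rpow_pos_of_pos (by norm_num) _).ne'
  rw [h4]
  field_simp
  norm_num

end PowerLaw
end

noncomputable section
namespace PowerLaw

variable {φ₁ φ₂ : ℝ}

/-! ### Folding integrals over the plane onto the torus -/

/-- The dual lattice vector `2π m`. -/
def dualPoint (m : ℤ × ℤ) : Plane := !₂[2 * Real.pi * (m.1 : ℝ), 2 * Real.pi * (m.2 : ℝ)]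

@[simp] lemma dualPoint_apply_zero (m : ℤ × ℤ) : dualPoint m 0 = 2 * Real.pi * m.1 := rfl
@[simp] lemma dualPoint_apply_one (m : ℤ × ℤ) : dualPoint m 1 = 2 * Real.pi * m.2 := rfl

lemma latticeDensity_eq (w : Plane) :
    latticeDensity φ₁ φ₂ w = ∑' m : ℤ × ℤ, planeDensity φ₁ φ₂ (w + dualPoint m) := rfl

lemma measurableSet_torus : MeasurableSet torus := by
  have : torus = ⋂ i : Fin 2, (fun w : Plane => w i) ⁻¹' Set.Ioc (-Real.pi) Real.pi := by
    ext; simp [torus]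
  rw [this]
  exact MeasurableSet.iInter fun i => measurableSet_Ioc.preimage (by fun_prop)

/-- The torus translated by `-2π m`. -/
def torusTranslate (m : ℤ × ℤ) : Set Plane := (fun w => w + dualPoint m) ⁻¹' torus

lemma measurableSet_torusTranslate (m : ℤ × ℤ) : MeasurableSet (torusTranslate m) :=
  measurableSet_torus.preimage (by fun_prop)

lemma mem_torusTranslate_iff {m : ℤ × ℤ} {w : Plane} :
    w ∈ torusTranslate m ↔ w 0 + 2 * Real.pi * m.1 ∈ Set.Ioc (-Real.pi) Real.pi ∧
      w 1 + 2 * Real.pi * m.2 ∈ Set.Ioc (-Real.pi) Real.pi := by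
  simp [torusTranslate, torus, Fin.forall_fin_two]

lemma existsUnique_add_mem_Ioc (x : ℝ) :
    ∃! m : ℤ, x + 2 * Real.pi * m ∈ Set.Ioc (-Real.pi) Real.pi := by
  have := existsUnique_add_zsmul_mem_Ioc (a := 2 * Real.pi) Real.two_pi_pos x (-Real.pi)
  have h2 : -Real.pi + 2 * Real.pi = Real.pi := by ring
  rw [h2] at this
  simpa [mul_comm] using this

lemma iUnion_torusTranslate : ⋃ m, torusTranslate m = Set.univ := by
  refine Set.eq_univ_of_forall fun w => ?_
  obtain ⟨m, hm, -⟩ := existsUnique_add_mem_Ioc (w 0)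
  obtain ⟨n, hn, -⟩ := existsUnique_add_mem_Ioc (w 1)
  exact Set.mem_iUnion.2 ⟨(m, n), mem_torusTranslate_iff.2 ⟨hm, hn⟩⟩

lemma pairwise_disjoint_torusTranslate :
    Pairwise (Function.onFun Disjoint torusTranslate) := by
  intro m n hmn
  refine Set.disjoint_left.2 fun w hm hn => hmn ?_
  rw [mem_torusTranslate_iff] at hm hn
  exact Prod.ext ((existsUnique_add_mem_Ioc (w 0)).unique hm.1 hn.1)
    ((existsUnique_add_mem_Ioc (w 1)).unique hm.2 hn.2)

lemma setIntegral_torusTranslate {E : Type*} [NormedAddCommGroup E] [NormedSpace ℝ E]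
    (G : Plane → E) (m : ℤ × ℤ) :
    ∫ w in torusTranslate m, G w = ∫ w in torus, G (w + dualPoint (-m)) := by
  have h := (measurePreserving_add_right (volume : Measure Plane)
    (dualPoint m)).setIntegral_preimage_emb
    (MeasurableEquiv.addRight (dualPoint m)).measurableEmbedding
    (fun w => G (w + dualPoint (-m))) torus
  rw [← h]
  refine setIntegral_congr_fun (measurableSet_torusTranslate m) fun w _ => ?_
  have : w + dualPoint m + dualPoint (-m) = w := by
    ext i; fin_cases i <;> simp
  simp only [this]

lemma integrableOn_torus_comp_add {E : Type*} [NormedAddCommGroup E] [NormedSpace ℝ E]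
    {G : Plane → E} (hG : Integrable G) (m : ℤ × ℤ) :
    IntegrableOn (fun w => G (w + dualPoint m)) torus :=
  ((measurePreserving_add_right (volume : Measure Plane)
    (dualPoint m)).integrable_comp_of_integrable hG).integrableOn

/-- The integral over the plane is the integral over the torus of the periodization. -/
lemma integral_plane_eq_integral_torus_tsum {E : Type*} [NormedAddCommGroup E] [NormedSpace ℝ E]
    [CompleteSpace E] {G : Plane → E} (hG : Integrable G) :
    ∫ w, G w = ∫ w in torus, ∑' m : ℤ × ℤ, G (w + dualPoint m) := by
  have h1 := hasSum_integral_iUnion (μ := (volume : Measure Plane)) (f := G)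
    measurableSet_torusTranslate pairwise_disjoint_torusTranslate
    hG.integrableOn
  have h2 := hasSum_integral_iUnion (μ := (volume : Measure Plane)) (f := fun w => ‖G w‖)
    measurableSet_torusTranslate pairwise_disjoint_torusTranslate
    hG.norm.integrableOn
  rw [iUnion_torusTranslate, Measure.restrict_univ] at h1
  simp only [setIntegral_torusTranslate] at h1 h2
  have h3 := hasSum_integral_of_summable_integral_norm
    (fun m : ℤ × ℤ => integrableOn_torus_comp_add hG (-m)) h2.summable
  rw [h1.unique h3]
  refine integral_congr_ae (ae_of_all _ fun w => ?_)
  exact (Equiv.neg (ℤ × ℤ)).tsum_eq fun m => G (w + dualPoint m)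

/-- A periodic factor comes out of the periodization, so only the density is aliased. -/
lemma integral_mul_planeDensity_eq {F : Plane → ℂ} (hF : ∀ w m, F (w + dualPoint m) = F w)
    (hi : Integrable fun w => F w * (planeDensity φ₁ φ₂ w : ℂ)) :
    ∫ w, F w * (planeDensity φ₁ φ₂ w : ℂ) = ∫ w in torus, F w * (latticeDensity φ₁ φ₂ w : ℂ) := by
  rw [integral_plane_eq_integral_torus_tsum hi]
  refine integral_congr_ae (ae_of_all _ fun w => ?_)
  simp only [hF, latticeDensity_eq]
  rw [tsum_mul_left, Complex.ofReal_tsum]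

/-! ### The aliased spectral density -/

lemma measurable_latticeDensity (hφ₁ : 0 < φ₁) (hφ₂ : 0 < φ₂) :
    Measurable (latticeDensity φ₁ φ₂) := by
  -- A sum in `ℝ≥0∞` is measurable without any summability; `toReal` sends a divergent sum to `0`,
  -- which is also the default value of the real `tsum`.
  have : latticeDensity φ₁ φ₂ = fun w => (∑' m : ℤ × ℤ,
      ENNReal.ofReal (planeDensity φ₁ φ₂ (w + dualPoint m))).toReal := by
    ext w
    rw [ENNReal.tsum_toReal_eq (fun _ => ENNReal.ofReal_ne_top), latticeDensity_eq]
    simp_rw [ENNReal.toReal_ofReal (planeDensity_nonneg hφ₁ hφ₂ _)]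
  rw [this]
  refine Measurable.ennreal_toReal (Measurable.tsum fun m => ?_)
  exact (measurable_planeDensity.comp (by fun_prop)).ennreal_ofReal

lemma latticeDensity_nonneg (hφ₁ : 0 < φ₁) (hφ₂ : 0 < φ₂) (w : Plane) :
    0 ≤ latticeDensity φ₁ φ₂ w :=
  tsum_nonneg fun _ => planeDensity_nonneg hφ₁ hφ₂ _

lemma abs_coord_le_norm (w : Plane) (i : Fin 2) : |w i| ≤ ‖w‖ := by
  simpa using PiLp.norm_apply_le w i

/-- For `k ≠ 0`, `|x + 2πk| ≥ 2π|k| - π ≥ π|k|`. -/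
lemma pi_mul_abs_le {x : ℝ} (hx : x ∈ Set.Ioc (-Real.pi) Real.pi) (k : ℤ) :
    Real.pi * |(k : ℝ)| ≤ |x + 2 * Real.pi * k| := by
  rcases eq_or_ne k 0 with rfl | hk
  · simp
  have h1 : (1 : ℝ) ≤ |(k : ℝ)| := by exact_mod_cast Int.one_le_abs hk
  have h2 : |2 * Real.pi * (k : ℝ)| = 2 * Real.pi * |(k : ℝ)| := by
    rw [abs_mul, abs_of_pos Real.two_pi_pos]
  have h3 : |x| ≤ Real.pi := abs_le.2 ⟨hx.1.le, hx.2⟩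
  have h4 : |2 * Real.pi * (k : ℝ)| ≤ |x + 2 * Real.pi * k| + |x| := by
    have := abs_sub (x + 2 * Real.pi * k) x
    simpa using this
  nlinarith [Real.pi_pos]

lemma pi_mul_norm_le_norm_add_dualPoint {w : Plane} (hw : w ∈ torus) (m : ℤ × ℤ) :
    Real.pi * ‖m‖ ≤ ‖w + dualPoint m‖ := by
  have h0 := (pi_mul_abs_le (hw 0) m.1).trans (abs_coord_le_norm (w + dualPoint m) 0)
  have h1 := (pi_mul_abs_le (hw 1) m.2).trans (abs_coord_le_norm (w + dualPoint m) 1)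
  rw [Prod.norm_def, Int.norm_eq_abs, Int.norm_eq_abs]
  rcases max_cases |(m.1 : ℝ)| |(m.2 : ℝ)| with h | h <;> rw [h.1] <;> assumption

lemma summable_norm_rpow {k : ℝ} (hk : 2 < k) : Summable fun m : ℤ × ℤ => ‖m‖ ^ (-k) := by
  rw [← (finTwoArrowEquiv ℤ).summable_iff]
  -- The norm of `ℤ × ℤ` is the maximum norm, the one used for the lattice sums of Eisenstein
  -- series.
  refine (EisensteinSeries.summable_one_div_norm_rpow hk).congr fun x => ?_
  congr 1
  simp [Prod.norm_def, finTwoArrowEquiv, EisensteinSeries.norm_eq_max_natAbs, Int.norm_eq_abs]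

/-- The constant in `planeDensity`. -/
def densityConst (φ₁ φ₂ : ℝ) : ℝ := (2 : ℝ) ^ (2 * φ₂ + 2) * Real.pi * Real.Gamma (1 + φ₂) * φ₁

lemma densityConst_pos (hφ₁ : 0 < φ₁) (hφ₂ : 0 < φ₂) : 0 < densityConst φ₁ φ₂ := by
  have := Real.Gamma_pos_of_pos (show 0 < 1 + φ₂ by linarith)
  unfold densityConst; positivity

lemma planeDensity_eq (w : Plane) :
    planeDensity φ₁ φ₂ w = densityConst φ₁ φ₂ * ‖w‖ ^ (-(2 + 2 * φ₂)) := rfl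

lemma planeDensity_add_dualPoint_le (hφ₁ : 0 < φ₁) (hφ₂ : 0 < φ₂) {w : Plane} (hw : w ∈ torus)
    {m : ℤ × ℤ} (hm : m ≠ 0) :
    planeDensity φ₁ φ₂ (w + dualPoint m) ≤ densityConst φ₁ φ₂ * ‖m‖ ^ (-(2 + 2 * φ₂)) := by
  rw [planeDensity_eq]
  have hm0 : 0 < ‖m‖ := norm_pos_iff.2 hm
  refine mul_le_mul_of_nonneg_left ?_ (densityConst_pos hφ₁ hφ₂).le
  refine Real.rpow_le_rpow_of_nonpos hm0 ?_ (by linarith)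
  refine le_trans ?_ (pi_mul_norm_le_norm_add_dualPoint hw m)
  nlinarith [Real.pi_gt_three]

lemma summable_planeDensity (hφ₁ : 0 < φ₁) (hφ₂ : 0 < φ₂) {w : Plane} (hw : w ∈ torus) :
    Summable fun m : ℤ × ℤ => planeDensity φ₁ φ₂ (w + dualPoint m) := by
  have h := (summable_norm_rpow (k := 2 + 2 * φ₂) (by linarith)).mul_left (densityConst φ₁ φ₂)
  refine Summable.of_norm_bounded_eventually h ?_
  rw [Filter.eventually_cofinite]
  refine (Set.finite_singleton (0 : ℤ × ℤ)).subset fun m hm => ?_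
  by_contra h0
  refine hm ?_
  rw [Real.norm_of_nonneg (planeDensity_nonneg hφ₁ hφ₂ _)]
  exact planeDensity_add_dualPoint_le hφ₁ hφ₂ hw h0

lemma planeDensity_le_latticeDensity (hφ₁ : 0 < φ₁) (hφ₂ : 0 < φ₂) {w : Plane} (hw : w ∈ torus) :
    planeDensity φ₁ φ₂ w ≤ latticeDensity φ₁ φ₂ w := by
  have := (summable_planeDensity hφ₁ hφ₂ hw).le_tsum 0
    (fun _ _ => planeDensity_nonneg hφ₁ hφ₂ _)
  have h0 : dualPoint 0 = 0 := by ext i; fin_cases i <;> simp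
  rw [latticeDensity_eq]
  simpa [h0] using this

lemma latticeDensity_le (hφ₁ : 0 < φ₁) (hφ₂ : 0 < φ₂) {w : Plane} (hw : w ∈ torus) :
    latticeDensity φ₁ φ₂ w ≤ planeDensity φ₁ φ₂ w +
      densityConst φ₁ φ₂ * ∑' m : ℤ × ℤ, ‖m‖ ^ (-(2 + 2 * φ₂)) := by
  have hs := (summable_norm_rpow (k := 2 + 2 * φ₂) (by linarith)).mul_left (densityConst φ₁ φ₂)
  have h0 : dualPoint 0 = 0 := by ext i; fin_cases i <;> simp
  have h1 : HasSum (fun m : ℤ × ℤ => if m = 0 then planeDensity φ₁ φ₂ w else 0)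
      (planeDensity φ₁ φ₂ w) := hasSum_ite_eq 0 _
  rw [latticeDensity_eq, ← tsum_mul_left, ← h1.tsum_eq, ← h1.summable.tsum_add hs]
  refine (summable_planeDensity hφ₁ hφ₂ hw).tsum_le_tsum (fun m => ?_) (h1.summable.add hs)
  by_cases hm : m = 0
  · subst hm
    have := (densityConst_pos hφ₁ hφ₂).le
    simp only [h0, add_zero, if_true, le_add_iff_nonneg_right]
    positivity
  · simpa [hm] using planeDensity_add_dualPoint_le hφ₁ hφ₂ hw hm

/-! ### The symbol of the bilinear difference -/

lemma norm_symbol_le_four (r : ℕ) (w : Plane) : ‖symbol r w‖ ≤ 4 := by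
  have h : ∀ x : ℝ, ‖1 - Complex.exp (Complex.I * r * x)‖ ≤ 2 := fun x => by
    refine (norm_sub_le _ _).trans ?_
    rw [show Complex.I * r * x = Complex.I * ((r * x : ℝ) : ℂ) by push_cast; ring,
      mul_comm, Complex.norm_exp_ofReal_mul_I]
    norm_num
  rw [symbol, norm_mul]
  nlinarith [h (w 0), h (w 1), norm_nonneg (1 - Complex.exp (Complex.I * r * (w 0 : ℂ))),
    norm_nonneg (1 - Complex.exp (Complex.I * r * (w 1 : ℂ)))]

/-- Each factor obeys `|1 - e^{iθ}| ≤ |θ|`; the resulting second-order zero at the origin is what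
tames the spectral density. -/
lemma norm_symbol_le_norm_sq (r : ℕ) (w : Plane) : ‖symbol r w‖ ≤ (r * ‖w‖) ^ 2 := by
  have h : ∀ i : Fin 2, ‖1 - Complex.exp (Complex.I * r * (w i : ℂ))‖ ≤ r * ‖w‖ := fun i => by
    rw [norm_sub_rev, show Complex.I * r * (w i : ℂ) = Complex.I * ((r * w i : ℝ) : ℂ) by
      push_cast; ring]
    refine Real.norm_exp_I_mul_ofReal_sub_one_le.trans ?_
    rw [norm_mul]
    exact mul_le_mul (by simp) (PiLp.norm_apply_le w i) (norm_nonneg _) (by positivity)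
  rw [symbol, norm_mul, sq]
  exact mul_le_mul (h 0) (h 1) (norm_nonneg _) (by positivity)

lemma norm_le_of_mem_torus {w : Plane} (hw : w ∈ torus) : ‖w‖ ≤ 6 := by
  have h : ∀ i, w i ^ 2 ≤ 16 := fun i => by
    have := hw i
    have h3 := Real.pi_le_four
    nlinarith [this.1, this.2]
  have h2 := EuclideanSpace.real_norm_sq_eq w
  rw [Fin.sum_univ_two] at h2
  nlinarith [h 0, h 1, norm_nonneg w]

/-- The spectral density of the bilinear differences is bounded. -/
lemma exists_norm_symbol_sq_mul_latticeDensity_le (hφ₁ : 0 < φ₁) (hφ₂ : 0 < φ₂) (hφ₂' : φ₂ < 1)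
    (r : ℕ) : ∃ B : ℝ, 0 ≤ B ∧ ∀ w ∈ torus, ‖symbol r w‖ ^ 2 * latticeDensity φ₁ φ₂ w ≤ B := by
  set S := ∑' m : ℤ × ℤ, ‖m‖ ^ (-(2 + 2 * φ₂)) with hS
  have hS0 : 0 ≤ S := tsum_nonneg fun m => by positivity
  have hc := densityConst_pos hφ₁ hφ₂
  -- The term `m = 0` contributes a multiple of `‖w‖ ^ (4 - (2 + 2 φ₂))`, a positive power because
  -- `φ₂ < 1`, with `‖w‖ ≤ 6` on the torus. The other terms sum to a bounded function, multiplied by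
  -- `‖symbol‖² ≤ 16`.
  refine ⟨r ^ 4 * densityConst φ₁ φ₂ * 6 ^ (2 - 2 * φ₂) + 16 * (densityConst φ₁ φ₂ * S),
    by positivity, fun w hw => ?_⟩
  have h1 := latticeDensity_le hφ₁ hφ₂ hw
  have h2 : ‖symbol r w‖ ^ 2 ≤ 16 := by
    nlinarith [norm_symbol_le_four r w, norm_nonneg (symbol r w)]
  calc ‖symbol r w‖ ^ 2 * latticeDensity φ₁ φ₂ w
      ≤ ‖symbol r w‖ ^ 2 * (planeDensity φ₁ φ₂ w + densityConst φ₁ φ₂ * S) := by gcongr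
    _ = ‖symbol r w‖ ^ 2 * planeDensity φ₁ φ₂ w + ‖symbol r w‖ ^ 2 * (densityConst φ₁ φ₂ * S) := by
        ring
    _ ≤ _ := ?_
  refine add_le_add ?_ (by gcongr)
  rcases eq_or_ne w 0 with rfl | hw0
  · simp [symbol]; positivity
  have hn : 0 < ‖w‖ := norm_pos_iff.2 hw0
  calc ‖symbol r w‖ ^ 2 * planeDensity φ₁ φ₂ w
      ≤ ((r * ‖w‖) ^ 2) ^ 2 * planeDensity φ₁ φ₂ w := by
        have := planeDensity_nonneg hφ₁ hφ₂ w
        gcongr; exact norm_symbol_le_norm_sq r w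
    _ = r ^ 4 * densityConst φ₁ φ₂ * (‖w‖ ^ (4 : ℝ) * ‖w‖ ^ (-(2 + 2 * φ₂))) := by
        rw [planeDensity_eq, show (4 : ℝ) = (4 : ℕ) by norm_num, Real.rpow_natCast]; ring
    _ = r ^ 4 * densityConst φ₁ φ₂ * ‖w‖ ^ (2 - 2 * φ₂) := by
        rw [← Real.rpow_add hn]; ring_nf
    _ ≤ _ := by
        gcongr
        · linarith
        · exact norm_le_of_mem_torus hw

end PowerLaw
end

open scoped ComplexConjugate
noncomputable section
namespace PowerLaw

variable {φ₁ φ₂ : ℝ}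

/-! ### Covariances of bilinear differences -/

/-- The lattice point `k` of the plane. -/
def latticePoint (k : ℤ × ℤ) : Plane := !₂[(k.1 : ℝ), (k.2 : ℝ)]

@[simp] lemma latticePoint_apply_zero (k : ℤ × ℤ) : latticePoint k 0 = k.1 := rfl
@[simp] lemma latticePoint_apply_one (k : ℤ × ℤ) : latticePoint k 1 = k.2 := rfl

/-- The corners of the unit square. -/
def corner : Fin 4 → ℤ × ℤ := ![(0, 0), (1, 0), (0, 1), (1, 1)]

/-- The signs of the corners in the bilinear difference. -/
def cornerSign : Fin 4 → ℝ := ![1, -1, -1, 1]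

/-- The covariance of the bilinear differences with steps `a`, `b` at lattice points `s`, `t` with
`s - t = k`. -/
def diffCov (φ₁ φ₂ : ℝ) (a b : ℕ) (k : ℤ × ℤ) : ℝ :=
  ∑ p, ∑ q, cornerSign p * cornerSign q *
    genCov φ₁ φ₂ (latticePoint (k + (a : ℤ) • corner p - (b : ℤ) • corner q))

/-- The character `w ↦ exp(i k·w)`. -/
def wave (k : ℤ × ℤ) (w : Plane) : ℂ := Complex.exp (Complex.I * (k.1 * w 0 + k.2 * w 1 : ℝ))

lemma wave_add (k l : ℤ × ℤ) (w : Plane) : wave (k + l) w = wave k w * wave l w := by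
  simp only [wave, ← Complex.exp_add]; congr 1; push_cast [Prod.fst_add, Prod.snd_add]; ring

lemma conj_wave (k : ℤ × ℤ) (w : Plane) : conj (wave k w) = wave (-k) w := by
  simp only [wave, ← Complex.exp_conj]; congr 1
  simp only [map_mul, Complex.conj_I, Complex.conj_ofReal]; push_cast [Prod.fst_neg, Prod.snd_neg]
  ring

lemma wave_sub (k l : ℤ × ℤ) (w : Plane) : wave (k - l) w = wave k w * conj (wave l w) := by
  rw [sub_eq_add_neg, wave_add, conj_wave]

@[simp] lemma norm_wave (k : ℤ × ℤ) (w : Plane) : ‖wave k w‖ = 1 := by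
  rw [wave, mul_comm, Complex.norm_exp_ofReal_mul_I]

lemma wave_neg_arg (k : ℤ × ℤ) (w : Plane) : wave k (-w) = conj (wave k w) := by
  rw [conj_wave, wave, wave]; congr 2; simp

lemma continuous_wave (k : ℤ × ℤ) : Continuous (wave k) := by unfold wave; fun_prop

lemma re_wave (k : ℤ × ℤ) (w : Plane) :
    (wave k w).re = Real.cos (inner ℝ (latticePoint k) w) := by
  rw [wave, mul_comm, Complex.exp_ofReal_mul_I_re]
  congr 1
  simp [PiLp.inner_apply, Fin.sum_univ_two, mul_comm]

lemma wave_add_dualPoint (k : ℤ × ℤ) (w : Plane) (m : ℤ × ℤ) :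
    wave k (w + dualPoint m) = wave k w := by
  rw [wave, wave, Complex.exp_eq_exp_iff_exists_int]
  refine ⟨k.1 * m.1 + k.2 * m.2, ?_⟩
  simp only [PiLp.add_apply, dualPoint_apply_zero, dualPoint_apply_one]
  push_cast; ring

lemma symbol_eq_sum (r : ℕ) (w : Plane) :
    symbol r w = ∑ p, cornerSign p * wave ((r : ℤ) • corner p) w := by
  simp [Fin.sum_univ_four, cornerSign, corner, wave, symbol]
  rw [mul_add, Complex.exp_add]
  simp only [mul_assoc]
  ring

lemma continuous_symbol (r : ℕ) : Continuous (symbol r) := by unfold symbol; fun_prop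

/-- The cross-spectral symbol of the bilinear differences with steps `a` and `b`. -/
def crossSymbol (a b : ℕ) (k : ℤ × ℤ) (w : Plane) : ℂ :=
  wave k w * (symbol a w * conj (symbol b w))

lemma crossSymbol_eq_sum (a b : ℕ) (k : ℤ × ℤ) (w : Plane) :
    crossSymbol a b k w = ∑ p, ∑ q, (cornerSign p * cornerSign q : ℝ) *
      wave (k + (a : ℤ) • corner p - (b : ℤ) • corner q) w := by
  rw [crossSymbol, symbol_eq_sum, symbol_eq_sum, map_sum, Finset.sum_mul_sum]
  simp only [map_mul, Complex.conj_ofReal, Finset.mul_sum, wave_sub, wave_add, Complex.ofReal_mul]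
  exact Finset.sum_congr rfl fun p _ => Finset.sum_congr rfl fun q _ => by ring

lemma sum_cornerSign_mul : ∑ p, ∑ q, cornerSign p * cornerSign q = 0 := by
  simp [← Finset.mul_sum, Fin.sum_univ_four, cornerSign]

/-- The signs sum to zero, so `cos` may be replaced by `cos - 1`, which is integrable against the
density. -/
lemma re_crossSymbol (a b : ℕ) (k : ℤ × ℤ) (w : Plane) :
    (crossSymbol a b k w).re = -∑ p, ∑ q, cornerSign p * cornerSign q *
      (1 - Real.cos (inner ℝ (latticePoint (k + (a : ℤ) • corner p - (b : ℤ) • corner q)) w)) := by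
  simp only [crossSymbol_eq_sum, Complex.re_sum, Complex.re_ofReal_mul, re_wave, mul_sub, mul_one,
    Finset.sum_sub_distrib, sum_cornerSign_mul, zero_sub, neg_neg]

lemma continuous_crossSymbol (a b : ℕ) (k : ℤ × ℤ) : Continuous (crossSymbol a b k) :=
  (continuous_wave k).mul ((continuous_symbol a).mul
    (Complex.continuous_conj.comp (continuous_symbol b)))

lemma crossSymbol_add_dualPoint (a b : ℕ) (k : ℤ × ℤ) (w : Plane) (m : ℤ × ℤ) :
    crossSymbol a b k (w + dualPoint m) = crossSymbol a b k w := by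
  simp only [crossSymbol_eq_sum, wave_add_dualPoint]

lemma crossSymbol_neg_arg (a b : ℕ) (k : ℤ × ℤ) (w : Plane) :
    crossSymbol a b k (-w) = conj (crossSymbol a b k w) := by
  simp only [crossSymbol_eq_sum, wave_neg_arg, map_sum, map_mul, Complex.conj_ofReal]

lemma norm_crossSymbol (a b : ℕ) (k : ℤ × ℤ) (w : Plane) :
    ‖crossSymbol a b k w‖ = ‖symbol a w‖ * ‖symbol b w‖ := by
  simp [crossSymbol]

lemma crossSymbol_self_zero (a : ℕ) (w : Plane) :
    crossSymbol a a 0 w = ((‖symbol a w‖ ^ 2 : ℝ) : ℂ) := by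
  simp [crossSymbol, wave, Complex.mul_conj, Complex.normSq_eq_norm_sq]

lemma integrable_re_crossSymbol_mul (hφ₂ : 0 < φ₂) (hφ₂' : φ₂ < 1) (a b : ℕ) (k : ℤ × ℤ) :
    Integrable fun w => (crossSymbol a b k w).re * planeDensity φ₁ φ₂ w := by
  simp only [re_crossSymbol, neg_mul, Finset.sum_mul]
  refine (integrable_finsetSum _ fun p _ => integrable_finsetSum _ fun q _ => ?_).neg
  simp only [mul_assoc]
  exact ((integrable_one_sub_cos_mul_planeDensity hφ₂ hφ₂' _).const_mul _).const_mul _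

lemma integral_re_crossSymbol_mul (hφ₂ : 0 < φ₂) (hφ₂' : φ₂ < 1) (a b : ℕ) (k : ℤ × ℤ) :
    ((2 * Real.pi) ^ 2)⁻¹ * ∫ w, (crossSymbol a b k w).re * planeDensity φ₁ φ₂ w =
      diffCov φ₁ φ₂ a b k := by
  have hi : ∀ p q : Fin 4, Integrable fun w => cornerSign p * cornerSign q *
      (1 - Real.cos (inner ℝ (latticePoint (k + (a : ℤ) • corner p - (b : ℤ) • corner q)) w)) *
        planeDensity φ₁ φ₂ w := fun p q => by
    simp only [mul_assoc]
    exact ((integrable_one_sub_cos_mul_planeDensity hφ₂ hφ₂' _).const_mul _).const_mul _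
  simp only [re_crossSymbol, neg_mul, Finset.sum_mul]
  rw [integral_neg, integral_finsetSum _ fun p _ => integrable_finsetSum _ fun q _ => hi p q]
  simp_rw [fun p => integral_finsetSum Finset.univ fun q _ => hi p q]
  simp_rw [mul_assoc (cornerSign _ * cornerSign _), integral_const_mul]
  simp_rw [diffCov, mul_neg, Finset.mul_sum, ← Finset.sum_neg_distrib]
  refine Finset.sum_congr rfl fun p _ => Finset.sum_congr rfl fun q _ => ?_
  have := integral_one_sub_cos_mul_planeDensity (φ₁ := φ₁) hφ₂ hφ₂'
    (latticePoint (k + (a : ℤ) • corner p - (b : ℤ) • corner q))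
  rw [mul_left_comm, this]; ring

/-- The norm is dominated by the two diagonal symbols (`a = b`, `k = 0`), which are real and
therefore covered by the previous case. -/
lemma integrable_crossSymbol_mul (hφ₁ : 0 < φ₁) (hφ₂ : 0 < φ₂) (hφ₂' : φ₂ < 1) (a b : ℕ)
    (k : ℤ × ℤ) : Integrable fun w => crossSymbol a b k w * (planeDensity φ₁ φ₂ w : ℂ) := by
  have h : ∀ c, Integrable fun w => ‖symbol c w‖ ^ 2 * planeDensity φ₁ φ₂ w := fun c => by
    have := integrable_re_crossSymbol_mul (φ₁ := φ₁) hφ₂ hφ₂' c c 0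
    simpa only [crossSymbol_self_zero, Complex.ofReal_re] using this
  refine ((h a).add (h b)).mono' ?_ (ae_of_all _ fun w => ?_)
  · exact ((continuous_crossSymbol a b k).measurable.mul
      (measurable_planeDensity.complex_ofReal)).aestronglyMeasurable
  · have h0 := planeDensity_nonneg hφ₁ hφ₂ w
    rw [norm_mul, norm_crossSymbol, Complex.norm_real, Real.norm_of_nonneg h0, Pi.add_apply,
      ← add_mul]
    gcongr
    nlinarith [sq_nonneg (‖symbol a w‖ - ‖symbol b w‖), sq_nonneg ‖symbol a w‖,
      sq_nonneg ‖symbol b w‖]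

lemma integral_crossSymbol_mul (hφ₁ : 0 < φ₁) (hφ₂ : 0 < φ₂) (hφ₂' : φ₂ < 1) (a b : ℕ)
    (k : ℤ × ℤ) :
    (((2 * Real.pi) ^ 2)⁻¹ : ℝ) * ∫ w, crossSymbol a b k w * (planeDensity φ₁ φ₂ w : ℂ) =
      (diffCov φ₁ φ₂ a b k : ℂ) := by
  have hi := integrable_crossSymbol_mul hφ₁ hφ₂ hφ₂' a b k
  set J := ∫ w, crossSymbol a b k w * (planeDensity φ₁ φ₂ w : ℂ) with hJ
  -- The density is even and the symbol at `-w` is the conjugate of the symbol at `w`, so the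
  -- integral is real.
  have him : conj J = J := by
    rw [hJ, ← integral_conj, ← integral_neg_eq_self (fun w => crossSymbol a b k w *
      (planeDensity φ₁ φ₂ w : ℂ))]
    refine integral_congr_ae (ae_of_all _ fun w => ?_)
    simp [crossSymbol_neg_arg, planeDensity]
  have hre : J.re = ∫ w, (crossSymbol a b k w).re * planeDensity φ₁ φ₂ w := by
    rw [hJ, ← RCLike.re_eq_complex_re, ← integral_re hi]
    refine integral_congr_ae (ae_of_all _ fun w => ?_)
    simp
  rw [← integral_re_crossSymbol_mul hφ₂ hφ₂', ← hre, Complex.ofReal_mul, Complex.conj_eq_iff_re.1 him]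

/-- The spectral representation of the covariances of bilinear differences on the torus. -/
theorem diffCov_eq_integral_torus (hφ₁ : 0 < φ₁) (hφ₂ : 0 < φ₂) (hφ₂' : φ₂ < 1) (a b : ℕ)
    (k : ℤ × ℤ) :
    (diffCov φ₁ φ₂ a b k : ℂ) = (((2 * Real.pi) ^ 2)⁻¹ : ℝ) *
      ∫ w in torus, crossSymbol a b k w * (latticeDensity φ₁ φ₂ w : ℂ) := by
  rw [← integral_crossSymbol_mul hφ₁ hφ₂ hφ₂',
    integral_mul_planeDensity_eq (crossSymbol_add_dualPoint a b k)
      (integrable_crossSymbol_mul hφ₁ hφ₂ hφ₂' a b k)]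

lemma meanQV_eq_diffCov (hφ₁ : 0 < φ₁) (hφ₂ : 0 < φ₂) (hφ₂' : φ₂ < 1) (r : ℕ) :
    meanQV φ₁ φ₂ r = diffCov φ₁ φ₂ r r 0 := by
  have h := diffCov_eq_integral_torus hφ₁ hφ₂ hφ₂' r r 0
  simp only [crossSymbol_self_zero, ← Complex.ofReal_mul] at h
  rw [integral_complex_ofReal, ← Complex.ofReal_mul, Complex.ofReal_inj] at h
  exact h.symm

/-- Among the sixteen pairs of corners, four are at distance `0`, eight at distance `r` with sign
`-1`, four at distance `r √2` with sign `+1`. Since `Γ(-φ₂) < 0`, the factor `-8 + 4 · 2^φ₂` becomes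
the one in `aOne`. -/
lemma diffCov_self_zero (hφ₂ : 0 < φ₂) (hφ₂' : φ₂ < 1) (r : ℕ) :
    diffCov φ₁ φ₂ r r 0 = φ₁ * aOne φ₂ * (r : ℝ) ^ (2 * φ₂) := by
  have hG := neg_Gamma_neg_pos hφ₂ hφ₂'
  have hn : ∀ x y : ℤ, genCov φ₁ φ₂ (latticePoint ((r : ℤ) * x, (r : ℤ) * y)) =
      φ₁ * Real.Gamma (-φ₂) * ((r : ℝ) ^ (2 * φ₂) * ((x : ℝ) ^ 2 + (y : ℝ) ^ 2) ^ φ₂) := by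
    intro x y
    have : ‖latticePoint ((r : ℤ) * x, (r : ℤ) * y)‖ = r * √((x : ℝ) ^ 2 + (y : ℝ) ^ 2) := by
      rw [EuclideanSpace.norm_eq, Fin.sum_univ_two]
      simp only [latticePoint_apply_zero, latticePoint_apply_one, Real.norm_eq_abs, sq_abs]
      push_cast
      rw [mul_pow, mul_pow, ← mul_add, Real.sqrt_mul (by positivity), Real.sqrt_sq (by positivity)]
    rw [genCov, this, Real.mul_rpow (by positivity) (by positivity), Real.rpow_mul (Real.sqrt_nonneg _),
      Real.rpow_two, Real.sq_sqrt (by positivity)]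
  have hk : ∀ p q, (0 : ℤ × ℤ) + (r : ℤ) • corner p - (r : ℤ) • corner q =
      ((r : ℤ) * ((corner p).1 - (corner q).1), (r : ℤ) * ((corner p).2 - (corner q).2)) := by
    intro p q; ext <;> simp [mul_sub]
  simp only [diffCov, hk, hn]
  simp [Fin.sum_univ_four, corner, cornerSign, Real.zero_rpow hφ₂.ne', aOne, abs_of_neg (neg_pos.1 hG)]
  norm_num
  ring

lemma aOne_pos (hφ₂ : 0 < φ₂) (hφ₂' : φ₂ < 1) : 0 < aOne φ₂ := by
  have hG := neg_Gamma_neg_pos hφ₂ hφ₂'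
  have h2 : (2 : ℝ) ^ φ₂ < 2 := by
    simpa using Real.rpow_lt_rpow_of_exponent_lt (x := 2) one_lt_two hφ₂'
  exact mul_pos (abs_pos.2 (by linarith)) (by linarith)

lemma meanQV_eq (hφ₁ : 0 < φ₁) (hφ₂ : 0 < φ₂) (hφ₂' : φ₂ < 1) (r : ℕ) :
    meanQV φ₁ φ₂ r = φ₁ * aOne φ₂ * (r : ℝ) ^ (2 * φ₂) := by
  rw [meanQV_eq_diffCov hφ₁ hφ₂ hφ₂', diffCov_self_zero hφ₂ hφ₂']

lemma meanQV_one (hφ₁ : 0 < φ₁) (hφ₂ : 0 < φ₂) (hφ₂' : φ₂ < 1) :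
    meanQV φ₁ φ₂ 1 = φ₁ * aOne φ₂ := by simp [meanQV_eq hφ₁ hφ₂ hφ₂']

lemma meanQV_two (hφ₁ : 0 < φ₁) (hφ₂ : 0 < φ₂) (hφ₂' : φ₂ < 1) :
    meanQV φ₁ φ₂ 2 = (4 : ℝ) ^ φ₂ * meanQV φ₁ φ₂ 1 := by
  rw [meanQV_one hφ₁ hφ₂ hφ₂', meanQV_eq hφ₁ hφ₂ hφ₂', Real.rpow_mul (by norm_num)]
  norm_num [mul_comm]

lemma meanQV_one_pos (hφ₁ : 0 < φ₁) (hφ₂ : 0 < φ₂) (hφ₂' : φ₂ < 1) : 0 < meanQV φ₁ φ₂ 1 := by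
  rw [meanQV_one hφ₁ hφ₂ hφ₂']; exact mul_pos hφ₁ (aOne_pos hφ₂ hφ₂')

end PowerLaw
end

open scoped ComplexConjugate
noncomputable section
namespace PowerLaw

variable {φ₁ φ₂ : ℝ}

/-! ### Fourier series on the torus -/

/-- The normalized Haar measure on the circle. -/
abbrev circleMeasureSpace : MeasureSpace UnitAddCircle := ⟨AddCircle.haarAddCircle⟩

attribute [local instance] circleMeasureSpace

lemma isProbabilityMeasure_haarAddCircle :
    IsProbabilityMeasure (volume : Measure UnitAddCircle) :=
  inferInstanceAs (IsProbabilityMeasure AddCircle.haarAddCircle)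

attribute [local instance] isProbabilityMeasure_haarAddCircle

/-- The point of `(-π, π]²` over a point of the unit torus. -/
def torusPoint (x : UnitAddTorus (Fin 2)) : Plane :=
  WithLp.toLp 2 fun i => 2 * Real.pi * (AddCircle.equivIoc 1 (-1 / 2 : ℝ) (x i)).1

lemma measurable_torusPoint : Measurable torusPoint := by
  have h : Measurable fun x : UnitAddTorus (Fin 2) => fun i : Fin 2 =>
      2 * Real.pi * (AddCircle.equivIoc 1 (-1 / 2 : ℝ) (x i)).1 := by
    refine measurable_pi_lambda _ fun i => Measurable.const_mul ?_ _
    exact measurable_subtype_coe.comp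
      ((AddCircle.measurableEquivIoc 1 (-1 / 2 : ℝ)).measurable.comp (measurable_pi_apply i))
  exact (WithLp.measurable_toLp 2 _).comp h

lemma torusPoint_mem (x : UnitAddTorus (Fin 2)) : torusPoint x ∈ torus := by
  intro i
  have h := (AddCircle.equivIoc 1 (-1 / 2 : ℝ) (x i)).2
  have hp := Real.pi_pos
  have e : torusPoint x i = 2 * Real.pi * (AddCircle.equivIoc 1 (-1 / 2 : ℝ) (x i)).1 := rfl
  rw [e]
  constructor <;> nlinarith [h.1, h.2]

/-- The unit torus carries a probability measure; `(2π)⁻²` is the Jacobian of the dilation from its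
fundamental cell to `(-π, π]²`. -/
lemma integral_comp_torusPoint {E : Type*} [NormedAddCommGroup E] [NormedSpace ℝ E]
    (G : Plane → E) :
    ∫ x, G (torusPoint x) = ((2 * Real.pi) ^ 2)⁻¹ • ∫ w in torus, G w := by
  have h1 : ∫ x, G (torusPoint x) = ∫ x in {x : Fin 2 → ℝ | ∀ i, x i ∈ Set.Ioc (-1 / 2) (-1 / 2 + 1)},
      G (torusPoint fun i => (x i : UnitAddCircle)) :=
    UnitAddTorus.integral_preimage (fun x => G (torusPoint x)) (fun _ => -1 / 2)
  have h2 : {x : Fin 2 → ℝ | ∀ i, x i ∈ Set.Ioc (-1 / 2 : ℝ) (-1 / 2 + 1)} =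
      WithLp.toLp 2 ⁻¹' {w : Plane | ∀ i, w i ∈ Set.Ioc (-1 / 2 : ℝ) (-1 / 2 + 1)} := rfl
  have hmeas : MeasurableSet {x : Fin 2 → ℝ | ∀ i, x i ∈ Set.Ioc (-1 / 2 : ℝ) (-1 / 2 + 1)} :=
    MeasurableSet.univ_pi' fun i => measurableSet_Ioc
  have h3 : ∀ x ∈ {x : Fin 2 → ℝ | ∀ i, x i ∈ Set.Ioc (-1 / 2 : ℝ) (-1 / 2 + 1)},
      G (torusPoint fun i => (x i : UnitAddCircle)) = G ((2 * Real.pi) • WithLp.toLp 2 x) := by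
    intro x hx
    congr 1
    ext i
    simp [torusPoint, AddCircle.equivIoc_coe_of_mem (hx i)]
  rw [h1, setIntegral_congr_fun hmeas h3, h2,
    (PiLp.volume_preserving_toLp (Fin 2)).setIntegral_preimage_emb
      (MeasurableEquiv.toLp 2 (Fin 2 → ℝ)).measurableEmbedding
      (fun w => G ((2 * Real.pi) • w)),
    Measure.setIntegral_comp_smul _ _ _ Real.two_pi_pos.ne']
  congr 2
  · rw [finrank_euclideanSpace, Fintype.card_fin, abs_of_pos (by positivity)]
  · congr 1
    ext w
    rw [Set.mem_smul_set_iff_inv_smul_mem₀ Real.two_pi_pos.ne']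
    simp only [torus, Set.mem_ofPred_eq, PiLp.smul_apply, smul_eq_mul, Set.mem_Ioc]
    refine forall_congr' fun i => ?_
    have hp := Real.pi_pos
    rw [inv_mul_eq_div, lt_div_iff₀ (by positivity), div_le_iff₀ (by positivity)]
    constructor <;> rintro ⟨h1, h2⟩ <;> constructor <;> nlinarith

lemma mFourier_eq_wave (k : ℤ × ℤ) (x : UnitAddTorus (Fin 2)) :
    UnitAddTorus.mFourier ((finTwoArrowEquiv ℤ).symm k) x = wave k (torusPoint x) := by
  have h : ∀ i, x i = (((AddCircle.equivIoc 1 (-1 / 2 : ℝ) (x i)).1 : ℝ) : UnitAddCircle) :=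
    fun i => ((AddCircle.equivIoc 1 (-1 / 2 : ℝ)).symm_apply_apply (x i)).symm
  simp only [UnitAddTorus.mFourier, ContinuousMap.coe_mk, Fin.prod_univ_two]
  rw [h 0, h 1, fourier_coe_apply, fourier_coe_apply, ← Complex.exp_add, wave]
  congr 1
  simp [torusPoint]
  ring

/-- Parseval's identity on the torus. -/
theorem hasSum_norm_sq_integral_wave_mul {F : Plane → ℂ} (hF : Measurable F) {B : ℝ}
    (hB : ∀ w ∈ torus, ‖F w‖ ≤ B) :
    HasSum (fun k => ‖((2 * Real.pi) ^ 2)⁻¹ • ∫ w in torus, wave k w * F w‖ ^ 2)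
      (torusIntegral fun w => ‖F w‖ ^ 2) := by
  have hm : MemLp (fun x => F (torusPoint x)) 2 (volume : Measure (UnitAddTorus (Fin 2))) :=
    MemLp.of_bound (hF.comp measurable_torusPoint).aestronglyMeasurable B
      (ae_of_all _ fun x => hB _ (torusPoint_mem x))
  have h := UnitAddTorus.hasSum_sq_mFourierCoeff (hm.toLp _)
  have e1 : ∫ t, ‖(hm.toLp _ : UnitAddTorus (Fin 2) → ℂ) t‖ ^ 2 = torusIntegral fun w => ‖F w‖ ^ 2 := by
    rw [torusIntegral, ← smul_eq_mul, ← integral_comp_torusPoint]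
    refine integral_congr_ae ?_
    filter_upwards [hm.coeFn_toLp] with x hx
    rw [hx]
  rw [e1] at h
  -- The coefficient of index `k` integrates against the character of index `-k`, hence the
  -- reindexing.
  rw [← ((Equiv.neg (ℤ × ℤ)).trans (finTwoArrowEquiv ℤ).symm).hasSum_iff] at h
  refine h.congr_fun fun k => ?_
  simp only [Function.comp_apply, Equiv.trans_apply, Equiv.neg_apply]
  rw [UnitAddTorus.mFourierCoeff, ← integral_comp_torusPoint]
  congr 2
  refine integral_congr_ae ?_
  filter_upwards [hm.coeFn_toLp] with x hx
  rw [hx, smul_eq_mul, ← mFourier_eq_wave]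
  have hk : (finTwoArrowEquiv ℤ).symm k = -(finTwoArrowEquiv ℤ).symm (-k) := by
    ext i; fin_cases i <;> simp
  rw [← hk]

lemma integral_wave (k : ℤ × ℤ) :
    ((2 * Real.pi) ^ 2)⁻¹ • ∫ w in torus, wave k w = if k = 0 then 1 else 0 := by
  have h := orthonormal_iff_ite.1 (UnitAddTorus.orthonormal_mFourier (d := Fin 2))
    ((finTwoArrowEquiv ℤ).symm 0) ((finTwoArrowEquiv ℤ).symm k)
  simp only [EmbeddingLike.apply_eq_iff_eq, ContinuousMap.inner_toLp] at h
  rw [← integral_comp_torusPoint]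
  simp only [eq_comm (a := k)]
  rw [← h]
  refine integral_congr_ae (ae_of_all _ fun x => ?_)
  simp only [mFourier_eq_wave]
  simp [wave]

end PowerLaw
end

/-! ### Square-summability and spectral bounds for the covariances -/

open scoped ComplexConjugate
noncomputable section
namespace PowerLaw

variable {φ₁ φ₂ : ℝ}

lemma volume_torus_lt_top : volume torus < ⊤ := by
  refine (Metric.isBounded_closedBall (x := (0 : Plane)) (r := 6)).subset ?_ |>.measure_lt_top
  intro w hw
  simpa using norm_le_of_mem_torus hw

lemma integrableOn_torus_of_bound {E : Type*} [NormedAddCommGroup E] {G : Plane → E}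
    (hG : AEStronglyMeasurable G (volume.restrict torus)) {B : ℝ} (hB : ∀ w ∈ torus, ‖G w‖ ≤ B) :
    IntegrableOn G torus := by
  have : IsFiniteMeasure (volume.restrict torus) :=
    ⟨by rw [Measure.restrict_apply_univ]; exact volume_torus_lt_top⟩
  exact Integrable.of_bound hG B ((ae_restrict_mem measurableSet_torus).mono hB)

lemma torusIntegral_mono {F G : Plane → ℝ} (hF : IntegrableOn F torus) (hG : IntegrableOn G torus)
    (h : ∀ w ∈ torus, F w ≤ G w) : torusIntegral F ≤ torusIntegral G :=
  mul_le_mul_of_nonneg_left (setIntegral_mono_on hF hG measurableSet_torus h) (by positivity)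

/-- The cross-spectral density of the bilinear differences with steps `a` and `b`. -/
def crossDensity (φ₁ φ₂ : ℝ) (a b : ℕ) (w : Plane) : ℂ :=
  symbol a w * conj (symbol b w) * (latticeDensity φ₁ φ₂ w : ℂ)

lemma measurable_crossDensity (hφ₁ : 0 < φ₁) (hφ₂ : 0 < φ₂) (a b : ℕ) :
    Measurable (crossDensity φ₁ φ₂ a b) :=
  ((continuous_symbol a).measurable.mul
    (Complex.continuous_conj.comp (continuous_symbol b)).measurable).mul
    (measurable_latticeDensity hφ₁ hφ₂).complex_ofReal

lemma norm_crossDensity (hφ₁ : 0 < φ₁) (hφ₂ : 0 < φ₂) (a b : ℕ) (w : Plane) :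
    ‖crossDensity φ₁ φ₂ a b w‖ = ‖symbol a w‖ * ‖symbol b w‖ * latticeDensity φ₁ φ₂ w := by
  rw [crossDensity, norm_mul, norm_mul, Complex.norm_real,
    Real.norm_of_nonneg (latticeDensity_nonneg hφ₁ hφ₂ w)]
  simp

lemma exists_norm_crossDensity_le (hφ₁ : 0 < φ₁) (hφ₂ : 0 < φ₂) (hφ₂' : φ₂ < 1) (a b : ℕ) :
    ∃ B : ℝ, ∀ w ∈ torus, ‖crossDensity φ₁ φ₂ a b w‖ ≤ B := by
  obtain ⟨A, -, hA⟩ := exists_norm_symbol_sq_mul_latticeDensity_le hφ₁ hφ₂ hφ₂' a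
  obtain ⟨B, -, hB⟩ := exists_norm_symbol_sq_mul_latticeDensity_le hφ₁ hφ₂ hφ₂' b
  refine ⟨A + B, fun w hw => ?_⟩
  rw [norm_crossDensity hφ₁ hφ₂]
  have h0 := latticeDensity_nonneg hφ₁ hφ₂ w
  calc _ ≤ (‖symbol a w‖ ^ 2 + ‖symbol b w‖ ^ 2) * latticeDensity φ₁ φ₂ w := by
        gcongr
        nlinarith [sq_nonneg (‖symbol a w‖ - ‖symbol b w‖), sq_nonneg ‖symbol a w‖,
          sq_nonneg ‖symbol b w‖]
    _ ≤ _ := by rw [add_mul]; exact add_le_add (hA w hw) (hB w hw)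

lemma diffCov_eq (hφ₁ : 0 < φ₁) (hφ₂ : 0 < φ₂) (hφ₂' : φ₂ < 1) (a b : ℕ) (k : ℤ × ℤ) :
    (diffCov φ₁ φ₂ a b k : ℂ) =
      ((2 * Real.pi) ^ 2)⁻¹ • ∫ w in torus, wave k w * crossDensity φ₁ φ₂ a b w := by
  rw [diffCov_eq_integral_torus hφ₁ hφ₂ hφ₂', Complex.real_smul]
  simp only [crossSymbol, crossDensity, mul_assoc]

/-- The squared covariances are summable, with the sum given by Parseval's identity. -/
theorem hasSum_diffCov_sq (hφ₁ : 0 < φ₁) (hφ₂ : 0 < φ₂) (hφ₂' : φ₂ < 1) (a b : ℕ) :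
    HasSum (fun k => diffCov φ₁ φ₂ a b k ^ 2)
      (torusIntegral fun w => ‖symbol a w‖ ^ 2 * ‖symbol b w‖ ^ 2 *
        latticeDensity φ₁ φ₂ w ^ 2) := by
  obtain ⟨B, hB⟩ := exists_norm_crossDensity_le hφ₁ hφ₂ hφ₂' a b
  have h := hasSum_norm_sq_integral_wave_mul (measurable_crossDensity hφ₁ hφ₂ a b) hB
  simp only [← diffCov_eq hφ₁ hφ₂ hφ₂', Complex.norm_real, Real.norm_eq_abs, sq_abs] at h
  simp only [norm_crossDensity hφ₁ hφ₂, mul_pow] at h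
  exact h

lemma norm_sq_one_add_exp (x : ℝ) : ‖1 + Complex.exp (Complex.I * x)‖ ^ 2 =
    4 * Real.cos (x / 2) ^ 2 := by
  rw [mul_comm, Complex.exp_mul_I, ← Complex.ofReal_cos, ← Complex.ofReal_sin,
    ← Complex.normSq_eq_norm_sq, Complex.normSq_apply]
  have h1 := Real.cos_sq (x / 2)
  rw [mul_div_cancel₀ x two_ne_zero] at h1
  simp [-Complex.ofReal_cos, -Complex.ofReal_sin]
  nlinarith [Real.sin_sq_add_cos_sq x]

/-- From `1 - z² = (1 - z)(1 + z)` with `z = e^{i w_j}` in each coordinate. -/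
lemma norm_sq_symbol_two (w : Plane) :
    ‖symbol 2 w‖ ^ 2 = bSymbol 1 w * ‖symbol 1 w‖ ^ 2 := by
  have h : symbol 2 w = symbol 1 w * ((1 + Complex.exp (Complex.I * (w 0 : ℝ))) *
      (1 + Complex.exp (Complex.I * (w 1 : ℝ)))) := by
    have e : ∀ x : ℂ, Complex.exp (Complex.I * 2 * x) = Complex.exp (Complex.I * x) ^ 2 :=
      fun x => by rw [← Complex.exp_nat_mul]; congr 1; push_cast; ring
    simp only [symbol, Nat.cast_ofNat, Nat.cast_one, mul_one, e]; ring
  rw [h, norm_mul, norm_mul, mul_pow, mul_pow, norm_sq_one_add_exp, norm_sq_one_add_exp]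
  simp [bSymbol]; ring

lemma norm_sq_symbol_succ (l : Fin 2) (w : Plane) :
    ‖symbol (l + 1) w‖ ^ 2 = bSymbol l w * ‖symbol 1 w‖ ^ 2 := by
  fin_cases l
  · simp [bSymbol]
  · exact norm_sq_symbol_two w

/-- Parseval for the cross-density links the spectral matrix `Σ` to the covariances from which
variances of quadratic forms are computed. -/
lemma hasSum_covQV (hφ₁ : 0 < φ₁) (hφ₂ : 0 < φ₂) (hφ₂' : φ₂ < 1) (l m : Fin 2) :
    HasSum (fun k => 2 * diffCov φ₁ φ₂ (l + 1) (m + 1) k ^ 2) (covQV φ₁ φ₂ l m) := by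
  have h := (hasSum_diffCov_sq hφ₁ hφ₂ hφ₂' (l + 1) (m + 1)).mul_left 2
  have e : covQV φ₁ φ₂ l m = 2 * torusIntegral fun w => ‖symbol (l + 1) w‖ ^ 2 *
      ‖symbol (m + 1) w‖ ^ 2 * latticeDensity φ₁ φ₂ w ^ 2 := by
    simp only [norm_sq_symbol_succ]
    refine congrArg (fun F => 2 * torusIntegral F) (funext fun w => ?_)
    ring
  rwa [e]

/-! ### Quadratic forms in the covariances -/

section QuadraticForm

variable {ι : Type*} [Fintype ι]

lemma norm_sum_wave_sq (u : ι → ℝ) (z : ι → ℂ) :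
    ((‖∑ i, (u i : ℂ) * z i‖ ^ 2 : ℝ) : ℂ) = ∑ i, ∑ j, ((u i * u j : ℝ) : ℂ) * (z i * conj (z j)) := by
  rw [← Complex.normSq_eq_norm_sq, ← Complex.mul_conj, map_sum, Finset.sum_mul_sum]
  simp only [map_mul, Complex.conj_ofReal]
  exact Finset.sum_congr rfl fun i _ => Finset.sum_congr rfl fun j _ => by push_cast; ring

/-- The covariance form of bilinear differences is a spectral integral. -/
lemma sum_diffCov_eq (hφ₁ : 0 < φ₁) (hφ₂ : 0 < φ₂) (hφ₂' : φ₂ < 1) (r : ι → ℕ) (t : ι → ℤ × ℤ)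
    (u : ι → ℝ) :
    ∑ i, ∑ j, u i * u j * diffCov φ₁ φ₂ (r i) (r j) (t i - t j) =
      torusIntegral fun w => ‖∑ i, (u i : ℂ) * (wave (t i) w * symbol (r i) w)‖ ^ 2 *
        latticeDensity φ₁ φ₂ w := by
  rw [← Complex.ofReal_inj, torusIntegral, Complex.ofReal_mul, ← integral_complex_ofReal,
    ← Complex.real_smul]
  have hi : ∀ i j, IntegrableOn (fun w => ((u i * u j : ℝ) : ℂ) *
      (wave (t i - t j) w * crossDensity φ₁ φ₂ (r i) (r j) w)) torus := fun i j => by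
    obtain ⟨B, hB⟩ := exists_norm_crossDensity_le hφ₁ hφ₂ hφ₂' (r i) (r j)
    refine Integrable.const_mul (integrableOn_torus_of_bound
      ((continuous_wave _).measurable.mul
        (measurable_crossDensity hφ₁ hφ₂ _ _)).aestronglyMeasurable (B := B) fun w hw => ?_) _
    simpa using hB w hw
  have h1 : ∀ w, ((‖∑ i, (u i : ℂ) * (wave (t i) w * symbol (r i) w)‖ ^ 2 *
        latticeDensity φ₁ φ₂ w : ℝ) : ℂ) = ∑ i, ∑ j, ((u i * u j : ℝ) : ℂ) *
      (wave (t i - t j) w * crossDensity φ₁ φ₂ (r i) (r j) w) := by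
    intro w
    rw [Complex.ofReal_mul, norm_sum_wave_sq, Finset.sum_mul]
    simp only [Finset.sum_mul]
    refine Finset.sum_congr rfl fun i _ => Finset.sum_congr rfl fun j _ => ?_
    rw [wave_sub, crossDensity, map_mul]; ring
  simp only [h1]
  rw [integral_finsetSum _ fun i _ => integrable_finsetSum _ fun j _ => hi i j]
  simp_rw [fun i => integral_finsetSum Finset.univ fun j _ => hi i j]
  simp_rw [integral_const_mul, Finset.smul_sum, Complex.ofReal_sum]
  refine Finset.sum_congr rfl fun i _ => Finset.sum_congr rfl fun j _ => ?_
  rw [Complex.ofReal_mul, diffCov_eq hφ₁ hφ₂ hφ₂', mul_smul_comm]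

lemma sum_diffCov_nonneg (hφ₁ : 0 < φ₁) (hφ₂ : 0 < φ₂) (hφ₂' : φ₂ < 1) (r : ι → ℕ) (t : ι → ℤ × ℤ)
    (u : ι → ℝ) :
    0 ≤ ∑ i, ∑ j, u i * u j * diffCov φ₁ φ₂ (r i) (r j) (t i - t j) := by
  rw [sum_diffCov_eq hφ₁ hφ₂ hφ₂']
  exact mul_nonneg (by positivity) (integral_nonneg fun w =>
    mul_nonneg (by positivity) (latticeDensity_nonneg hφ₁ hφ₂ w))

/-- Orthonormality of the characters. Distinctness is asked only where coefficients are nonzero,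
because one lattice point may carry differences of both steps and one of them is then masked by a
zero coefficient. -/
lemma torusIntegral_norm_sum_wave_sq (t : ι → ℤ × ℤ) (u : ι → ℝ)
    (ht : ∀ i j, u i ≠ 0 → u j ≠ 0 → t i = t j → i = j) :
    torusIntegral (fun w => ‖∑ i, (u i : ℂ) * wave (t i) w‖ ^ 2) = ∑ i, u i ^ 2 := by
  classical
  rw [← Complex.ofReal_inj, torusIntegral, Complex.ofReal_mul, ← integral_complex_ofReal,
    ← Complex.real_smul]
  have hi : ∀ i j, IntegrableOn (fun w => ((u i * u j : ℝ) : ℂ) * wave (t i - t j) w) torus :=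
    fun i j => (integrableOn_torus_of_bound (continuous_wave _).aestronglyMeasurable (B := 1)
      fun w _ => by simp).const_mul _
  simp only [norm_sum_wave_sq, ← wave_sub]
  rw [integral_finsetSum _ fun i _ => integrable_finsetSum _ fun j _ => hi i j]
  simp_rw [fun i => integral_finsetSum Finset.univ fun j _ => hi i j]
  simp_rw [integral_const_mul, Finset.smul_sum, ← mul_smul_comm, integral_wave, Complex.ofReal_sum]
  refine Finset.sum_congr rfl fun i _ => ?_
  rw [Finset.sum_eq_single i]
  · simp [sq]
  · intro j _ hji
    by_cases h : u i = 0 ∨ u j = 0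
    · rcases h with h | h <;> simp [h]
    · push Not at h
      rw [if_neg, mul_zero]
      intro h0
      exact hji (ht i j h.1 h.2 (sub_eq_zero.1 h0)).symm
  · simp

/-- The covariance form of bilinear differences with steps one and two is bounded. -/
theorem exists_sum_diffCov_le (hφ₁ : 0 < φ₁) (hφ₂ : 0 < φ₂) (hφ₂' : φ₂ < 1) :
    ∃ κ : ℝ, 0 < κ ∧ ∀ {ι : Type} [Fintype ι] (a : ι → Fin 2) (t : ι → ℤ × ℤ)
      (_ : Function.Injective fun i => (a i, t i)) (u : ι → ℝ),
      ∑ i, ∑ j, u i * u j * diffCov φ₁ φ₂ (a i + 1) (a j + 1) (t i - t j) ≤ κ * ∑ i, u i ^ 2 := by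
  classical
  have hb : ∃ B : ℝ, 0 < B ∧ ∀ l : Fin 2, ∀ w ∈ torus,
      ‖symbol (l + 1) w‖ ^ 2 * latticeDensity φ₁ φ₂ w ≤ B := by
    obtain ⟨A, hA0, hA⟩ := exists_norm_symbol_sq_mul_latticeDensity_le hφ₁ hφ₂ hφ₂' 1
    obtain ⟨B, hB0, hB⟩ := exists_norm_symbol_sq_mul_latticeDensity_le hφ₁ hφ₂ hφ₂' 2
    refine ⟨A + B + 1, by linarith, fun l w hw => ?_⟩
    fin_cases l
    · have := hA w hw; simp at this ⊢; linarith
    · have := hB w hw; simp at this ⊢; linarith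
  obtain ⟨B, hB0, hB⟩ := hb
  refine ⟨2 * B, by positivity, fun {ι} _ a t hinj u => ?_⟩
  -- The trigonometric polynomials of the two steps taken separately. Within one step the lattice
  -- points are distinct, so orthonormality applies; combining the steps costs the factor `2` in `2
  -- * B`.
  set U : Fin 2 → Plane → ℂ := fun l w =>
    ∑ i, ((if a i = l then u i else 0 : ℝ) : ℂ) * wave (t i) w with hU
  have hUc : ∀ l, Continuous (U l) := fun l =>
    continuous_finsetSum _ fun i _ => continuous_const.mul (continuous_wave _)
  have hUb : ∀ l w, ‖U l w‖ ≤ ∑ i, |u i| := fun l w => by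
    refine (norm_sum_le _ _).trans (Finset.sum_le_sum fun i _ => ?_)
    rw [norm_mul, norm_wave, mul_one, Complex.norm_real, Real.norm_eq_abs]
    split_ifs <;> simp
  have hUI : ∀ l, torusIntegral (fun w => ‖U l w‖ ^ 2) =
      ∑ i, (if a i = l then u i else 0) ^ 2 := fun l => by
    refine torusIntegral_norm_sum_wave_sq t _ fun i j hi hj hij => hinj ?_
    simp only [ne_eq, ite_eq_right_iff, Classical.not_imp] at hi hj
    exact Prod.ext (hi.1.trans hj.1.symm) hij
  have hUi : ∀ l, IntegrableOn (fun w => ‖U l w‖ ^ 2) torus := fun l =>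
    integrableOn_torus_of_bound ((hUc l).norm.pow 2).aestronglyMeasurable
      (B := (∑ i, |u i|) ^ 2) fun w _ => by
        rw [norm_pow, norm_norm]; gcongr; exact hUb l w
  have hsplit : ∀ w, ∑ i, (u i : ℂ) * (wave (t i) w * symbol (a i + 1) w) =
      U 0 w * symbol ((0 : Fin 2) + 1) w + U 1 w * symbol ((1 : Fin 2) + 1) w := by
    intro w
    simp only [hU, Finset.sum_mul, ← Finset.sum_add_distrib]
    refine Finset.sum_congr rfl fun i _ => ?_
    rcases Fin.exists_fin_two.1 ⟨a i, rfl⟩ with h | h <;> simp [h, mul_assoc]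
  have hpt : ∀ w ∈ torus, ‖∑ i, (u i : ℂ) * (wave (t i) w * symbol (a i + 1) w)‖ ^ 2 *
      latticeDensity φ₁ φ₂ w ≤ 2 * B * (‖U 0 w‖ ^ 2 + ‖U 1 w‖ ^ 2) := by
    intro w hw
    have h0 := latticeDensity_nonneg hφ₁ hφ₂ w
    have h1 := hB 0 w hw
    have h2 := hB 1 w hw
    rw [hsplit]
    set s0 := symbol (((0 : Fin 2) : ℕ) + 1) w
    set s1 := symbol (((1 : Fin 2) : ℕ) + 1) w
    have h3 : ‖U 0 w * s0 + U 1 w * s1‖ ^ 2 ≤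
        2 * (‖U 0 w‖ ^ 2 * ‖s0‖ ^ 2 + ‖U 1 w‖ ^ 2 * ‖s1‖ ^ 2) := by
      have := norm_add_le (U 0 w * s0) (U 1 w * s1)
      rw [norm_mul, norm_mul] at this
      calc _ ≤ (‖U 0 w‖ * ‖s0‖ + ‖U 1 w‖ * ‖s1‖) ^ 2 := by gcongr
        _ ≤ _ := by nlinarith [sq_nonneg (‖U 0 w‖ * ‖s0‖ - ‖U 1 w‖ * ‖s1‖)]
    calc _ ≤ 2 * (‖U 0 w‖ ^ 2 * ‖s0‖ ^ 2 + ‖U 1 w‖ ^ 2 * ‖s1‖ ^ 2) * latticeDensity φ₁ φ₂ w := by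
          gcongr
      _ = 2 * (‖U 0 w‖ ^ 2 * (‖s0‖ ^ 2 * latticeDensity φ₁ φ₂ w) +
          ‖U 1 w‖ ^ 2 * (‖s1‖ ^ 2 * latticeDensity φ₁ φ₂ w)) := by ring
      _ ≤ 2 * (‖U 0 w‖ ^ 2 * B + ‖U 1 w‖ ^ 2 * B) := by gcongr
      _ = _ := by ring
  rw [sum_diffCov_eq hφ₁ hφ₂ hφ₂']
  have hint : IntegrableOn (fun w => 2 * B * (‖U 0 w‖ ^ 2 + ‖U 1 w‖ ^ 2)) torus :=
    ((hUi 0).add (hUi 1)).const_mul _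
  refine (torusIntegral_mono (hint.mono' ?_ ?_) hint hpt).trans (le_of_eq ?_)
  · refine Measurable.aestronglyMeasurable (Measurable.mul ?_ (measurable_latticeDensity hφ₁ hφ₂))
    refine Continuous.measurable ((continuous_finsetSum _ fun i _ => continuous_const.mul
      ((continuous_wave _).mul (continuous_symbol _))).norm.pow 2)
  · filter_upwards [ae_restrict_mem measurableSet_torus] with w hw
    rw [Real.norm_of_nonneg (mul_nonneg (by positivity) (latticeDensity_nonneg hφ₁ hφ₂ w))]
    exact hpt w hw
  · rw [torusIntegral, integral_const_mul, integral_add (hUi 0) (hUi 1), mul_left_comm, mul_add]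
    have e0 := hUI 0
    have e1 := hUI 1
    rw [torusIntegral] at e0 e1
    rw [e0, e1, ← Finset.sum_add_distrib]
    congr 1
    refine Finset.sum_congr rfl fun i _ => ?_
    rcases Fin.exists_fin_two.1 ⟨a i, rfl⟩ with h | h <;> simp [h]

end QuadraticForm

end PowerLaw
end

noncomputable section
namespace PowerLaw

/-! ### Averages of a function of differences of grid points -/

/-- A pair of natural numbers as a pair of integers. -/
def gridPoint (t : ℕ × ℕ) : ℤ × ℤ := (t.1, t.2)

lemma gridPoint_injective : Function.Injective gridPoint := by
  rintro ⟨a, b⟩ ⟨c, d⟩ h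
  simpa [gridPoint] using h

lemma card_grid (n : ℕ) : (grid n).card = n ^ 2 := by simp [grid, sq]

lemma mem_grid {n : ℕ} {t : ℕ × ℕ} : t ∈ grid n ↔ t.1 < n ∧ t.2 < n := by simp [grid]

/-- The pairs of grid points with difference `k`. -/
def diffPairs (p q : ℕ) (k : ℤ × ℤ) : Finset ((ℕ × ℕ) × (ℕ × ℕ)) :=
  (grid p ×ˢ grid q).filter fun x => gridPoint x.1 - gridPoint x.2 = k

lemma card_diffPairs_le (p q : ℕ) (k : ℤ × ℤ) : (diffPairs p q k).card ≤ p ^ 2 := by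
  rw [← card_grid]
  refine Finset.card_le_card_of_injOn Prod.fst (fun x hx => ?_) fun x hx y hy hxy => ?_
  · simp only [diffPairs, Finset.coe_filter, Finset.mem_product] at hx
    exact hx.1.1
  · simp only [diffPairs, Finset.coe_filter, Finset.mem_product] at hx hy
    refine Prod.ext hxy (gridPoint_injective ?_)
    have h := hx.2.trans hy.2.symm
    rw [hxy] at h
    exact sub_right_injective h

/-- A translation by `K = |k₁| + |k₂|` keeps both points of a pair in the quadrant and loses a
margin of `2 K`; truncated subtraction makes the bound trivial for small `n`. -/
lemma le_card_diffPairs (n a b : ℕ) (k : ℤ × ℤ) :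
    (n - (a + b + 2 * (k.1.natAbs + k.2.natAbs))) ^ 2 ≤ (diffPairs (n - a) (n - b) k).card := by
  rw [← card_grid]
  set K := k.1.natAbs + k.2.natAbs with hK
  refine Finset.card_le_card_of_injOn (fun i => (((i.1 + K + k.1).toNat, (i.2 + K + k.2).toNat),
    (i.1 + K, i.2 + K))) (fun i hi => ?_) fun i _ j _ hij => ?_
  · have hi' := mem_grid.1 hi
    simp only [diffPairs, Finset.coe_filter, Finset.mem_product, mem_grid, Set.mem_ofPred_eq,
      gridPoint, Prod.mk_sub_mk, Prod.ext_iff]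
    omega
  · simp only [Prod.mk.injEq] at hij
    ext <;> omega

lemma sum_grid_eq_tsum (p q : ℕ) (f : ℤ × ℤ → ℝ) :
    ∑ s ∈ grid p, ∑ t ∈ grid q, f (gridPoint s - gridPoint t) =
      ∑' k, ((diffPairs p q k).card : ℝ) * f k := by
  classical
  have h : ∀ x : (ℕ × ℕ) × (ℕ × ℕ), HasSum
      (fun k => if gridPoint x.1 - gridPoint x.2 = k then f k else 0)
      (f (gridPoint x.1 - gridPoint x.2)) := fun x => by
    convert hasSum_ite_eq (gridPoint x.1 - gridPoint x.2) (f (gridPoint x.1 - gridPoint x.2))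
      using 2 with k
    by_cases hk : gridPoint x.1 - gridPoint x.2 = k
    · simp [hk]
    · simp [hk, Ne.symm hk]
  rw [← Finset.sum_product' (f := fun s t => f (gridPoint s - gridPoint t)),
    ← (hasSum_sum fun x _ => h x).tsum_eq]
  refine tsum_congr fun k => ?_
  rw [← Finset.sum_filter, Finset.sum_const, nsmul_eq_mul]
  rfl

/-- The average over pairs of grid points of a summable function of the difference converges to the
total sum. -/
theorem tendsto_sum_grid_div {f : ℤ × ℤ → ℝ} (hf : Summable f) (a b : ℕ) :
    Tendsto (fun n : ℕ => ((n : ℝ) ^ 2)⁻¹ * ∑ s ∈ grid (n - a), ∑ t ∈ grid (n - b),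
      f (gridPoint s - gridPoint t)) atTop (𝓝 (∑' k, f k)) := by
  simp_rw [sum_grid_eq_tsum, ← tsum_mul_left]
  -- A difference `k` occurs at most `n²` times, and `n² (1 - o(1))` times for fixed `k`: the
  -- weights are at most `1` and tend to `1`.
  refine tendsto_tsum_of_dominated_convergence hf.norm (fun k => ?_)
    (eventually_atTop.2 ⟨1, fun n hn k => ?_⟩)
  · suffices h : Tendsto (fun n : ℕ => ((n : ℝ) ^ 2)⁻¹ * ((diffPairs (n - a) (n - b) k).card : ℝ))
        atTop (𝓝 1) by
      simpa [mul_assoc] using h.mul_const (f k)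
    set L := a + b + 2 * (k.1.natAbs + k.2.natAbs)
    have h1 : Tendsto (fun n : ℕ => ((n : ℝ) ^ 2)⁻¹ * ((n - L : ℕ) : ℝ) ^ 2) atTop (𝓝 1) := by
      have h2 : Tendsto (fun n : ℕ => (1 - (L : ℝ) / n) ^ 2) atTop (𝓝 1) := by
        have := ((tendsto_const_div_atTop_nhds_zero_nat (L : ℝ)).const_sub 1).pow 2
        simpa using this
      refine h2.congr' (eventually_atTop.2 ⟨L + 1, fun n hn => ?_⟩)
      have hn0 : (n : ℝ) ≠ 0 := by have : n ≠ 0 := by omega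
                                   exact_mod_cast this
      simp only
      rw [Nat.cast_sub (by omega)]
      field_simp
    refine tendsto_of_tendsto_of_tendsto_of_le_of_le' h1 tendsto_const_nhds
      (Eventually.of_forall fun n => ?_) (eventually_atTop.2 ⟨1, fun n hn => ?_⟩)
    · gcongr
      exact_mod_cast le_card_diffPairs n a b k
    · rw [inv_mul_le_one₀ (by positivity)]
      have := (card_diffPairs_le (n - a) (n - b) k).trans (Nat.pow_le_pow_left (Nat.sub_le n a) 2)
      exact_mod_cast this
  · rw [← mul_assoc, norm_mul]
    refine mul_le_of_le_one_left (norm_nonneg _) ?_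
    rw [Real.norm_of_nonneg (by positivity), inv_mul_le_one₀ (by positivity)]
    have := (card_diffPairs_le (n - a) (n - b) k).trans (Nat.pow_le_pow_left (Nat.sub_le n a) 2)
    exact_mod_cast this

end PowerLaw
end

open scoped MatrixOrder
noncomputable section
namespace PowerLaw

/-! ### Diagonal quadratic forms in Gaussian vectors -/

section Diagonalization

variable {ι : Type*} [Fintype ι] [DecidableEq ι]

lemma sum_mul_sq_eq_dotProduct (w v : ι → ℝ) :
    ∑ i, w i * v i ^ 2 = v ⬝ᵥ (diagonal w *ᵥ v) := by
  simp only [dotProduct, mulVec_diagonal]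
  exact Finset.sum_congr rfl fun i _ => by ring

/-- The law of a diagonal quadratic form in a centred Gaussian vector is that of a diagonal
quadratic form in independent standard Gaussian variables. -/
theorem exists_map_sum_mul_sq_eq {C : Matrix ι ι ℝ} (hC : C.PosSemidef) (w : ι → ℝ) :
    ∃ l : ι → ℝ, ∑ i, l i = ∑ i, w i * C i i ∧
      ∑ i, l i ^ 2 = ∑ i, ∑ j, w i * w j * C i j ^ 2 ∧
      (∀ κ M : ℝ, 0 ≤ M → (∀ u : ι → ℝ, u ⬝ᵥ (C *ᵥ u) ≤ κ * ∑ i, u i ^ 2) → (∀ i, |w i| ≤ M) →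
        ∀ i, |l i| ≤ M * κ) ∧
      (multivariateGaussian 0 C).map (fun v => ∑ i, w i * v i ^ 2) =
        (Measure.pi fun _ : ι => gaussianReal 0 1).map (fun z => ∑ i, l i * z i ^ 2) := by
  set S := CFC.sqrt C with hS_def
  have hSS : S * S = C := CFC.sqrt_mul_sqrt_self C hC.nonneg
  have hSsymm : Sᵀ = S := by
    have : IsSelfAdjoint S := (CFC.sqrt_nonneg C).isSelfAdjoint
    rw [← conjTranspose_eq_transpose_of_trivial]; exact this
  have hCsymm : ∀ i j, C j i = C i j := fun i j => by
    have := congrFun (congrFun hC.1 i) j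
    simpa using this
  -- Writing the vector as `S z` with `S = √C`, the form is `z · M z`. Its coefficients are the
  -- eigenvalues of `M`, since the standard Gaussian law is the same in an eigenbasis; the traces of
  -- `M` and `M²` give the two identities.
  set M := S * diagonal w * S with hM_def
  have hM : M.IsHermitian := by
    rw [IsHermitian, conjTranspose_eq_transpose_of_trivial, hM_def, transpose_mul, transpose_mul,
      hSsymm, diagonal_transpose, mul_assoc]
  have hquad : ∀ x : ι → ℝ, ∑ i, w i * (S *ᵥ x) i ^ 2 = x ⬝ᵥ (M *ᵥ x) := fun x => by
    rw [sum_mul_sq_eq_dotProduct, hM_def, ← mulVec_mulVec, ← mulVec_mulVec,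
      dotProduct_mulVec x S, ← mulVec_transpose, hSsymm]
  set b := hM.eigenvectorBasis
  have hbM : ∀ j, M *ᵥ (b j).ofLp = hM.eigenvalues j • (b j).ofLp := hM.mulVec_eigenvectorBasis
  have hbb : ∀ i j, (b i).ofLp ⬝ᵥ (b j).ofLp = if i = j then 1 else 0 := fun i j => by
    have := orthonormal_iff_ite.1 b.orthonormal j i
    rw [EuclideanSpace.inner_eq_star_dotProduct] at this
    simpa [eq_comm] using this
  refine ⟨hM.eigenvalues, ?_, ?_, ?_, ?_⟩
  · have h1 := hM.trace_eq_sum_eigenvalues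
    simp only [RCLike.ofReal_real_eq_id, id] at h1
    rw [← h1, hM_def, trace_mul_comm, ← mul_assoc, hSS, trace]
    exact Finset.sum_congr rfl fun i _ => by simp [mul_comm]
  · have h1 : (M * M).trace = ∑ i, hM.eigenvalues i ^ 2 := by
      conv_lhs => rw [hM.spectral_theorem, ← map_mul, diagonal_mul_diagonal,
        Unitary.conjStarAlgAut_apply, trace_mul_comm, ← mul_assoc]
      simp [trace_diagonal, sq]
    rw [← h1, hM_def, show S * diagonal w * S * (S * diagonal w * S) =
      S * (diagonal w * (S * S) * (diagonal w * S)) by simp only [mul_assoc], trace_mul_comm,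
      show diagonal w * (S * S) * (diagonal w * S) * S = diagonal w * (S * S) * (diagonal w * (S * S))
        by simp only [mul_assoc], hSS, trace]
    refine Finset.sum_congr rfl fun i _ => ?_
    simp only [diag_apply, mul_apply (M := diagonal w * C), diagonal_mul]
    refine Finset.sum_congr rfl fun j _ => ?_
    rw [hCsymm i j]; ring
  · intro κ B hB hκ hw i
    -- Rayleigh quotient at the unit eigenvector `b i`, where `|S (b i)|² = b i · C (b i) ≤ κ`.
    have h1 : hM.eigenvalues i = ∑ j, w j * (S *ᵥ (b i).ofLp) j ^ 2 := by
      rw [hquad, hbM, dotProduct_smul, hbb]; simp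
    have h2 : ∑ j, (S *ᵥ (b i).ofLp) j ^ 2 = (b i).ofLp ⬝ᵥ (C *ᵥ (b i).ofLp) := by
      rw [← hSS, ← mulVec_mulVec, dotProduct_mulVec (b i).ofLp S, ← mulVec_transpose, hSsymm,
        dotProduct]
      exact Finset.sum_congr rfl fun j _ => sq _
    have h3 : ∑ j, (b i).ofLp j ^ 2 = 1 := by
      have := hbb i i
      rw [if_pos rfl, dotProduct] at this
      rw [← this]; exact Finset.sum_congr rfl fun j _ => sq _
    rw [h1]
    calc |∑ j, w j * (S *ᵥ (b i).ofLp) j ^ 2| ≤ ∑ j, |w j * (S *ᵥ (b i).ofLp) j ^ 2| :=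
          Finset.abs_sum_le_sum_abs _ _
      _ ≤ ∑ j, B * (S *ᵥ (b i).ofLp) j ^ 2 := by
          refine Finset.sum_le_sum fun j _ => ?_
          rw [abs_mul, abs_of_nonneg (sq_nonneg ((S *ᵥ (b i).ofLp) j))]
          exact mul_le_mul_of_nonneg_right (hw j) (sq_nonneg _)
      _ = B * ((b i).ofLp ⬝ᵥ (C *ᵥ (b i).ofLp)) := by rw [← Finset.mul_sum, h2]
      _ ≤ B * κ := by
          refine mul_le_mul_of_nonneg_left ?_ hB
          simpa [h3] using hκ (b i).ofLp
  · rw [multivariateGaussian, stdGaussian_eq_map_pi_orthonormalBasis b,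
      Measure.map_map (by fun_prop) (by fun_prop), Measure.map_map (by fun_prop) (by fun_prop)]
    congr 1
    ext z
    have h0 : (∑ i, z i • b i).ofLp = ∑ i, z i • (b i).ofLp := by simp
    simp only [Function.comp_apply, zero_add, ofLp_toEuclideanCLM, ← hS_def]
    rw [hquad, h0, mulVec_sum]
    simp only [mulVec_smul, hbM, sum_dotProduct, dotProduct_sum, smul_dotProduct, dotProduct_smul,
      hbb]
    refine Finset.sum_congr rfl fun i _ => ?_
    simp; ring

end Diagonalization

end PowerLaw
end

open scoped ENNReal NNReal
noncomputable section
namespace PowerLaw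

/-! ### Moments of the square of a standard Gaussian variable -/

lemma gaussianPDFReal_zero_one (x : ℝ) :
    gaussianPDFReal 0 1 x = (√(2 * Real.pi))⁻¹ * Real.exp (-(1 / 2) * x ^ 2) := by
  rw [gaussianPDFReal]; simp; left; ring_nf

lemma integral_rpow_four_mul_exp :
    ∫ x : ℝ, x ^ 4 * Real.exp (-(1 / 2) * x ^ 2) = 3 * √(2 * Real.pi) := by
  have h1 : ∫ x : ℝ, x ^ 4 * Real.exp (-(1 / 2) * x ^ 2) =
      2 * ∫ x in Set.Ioi (0 : ℝ), x ^ 4 * Real.exp (-(1 / 2) * x ^ 2) := by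
    rw [← integral_comp_abs]
    refine integral_congr_ae (ae_of_all _ fun x => ?_)
    simp only [sq_abs, show |x| ^ 4 = x ^ 4 by rw [show 4 = 2 * 2 by norm_num, pow_mul, sq_abs, pow_mul]]
  have h2 := integral_rpow_mul_exp_neg_mul_rpow (p := 2) (q := 4) (b := 1 / 2) (by norm_num)
    (by norm_num) (by norm_num)
  have h3 : ∫ x in Set.Ioi (0 : ℝ), x ^ 4 * Real.exp (-(1 / 2) * x ^ 2) =
      ∫ x in Set.Ioi (0 : ℝ), x ^ (4 : ℝ) * Real.exp (-(1 / 2) * x ^ (2 : ℝ)) := by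
    refine setIntegral_congr_fun measurableSet_Ioi fun x _ => ?_
    simp only [Real.rpow_two]
    norm_cast
  have h4 : Real.Gamma ((4 + 1) / 2) = 3 / 4 * √Real.pi := by
    rw [show ((4 : ℝ) + 1) / 2 = (1 / 2 + 1) + 1 by norm_num, Real.Gamma_add_one (by norm_num),
      Real.Gamma_add_one (by norm_num), Real.Gamma_one_half_eq]
    ring
  have h5 : ((1 : ℝ) / 2) ^ (-(4 + 1) / 2 : ℝ) = 4 * √2 := by
    rw [one_div, Real.inv_rpow (by norm_num), ← Real.rpow_neg (by norm_num),
      show -(-((4 : ℝ) + 1) / 2) = 2 + 1 / 2 by norm_num, Real.rpow_add (by norm_num),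
      ← Real.sqrt_eq_rpow]
    norm_num
  rw [h1, h3, h2, h4, h5, Real.sqrt_mul (by norm_num)]
  ring

lemma integral_pow_four_gaussianReal : ∫ x, x ^ 4 ∂gaussianReal 0 1 = 3 := by
  rw [integral_gaussianReal_eq_integral_smul one_ne_zero]
  simp only [gaussianPDFReal_zero_one, smul_eq_mul]
  rw [show (fun x : ℝ => (√(2 * Real.pi))⁻¹ * Real.exp (-(1 / 2) * x ^ 2) * x ^ 4) =
    fun x : ℝ => (√(2 * Real.pi))⁻¹ * (x ^ 4 * Real.exp (-(1 / 2) * x ^ 2)) by ext; ring,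
    integral_const_mul, integral_rpow_four_mul_exp]
  have : √(2 * Real.pi) ≠ 0 := by positivity
  field_simp

lemma integrable_pow_gaussianReal (n : ℕ) : Integrable (fun x : ℝ => x ^ n) (gaussianReal 0 1) := by
  have h := (memLp_id_gaussianReal (μ := 0) (v := 1) n)
  simpa using h.integrable_norm_pow' |>.mono (f := fun x : ℝ => x ^ n) (by fun_prop) (by simp)

lemma integral_sq_gaussianReal : ∫ x, x ^ 2 ∂gaussianReal 0 1 = 1 := by
  have h := variance_id_gaussianReal (μ := 0) (v := 1)
  rw [variance_eq_integral (by fun_prop)] at h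
  simpa using h

lemma integral_centredSq : ∫ x : ℝ, (x ^ 2 - 1) / √2 ∂gaussianReal 0 1 = 0 := by
  rw [integral_div, integral_sub (integrable_pow_gaussianReal 2) (by fun_prop),
    integral_sq_gaussianReal]
  simp

lemma integral_centredSq_sq : ∫ x : ℝ, ((x ^ 2 - 1) / √2) ^ 2 ∂gaussianReal 0 1 = 1 := by
  have h : ∀ x : ℝ, ((x ^ 2 - 1) / √2) ^ 2 = (x ^ 4 - 2 * x ^ 2 + 1) / 2 := fun x => by
    rw [div_pow, Real.sq_sqrt (by norm_num)]; ring
  simp_rw [h]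
  rw [integral_div, integral_add, integral_sub, integral_const_mul, integral_sq_gaussianReal,
    integral_pow_four_gaussianReal]
  · norm_num
  · exact integrable_pow_gaussianReal 4
  · exact (integrable_pow_gaussianReal 2).const_mul 2
  · exact (integrable_pow_gaussianReal 4).sub ((integrable_pow_gaussianReal 2).const_mul 2)
  · fun_prop

/-! ### The central limit theorem for diagonal quadratic forms -/

/-- The characteristic function of the standardized square of a standard Gaussian variable. -/
def chiChar (u : ℝ) : ℂ := charFun ((gaussianReal 0 1).map fun x => (x ^ 2 - 1) / √2) u

lemma chiChar_eq (u : ℝ) : chiChar (√2 * u) =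
    ∫ x : ℝ, Complex.exp ((u * (x ^ 2 - 1) : ℝ) * Complex.I) ∂gaussianReal 0 1 := by
  rw [chiChar, charFun_apply_real, integral_map (by fun_prop) (by fun_prop)]
  refine integral_congr_ae (ae_of_all _ fun x => ?_)
  have h2 : (√2 : ℂ) ≠ 0 := by exact_mod_cast (by positivity : √2 ≠ 0)
  simp only
  congr 2
  push_cast
  field_simp

lemma norm_chiChar_le (u : ℝ) : ‖chiChar u‖ ≤ 1 := by
  have : IsProbabilityMeasure ((gaussianReal 0 1).map fun x : ℝ => (x ^ 2 - 1) / √2) :=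
    Measure.isProbabilityMeasure_map (by fun_prop)
  exact norm_charFun_le_one (μ := (gaussianReal 0 1).map fun x : ℝ => (x ^ 2 - 1) / √2) u

/-- The variable `(Z² - 1) / √2` is standardized, so its characteristic function agrees to second
order with that of a standard Gaussian variable. -/
lemma exists_norm_chiChar_sub_exp_le {ε : ℝ} (hε : 0 < ε) :
    ∃ δ > 0, ∀ u : ℝ, |u| < δ → ‖chiChar u - Complex.exp (-(u ^ 2 / 2 : ℝ))‖ ≤ ε * u ^ 2 := by
  have h := taylor_charFun_two (P := gaussianReal 0 1) (X := fun x => (x ^ 2 - 1) / √2)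
    (by fun_prop) integral_centredSq integral_centredSq_sq
  have h1 := (Asymptotics.isLittleO_iff.1 h) (half_pos hε)
  obtain ⟨δ, hδ, h2⟩ := Metric.eventually_nhds_iff.1 h1
  refine ⟨min δ (min 1 (√ε)), by positivity, fun u hu => ?_⟩
  have hu1 : |u| < δ := hu.trans_le (min_le_left _ _)
  have hu2 : |u| < 1 := hu.trans_le ((min_le_right _ _).trans (min_le_left _ _))
  have hu3 : |u| < √ε := hu.trans_le ((min_le_right _ _).trans (min_le_right _ _))
  have hsq : u ^ 2 ≤ ε := by
    rw [← sq_abs, ← Real.sq_sqrt hε.le]; gcongr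
  have hsq1 : u ^ 2 ≤ 1 := by rw [← sq_abs]; nlinarith [abs_nonneg u]
  have h3 := h2 (y := u) (by simpa using hu1)
  rw [Real.norm_of_nonneg (sq_nonneg u)] at h3
  have h4 : ‖(1 - (u : ℂ) ^ 2 / 2) - Complex.exp (-(u ^ 2 / 2 : ℝ))‖ ≤ ε / 2 * u ^ 2 := by
    have h5 : |Real.exp (-(u ^ 2 / 2)) - 1 - -(u ^ 2 / 2)| ≤ (-(u ^ 2 / 2)) ^ 2 :=
      Real.abs_exp_sub_one_sub_id_le (by rw [abs_neg, abs_of_nonneg (by positivity)]; linarith)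
    rw [show (1 - (u : ℂ) ^ 2 / 2) - Complex.exp (-(u ^ 2 / 2 : ℝ)) =
      ((-(Real.exp (-(u ^ 2 / 2)) - 1 - -(u ^ 2 / 2)) : ℝ) : ℂ) by push_cast; ring,
      Complex.norm_real, Real.norm_eq_abs, abs_neg]
    refine h5.trans ?_
    nlinarith [sq_nonneg u]
  calc _ = ‖(chiChar u - (1 - (u : ℂ) ^ 2 / 2)) +
        ((1 - (u : ℂ) ^ 2 / 2) - Complex.exp (-(u ^ 2 / 2 : ℝ)))‖ := by congr 1; ring
    _ ≤ _ := (norm_add_le _ _).trans (add_le_add h3 h4)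
    _ = ε * u ^ 2 := by ring

/-- Telescoping: factors are exchanged one at a time while all others have modulus at most one. -/
lemma norm_prod_sub_prod_le_sum {ι : Type*} (s : Finset ι) (a b : ι → ℂ) (ha : ∀ i, ‖a i‖ ≤ 1)
    (hb : ∀ i, ‖b i‖ ≤ 1) : ‖∏ i ∈ s, a i - ∏ i ∈ s, b i‖ ≤ ∑ i ∈ s, ‖a i - b i‖ := by
  classical
  induction s using Finset.induction_on with
  | empty => simp
  | insert i s hi ih =>
    rw [Finset.prod_insert hi, Finset.prod_insert hi, Finset.sum_insert hi]
    have h1 : ‖∏ j ∈ s, b j‖ ≤ 1 := by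
      rw [norm_prod]; exact Finset.prod_le_one (fun _ _ => norm_nonneg _) fun j _ => hb j
    calc _ = ‖(a i - b i) * ∏ j ∈ s, b j + a i * (∏ j ∈ s, a j - ∏ j ∈ s, b j)‖ := by
          congr 1; ring
      _ ≤ ‖a i - b i‖ * ‖∏ j ∈ s, b j‖ + ‖a i‖ * ‖∏ j ∈ s, a j - ∏ j ∈ s, b j‖ := by
          refine (norm_add_le _ _).trans ?_
          rw [norm_mul, norm_mul]
      _ ≤ ‖a i - b i‖ * 1 + 1 * ∑ j ∈ s, ‖a j - b j‖ := by
          gcongr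
          exact ha i
      _ = _ := by ring

/-- The standard Gaussian measure on a finite product. -/
abbrev gaussianPi (ι : Type*) [Fintype ι] : Measure (ι → ℝ) :=
  Measure.pi fun _ : ι => gaussianReal 0 1

lemma integral_exp_sum_eq_prod {ι : Type*} [Fintype ι] (l : ι → ℝ) :
    ∫ z, Complex.exp ((∑ i, l i * (z i ^ 2 - 1) : ℝ) * Complex.I) ∂gaussianPi ι =
      ∏ i, chiChar (√2 * l i) := by
  simp_rw [chiChar_eq]
  rw [← integral_fintype_prod_eq_prod (f := fun i x =>
    Complex.exp ((l i * (x ^ 2 - 1) : ℝ) * Complex.I))]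
  refine integral_congr_ae (ae_of_all _ fun z => ?_)
  simp only
  rw [← Complex.exp_sum, Complex.ofReal_sum, Finset.sum_mul]

/-- Central limit theorem for diagonal quadratic forms in independent standard Gaussian variables,
in terms of characteristic functions. -/
theorem tendsto_integral_exp_sum {ι : ℕ → Type*} [∀ n, Fintype (ι n)] (l : ∀ n, ι n → ℝ)
    {m : ℕ → ℝ} (hm : Tendsto m atTop (𝓝 0)) (hl : ∀ᶠ n in atTop, ∀ i, |l n i| ≤ m n) {v : ℝ}
    (hv : Tendsto (fun n => 2 * ∑ i, l n i ^ 2) atTop (𝓝 v)) :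
    Tendsto (fun n => ∫ z, Complex.exp ((∑ i, l n i * (z i ^ 2 - 1) : ℝ) * Complex.I)
      ∂gaussianPi (ι n)) atTop (𝓝 (Complex.exp (-(v / 2 : ℝ)))) := by
  simp_rw [integral_exp_sum_eq_prod]
  have h1 : Tendsto (fun n => Complex.exp (-((2 * ∑ i, l n i ^ 2) / 2 : ℝ))) atTop
      (𝓝 (Complex.exp (-(v / 2 : ℝ)))) := by
    have : Continuous fun x : ℝ => Complex.exp (-(x / 2 : ℝ)) := by fun_prop
    exact (this.tendsto v).comp hv
  refine (tendsto_iff_of_dist ?_).2 h1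
  rw [Metric.tendsto_atTop]
  intro ε hε
  have hv0 : 0 ≤ v := ge_of_tendsto' hv fun n => by positivity
  -- Eventually `2 ∑ l² < v + 1`, so the division by `v + 2` keeps the accumulated error below `ε`.
  obtain ⟨δ, hδ, hchi⟩ := exists_norm_chiChar_sub_exp_le (ε := ε / (v + 2)) (by positivity)
  have e1 : ∀ᶠ n in atTop, √2 * m n < δ := by
    have : Tendsto (fun n => √2 * m n) atTop (𝓝 (√2 * 0)) := hm.const_mul _
    rw [mul_zero] at this
    exact this.eventually_lt_const hδ
  have e2 : ∀ᶠ n in atTop, 2 * ∑ i, l n i ^ 2 < v + 1 := hv.eventually_lt_const (by linarith)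
  obtain ⟨N, hN⟩ := eventually_atTop.1 (e1.and (e2.and hl))
  refine ⟨N, fun n hn => ?_⟩
  obtain ⟨a1, a2, a3⟩ := hN n hn
  rw [Real.dist_0_eq_abs, abs_of_nonneg dist_nonneg, dist_eq_norm]
  have h2 : Complex.exp (-((2 * ∑ i, l n i ^ 2) / 2 : ℝ)) =
      ∏ i, Complex.exp (-((√2 * l n i) ^ 2 / 2 : ℝ)) := by
    rw [← Complex.exp_sum]
    congr 1
    rw [Finset.mul_sum, Finset.sum_div, Complex.ofReal_sum, ← Finset.sum_neg_distrib]
    refine Finset.sum_congr rfl fun i _ => ?_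
    rw [mul_pow, Real.sq_sqrt (by norm_num)]
  rw [h2]
  refine (norm_prod_sub_prod_le_sum _ _ _ (fun i => norm_chiChar_le _) fun i => ?_).trans_lt ?_
  · rw [← Complex.ofReal_neg, ← Complex.ofReal_exp, Complex.norm_real,
      Real.norm_of_nonneg (Real.exp_pos _).le, Real.exp_le_one_iff]
    have : 0 ≤ (√2 * l n i) ^ 2 / 2 := by positivity
    linarith
  · calc _ ≤ ∑ i, ε / (v + 2) * (√2 * l n i) ^ 2 := by
          refine Finset.sum_le_sum fun i _ => hchi _ ?_
          rw [abs_mul, abs_of_nonneg (Real.sqrt_nonneg 2)]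
          exact lt_of_le_of_lt (by gcongr; exact a3 i) a1
      _ = ε / (v + 2) * (2 * ∑ i, l n i ^ 2) := by
          rw [← Finset.mul_sum]
          congr 1
          rw [Finset.mul_sum]
          refine Finset.sum_congr rfl fun i _ => ?_
          rw [mul_pow, Real.sq_sqrt (by norm_num)]
      _ ≤ ε / (v + 2) * (v + 1) := by gcongr
      _ < ε := by
          rw [div_mul_eq_mul_div, div_lt_iff₀ (by positivity)]
          nlinarith

/-! ### Exponential moments of diagonal quadratic forms -/

lemma inv_one_sub_le_exp {x : ℝ} (hx : |x| ≤ 1 / 2) : 1 / (1 - x) ≤ Real.exp (x + 2 * x ^ 2) := by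
  have hx' := abs_le.1 hx
  have h1 : 0 < 1 - x := by linarith
  have h2 := Real.one_sub_inv_le_log_of_pos h1
  have h3 : -x - 2 * x ^ 2 ≤ 1 - (1 - x)⁻¹ := by
    have : 1 - (1 - x)⁻¹ = -x / (1 - x) := by field_simp; ring
    rw [this, le_div_iff₀ h1]
    nlinarith [sq_nonneg x]
  rw [one_div, ← Real.exp_log (inv_pos.2 h1), Real.log_inv]
  exact Real.exp_le_exp.2 (by linarith)

/-- The expectation is `e^{-y} (1 - 2y)^{-1/2}`; the bound `1 / (1 - x) ≤ e^{x + 2x²}` at `x = 2y`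
cancels the linear term. -/
lemma integral_exp_mul_sq_gaussianReal {y : ℝ} (hy : |y| ≤ 1 / 4) :
    Integrable (fun x : ℝ => Real.exp (y * (x ^ 2 - 1))) (gaussianReal 0 1) ∧
    ∫ x : ℝ, Real.exp (y * (x ^ 2 - 1)) ∂gaussianReal 0 1 ≤ Real.exp (4 * y ^ 2) := by
  have hy' := abs_le.1 hy
  have hb : 0 < 1 / 2 - y := by linarith
  have e : ∀ x : ℝ, gaussianPDFReal 0 1 x • Real.exp (y * (x ^ 2 - 1)) =
      ((√(2 * Real.pi))⁻¹ * Real.exp (-y)) * Real.exp (-(1 / 2 - y) * x ^ 2) := fun x => by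
    rw [gaussianPDFReal_zero_one, smul_eq_mul, mul_assoc, mul_assoc, ← Real.exp_add,
      ← Real.exp_add]
    ring_nf
  constructor
  · rw [gaussianReal_of_var_ne_zero _ one_ne_zero,
      integrable_withDensity_iff_integrable_smul' (measurable_gaussianPDF _ _)
        (ae_of_all _ fun x => gaussianPDF_lt_top)]
    simp only [toReal_gaussianPDF, e]
    exact (integrable_exp_neg_mul_sq hb).const_mul _
  · rw [integral_gaussianReal_eq_integral_smul one_ne_zero]
    simp_rw [e]
    rw [integral_const_mul, integral_gaussian]
    have h1 : (√(2 * Real.pi))⁻¹ * √(Real.pi / (1 / 2 - y)) = √(1 / (1 - 2 * y)) := by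
      rw [← Real.sqrt_inv, ← Real.sqrt_mul (by positivity)]
      congr 1
      have : 1 - 2 * y ≠ 0 := by linarith
      have : 1 / 2 - y ≠ 0 := hb.ne'
      have := Real.pi_ne_zero
      field_simp
    rw [mul_right_comm, h1]
    have h2 : √(1 / (1 - 2 * y)) ≤ Real.exp (y + 4 * y ^ 2) := by
      rw [Real.sqrt_le_left (Real.exp_pos _).le, ← Real.exp_nat_mul]
      refine (inv_one_sub_le_exp (x := 2 * y) ?_).trans (le_of_eq ?_)
      · rw [abs_mul, abs_two]; linarith
      · congr 1; push_cast; ring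
    calc _ ≤ Real.exp (y + 4 * y ^ 2) * Real.exp (-y) := by gcongr
      _ = _ := by rw [← Real.exp_add]; ring_nf

theorem integral_exp_sum_le {ι : Type*} [Fintype ι] {l : ι → ℝ} (hl : ∀ i, |l i| ≤ 1 / 4) :
    Integrable (fun z => Real.exp (∑ i, l i * (z i ^ 2 - 1))) (gaussianPi ι) ∧
    ∫ z, Real.exp (∑ i, l i * (z i ^ 2 - 1)) ∂gaussianPi ι ≤ Real.exp (4 * ∑ i, l i ^ 2) := by
  simp_rw [Real.exp_sum]
  refine ⟨Integrable.fintype_prod (f := fun i x => Real.exp (l i * (x ^ 2 - 1)))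
    fun i => (integral_exp_mul_sq_gaussianReal (hl i)).1, ?_⟩
  rw [integral_fintype_prod_eq_prod (f := fun i x => Real.exp (l i * (x ^ 2 - 1))), Finset.mul_sum,
    Real.exp_sum]
  exact Finset.prod_le_prod (fun i _ => integral_nonneg fun x => (Real.exp_pos _).le)
    fun i _ => (integral_exp_mul_sq_gaussianReal (hl i)).2

end PowerLaw
end

open scoped ENNReal NNReal
noncomputable section
namespace PowerLaw

/-! ### Negative moments of diagonal quadratic forms -/

lemma integrableOn_abs_rpow : IntegrableOn (fun x : ℝ => |x| ^ (-(1 / 2) : ℝ)) (Set.Icc (-1) 1) := by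
  have h1 : IntegrableOn (fun x : ℝ => |x| ^ (-(1 / 2) : ℝ)) (Set.Ioc 0 1) := by
    have := (intervalIntegral.intervalIntegrable_rpow' (a := 0) (b := 1) (r := -(1 / 2))
      (by norm_num))
    rw [intervalIntegrable_iff_integrableOn_Ioc_of_le zero_le_one] at this
    refine this.congr_fun (fun x hx => ?_) measurableSet_Ioc
    simp only [abs_of_pos hx.1]
  have h2 : IntegrableOn (fun x : ℝ => |x| ^ (-(1 / 2) : ℝ)) (Set.Ico (-1) 0) := by
    have h3 := ((Measure.measurePreserving_neg (volume : Measure ℝ)).integrableOn_comp_preimage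
      (MeasurableEquiv.neg ℝ).measurableEmbedding).2 h1
    have e : (fun x : ℝ => -x) ⁻¹' Set.Ioc 0 1 = Set.Ico (-1) 0 := by
      ext x; simp only [Set.mem_preimage, Set.mem_Ioc, Set.mem_Ico]
      constructor <;> rintro ⟨a, b⟩ <;> constructor <;> linarith
    rw [show Neg.neg ⁻¹' Set.Ioc (0 : ℝ) 1 = Set.Ico (-1) 0 from e] at h3
    refine h3.congr_fun (fun x _ => ?_) measurableSet_Ico
    simp
  have h4 : IntegrableOn (fun x : ℝ => |x| ^ (-(1 / 2) : ℝ)) {0} := by simp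
  refine ((h2.union h4).union h1).mono_set fun x hx => ?_
  rcases lt_trichotomy x 0 with h | h | h
  · exact Or.inl (Or.inl ⟨hx.1, h⟩)
  · exact Or.inl (Or.inr h)
  · exact Or.inr ⟨h, hx.2⟩

/-- The standard Gaussian density is at most `(2π)^{-1/2} < 1`. -/
lemma gaussianReal_le_volume : gaussianReal 0 1 ≤ volume := by
  refine Measure.le_iff.2 fun s hs => ?_
  rw [gaussianReal_apply _ one_ne_zero]
  refine (setLIntegral_mono (g := fun _ => 1) (by fun_prop) fun x _ => ?_).trans (by simp)
  rw [gaussianPDF, gaussianPDFReal_zero_one, ← ENNReal.ofReal_one]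
  refine ENNReal.ofReal_le_ofReal ?_
  have h1 : (√(2 * Real.pi))⁻¹ ≤ 1 := by
    refine inv_le_one_of_one_le₀ ?_
    rw [Real.one_le_sqrt]; nlinarith [Real.pi_gt_three]
  have h2 : Real.exp (-(1 / 2) * x ^ 2) ≤ 1 := by
    rw [Real.exp_le_one_iff]; nlinarith [sq_nonneg x]
  nlinarith [Real.exp_pos (-(1 / 2) * x ^ 2), inv_nonneg.2 (Real.sqrt_nonneg (2 * Real.pi))]

/-- Outside `|x - r| ≤ 1` the integrand is at most `1`; inside, the comparison with Lebesgue measure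
and its translation invariance give a bound uniform in `r`. -/
lemma exists_lintegral_abs_sub_rpow_le : ∃ K : ℝ≥0, ∀ r : ℝ,
    ∫⁻ x, ENNReal.ofReal (|x - r| ^ (-(1 / 2) : ℝ)) ∂gaussianReal 0 1 ≤ K := by
  set J := ∫⁻ x in Set.Icc (-1 : ℝ) 1, ENNReal.ofReal (|x| ^ (-(1 / 2) : ℝ)) with hJ
  have hJt : J ≠ ⊤ := by
    have := integrableOn_abs_rpow.2
    rw [hasFiniteIntegral_iff_ofReal (ae_of_all _ fun x => by positivity)] at this
    exact this.ne
  refine ⟨(J + 1).toNNReal, fun r => ?_⟩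
  rw [ENNReal.coe_toNNReal (by simp [hJt])]
  have hpt : ∀ x : ℝ, ENNReal.ofReal (|x - r| ^ (-(1 / 2) : ℝ)) ≤
      (Set.Icc (-1 : ℝ) 1).indicator (fun y => ENNReal.ofReal (|y| ^ (-(1 / 2) : ℝ))) (x - r) + 1 := by
    intro x
    by_cases hx : x - r ∈ Set.Icc (-1 : ℝ) 1
    · simp [Set.indicator_of_mem hx]
    · rw [Set.indicator_of_notMem hx, zero_add, ← ENNReal.ofReal_one]
      refine ENNReal.ofReal_le_ofReal (Real.rpow_le_one_of_one_le_of_nonpos ?_ (by norm_num))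
      by_contra h
      push Not at h
      exact hx ⟨(abs_lt.1 h).1.le, (abs_lt.1 h).2.le⟩
  refine (lintegral_mono hpt).trans ?_
  rw [lintegral_add_right _ measurable_const]
  refine add_le_add ?_ (by simp)
  refine (lintegral_mono' gaussianReal_le_volume le_rfl).trans (le_of_eq ?_)
  rw [lintegral_sub_right_eq_self (fun y => (Set.Icc (-1 : ℝ) 1).indicator
    (fun y => ENNReal.ofReal (|y| ^ (-(1 / 2) : ℝ))) y) r, lintegral_indicator measurableSet_Icc]

/-- For `c ≤ 0` factor `x² + c = (x - r)(x + r)` and use `ab ≤ a² + b²`: the exponent `1/4` doubles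
to `1/2`, still integrable at each root. For `0 ≤ c` one has `√(-c) = 0` and `x² + c ≥ x²`. -/
lemma abs_sq_add_rpow_le {x c : ℝ} (hx : x ≠ 0) :
    |x ^ 2 + c| ^ (-(1 / 4) : ℝ) ≤ |x - √(-c)| ^ (-(1 / 2) : ℝ) + |x - -√(-c)| ^ (-(1 / 2) : ℝ) := by
  rcases le_total 0 c with hc | hc
  · have h1 : |x ^ 2 + c| ^ (-(1 / 4) : ℝ) ≤ |x| ^ (-(1 / 2) : ℝ) := by
      have h2 : |x| ^ (-(1 / 2) : ℝ) = (x ^ 2) ^ (-(1 / 4) : ℝ) := by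
        rw [← sq_abs, ← Real.rpow_two, ← Real.rpow_mul (abs_nonneg x)]; norm_num
      rw [h2, abs_of_nonneg (by positivity)]
      exact Real.rpow_le_rpow_of_nonpos (by positivity) (by linarith) (by norm_num)
    rw [Real.sqrt_eq_zero_of_nonpos (by linarith)]
    simp only [sub_zero, neg_zero]
    have : 0 ≤ |x| ^ (-(1 / 2) : ℝ) := by positivity
    linarith
  · set r := √(-c)
    have hr : r ^ 2 = -c := Real.sq_sqrt (by linarith)
    have h1 : x ^ 2 + c = (x - r) * (x - -r) := by nlinarith
    rw [h1, abs_mul, Real.mul_rpow (abs_nonneg _) (abs_nonneg _)]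
    have h2 : ∀ y : ℝ, |y| ^ (-(1 / 2) : ℝ) = (|y| ^ (-(1 / 4) : ℝ)) ^ 2 := fun y => by
      rw [← Real.rpow_two, ← Real.rpow_mul (abs_nonneg y)]; norm_num
    rw [h2, h2]
    nlinarith [sq_nonneg (|x - r| ^ (-(1 / 4) : ℝ) - |x - -r| ^ (-(1 / 4) : ℝ)),
      sq_nonneg (|x - r| ^ (-(1 / 4) : ℝ)), sq_nonneg (|x - -r| ^ (-(1 / 4) : ℝ))]

lemma exists_lintegral_abs_mul_sq_add_rpow_le : ∃ K : ℝ≥0, ∀ l c : ℝ, l ≠ 0 →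
    ∫⁻ x, ENNReal.ofReal (|l * x ^ 2 + c| ^ (-(1 / 4) : ℝ)) ∂gaussianReal 0 1 ≤
      K * ENNReal.ofReal (|l| ^ (-(1 / 4) : ℝ)) := by
  obtain ⟨K, hK⟩ := exists_lintegral_abs_sub_rpow_le
  refine ⟨K + K, fun l c hl => ?_⟩
  have hne : ∀ᵐ x ∂gaussianReal 0 1, x ≠ 0 := by
    have := nullSingletonClass_gaussianReal (μ := 0) (one_ne_zero (α := ℝ≥0))
    simp [ae_iff, measure_singleton]
  have h1 : ∀ᵐ x ∂gaussianReal 0 1, ENNReal.ofReal (|l * x ^ 2 + c| ^ (-(1 / 4) : ℝ)) ≤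
      ENNReal.ofReal (|l| ^ (-(1 / 4) : ℝ)) * (ENNReal.ofReal (|x - √(-(c / l))| ^ (-(1 / 2) : ℝ)) +
        ENNReal.ofReal (|x - -√(-(c / l))| ^ (-(1 / 2) : ℝ))) := by
    filter_upwards [hne] with x hx
    rw [← ENNReal.ofReal_add (by positivity) (by positivity), ← ENNReal.ofReal_mul (by positivity)]
    refine ENNReal.ofReal_le_ofReal ?_
    rw [show l * x ^ 2 + c = l * (x ^ 2 + c / l) by field_simp, abs_mul,
      Real.mul_rpow (abs_nonneg _) (abs_nonneg _)]
    exact mul_le_mul_of_nonneg_left (abs_sq_add_rpow_le hx) (by positivity)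
  refine (lintegral_mono_ae h1).trans ?_
  rw [lintegral_const_mul _ (by fun_prop), lintegral_add_left (by fun_prop), mul_comm,
    ENNReal.coe_add]
  gcongr
  · exact hK _
  · exact hK _

/-- Coordinate `i` is integrated first; a bound uniform in the frozen coordinates survives
integration against the remaining probability measures. -/
lemma lintegral_gaussianPi_le {ι : Type} [Fintype ι] [DecidableEq ι] {f : (ι → ℝ) → ℝ≥0∞}
    (hf : Measurable f) (i : ι) {c : ℝ≥0∞}
    (h : ∀ z, ∫⁻ x, f (Function.update z i x) ∂gaussianReal 0 1 ≤ c) :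
    ∫⁻ z, f z ∂gaussianPi ι ≤ c := by
  have h1 := congrFun (lmarginal_univ (μ := fun _ : ι => gaussianReal 0 1) (f := f)) 0
  have h2 := congrFun (lmarginal_univ (μ := fun _ : ι => gaussianReal 0 1)
    (f := fun _ => c)) 0
  have h3 := congrFun (lmarginal_erase' (μ := fun _ : ι => gaussianReal 0 1) f hf
    (Finset.mem_univ i)) 0
  have h4 := congrFun (lmarginal_erase' (μ := fun _ : ι => gaussianReal 0 1) (fun _ => c)
    measurable_const (Finset.mem_univ i)) 0
  simp only [lintegral_const, measure_univ, mul_one] at h2 h4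
  rw [gaussianPi, ← h1, h3, ← h2, h4]
  exact lmarginal_mono h 0

lemma sum_mul_update_sq {ι : Type} [Fintype ι] [DecidableEq ι] (l z : ι → ℝ) (i : ι) (x : ℝ) :
    ∑ j, l j * Function.update z i x j ^ 2 =
      l i * x ^ 2 + ∑ j ∈ Finset.univ.erase i, l j * z j ^ 2 := by
  rw [← Finset.add_sum_erase _ _ (Finset.mem_univ i), Function.update_self]
  congr 1
  refine Finset.sum_congr rfl fun j hj => ?_
  rw [Function.update_of_ne (Finset.ne_of_mem_erase hj)]

/-- A diagonal Gaussian quadratic form has a negative moment of order `1/4`, controlled by any of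
its coefficients. -/
theorem exists_lintegral_abs_sum_rpow_le : ∃ K : ℝ≥0, ∀ {ι : Type} [Fintype ι] (l : ι → ℝ) (i : ι),
    l i ≠ 0 → ∫⁻ z, ENNReal.ofReal (|∑ j, l j * z j ^ 2| ^ (-(1 / 4) : ℝ)) ∂gaussianPi ι ≤
      K * ENNReal.ofReal (|l i| ^ (-(1 / 4) : ℝ)) := by
  classical
  obtain ⟨K, hK⟩ := exists_lintegral_abs_mul_sq_add_rpow_le
  refine ⟨K, fun {ι} _ l i hi => lintegral_gaussianPi_le (by fun_prop) i fun z => ?_⟩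
  simp only [sum_mul_update_sq]
  exact hK _ _ hi

/-- A diagonal Gaussian quadratic form with nonzero mean almost surely does not vanish. -/
theorem ae_sum_mul_sq_ne_zero {ι : Type} [Fintype ι] (l : ι → ℝ) (hl : ∑ i, l i ≠ 0) :
    ∀ᵐ z ∂gaussianPi ι, ∑ j, l j * z j ^ 2 ≠ 0 := by
  classical
  obtain ⟨i, -, hi⟩ := Finset.exists_ne_zero_of_sum_ne_zero hl
  have hS : MeasurableSet {z : ι → ℝ | ∑ j, l j * z j ^ 2 = 0} :=
    (by fun_prop : Measurable fun z : ι → ℝ => ∑ j, l j * z j ^ 2) (measurableSet_singleton 0)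
  rw [ae_iff]
  simp only [ne_eq, not_not]
  rw [← lintegral_indicator_one hS]
  refine nonpos_iff_eq_zero.1 (lintegral_gaussianPi_le (measurable_one.indicator hS) i fun z => ?_)
  set c := ∑ j ∈ Finset.univ.erase i, l j * z j ^ 2 with hc
  -- With the other coordinates frozen, `l i x² + c = 0` has at most these two roots, a Gaussian
  -- null set.
  have hfin : ({√(-(c / l i)), -√(-(c / l i))} : Set ℝ).Finite := Set.toFinite _
  have := nullSingletonClass_gaussianReal (μ := 0) (one_ne_zero (α := ℝ≥0))
  have hae : ∀ᵐ x ∂gaussianReal 0 1, x ∉ ({√(-(c / l i)), -√(-(c / l i))} : Set ℝ) :=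
    measure_eq_zero_iff_ae_notMem.1 (hfin.measure_zero _)
  rw [nonpos_iff_eq_zero, lintegral_eq_zero_iff']
  · filter_upwards [hae] with x hx
    refine Set.indicator_of_notMem (fun h => hx ?_) _
    have h0 : l i * x ^ 2 + c = 0 := by rw [← sum_mul_update_sq]; exact h
    have h1 : -(c / l i) = x ^ 2 := by field_simp; linarith
    rw [h1, Real.sqrt_sq_eq_abs]
    rcases abs_choice x with h2 | h2 <;> simp [h2]
  · exact ((measurable_one.indicator hS).comp (by fun_prop)).aemeasurable

/-- A diagonal Gaussian quadratic form with nonzero mean has a negative moment of order `1/4`. -/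
theorem exists_lintegral_abs_sum_rpow_le_card : ∃ K : ℝ≥0, ∀ {ι : Type} [Fintype ι] (l : ι → ℝ),
    ∑ i, l i ≠ 0 → ∫⁻ z, ENNReal.ofReal (|∑ j, l j * z j ^ 2| ^ (-(1 / 4) : ℝ)) ∂gaussianPi ι ≤
      K * ENNReal.ofReal ((|∑ i, l i| / Fintype.card ι) ^ (-(1 / 4) : ℝ)) := by
  obtain ⟨K, hK⟩ := exists_lintegral_abs_sum_rpow_le
  refine ⟨K, fun {ι} _ l hl => ?_⟩
  have hne : (Finset.univ : Finset ι).Nonempty := by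
    by_contra h
    rw [Finset.not_nonempty_iff_eq_empty] at h
    simp [h] at hl
  have hcard : 0 < (Fintype.card ι : ℝ) := by
    have := Finset.card_pos.2 hne
    exact_mod_cast this
  -- The coefficient of largest modulus is at least the modulus of the mean divided by the number of
  -- terms.
  obtain ⟨i, -, hi⟩ := Finset.exists_max_image Finset.univ (fun i => |l i|) hne
  have h1 : |∑ i, l i| / Fintype.card ι ≤ |l i| := by
    rw [div_le_iff₀ hcard]
    calc |∑ i, l i| ≤ ∑ i, |l i| := Finset.abs_sum_le_sum_abs _ _
      _ ≤ ∑ _j : ι, |l i| := Finset.sum_le_sum fun j hj => hi j hj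
      _ = _ := by simp [mul_comm]
  have h0 : 0 < |∑ i, l i| / Fintype.card ι := div_pos (abs_pos.2 hl) hcard
  refine (hK l i (abs_pos.1 (h0.trans_le h1))).trans
    (mul_le_mul' le_rfl (ENNReal.ofReal_le_ofReal ?_))
  exact Real.rpow_le_rpow_of_nonpos h0 h1 (by norm_num)

end PowerLaw
end

noncomputable section
namespace PowerLaw

variable {φ₁ φ₂ : ℝ}

/-! ### The joint law of the bilinear differences -/

/-- The index set of the bilinear differences with steps one and two of data on `Λ_n`. -/
abbrev DiffIndex (n : ℕ) : Type := Σ a : Fin 2, {t // t ∈ grid (n - 2 * ((a : ℕ) + 1))}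

/-- The covariance matrix of the bilinear differences of the unit-lattice field. -/
def diffCovMatrix (φ₁ φ₂ : ℝ) (n : ℕ) : Matrix (DiffIndex n) (DiffIndex n) ℝ :=
  Matrix.of fun i j => diffCov φ₁ φ₂ (i.1 + 1) (j.1 + 1) (gridPoint i.2 - gridPoint j.2)

lemma genCov_neg (h : Plane) : genCov φ₁ φ₂ (-h) = genCov φ₁ φ₂ h := by simp [genCov]

/-- The self-similarity that makes the law of the normalized differences independent of the grid
spacing. -/
lemma genCov_smul {δ : ℝ} (hδ : 0 < δ) (h : Plane) :
    genCov φ₁ φ₂ (δ • h) = δ ^ (2 * φ₂) * genCov φ₁ φ₂ h := by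
  rw [genCov, norm_smul, Real.norm_of_nonneg hδ.le, Real.mul_rpow hδ.le (norm_nonneg _), genCov]
  ring

lemma latticePoint_neg (k : ℤ × ℤ) : latticePoint (-k) = -latticePoint k := by
  ext i; fin_cases i <;> simp

lemma diffCov_neg (a b : ℕ) (k : ℤ × ℤ) : diffCov φ₁ φ₂ b a (-k) = diffCov φ₁ φ₂ a b k := by
  rw [diffCov, diffCov, Finset.sum_comm]
  refine Finset.sum_congr rfl fun p _ => Finset.sum_congr rfl fun q _ => ?_
  rw [← genCov_neg, ← latticePoint_neg, mul_comm (cornerSign q)]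
  congr 3
  abel

lemma dotProduct_diffCovMatrix (n : ℕ) (u : DiffIndex n → ℝ) :
    u ⬝ᵥ (diffCovMatrix φ₁ φ₂ n *ᵥ u) = ∑ i, ∑ j, u i * u j *
      diffCov φ₁ φ₂ (i.1 + 1) (j.1 + 1) (gridPoint i.2 - gridPoint j.2) := by
  simp only [dotProduct, mulVec, Finset.mul_sum, diffCovMatrix, Matrix.of_apply]
  exact Finset.sum_congr rfl fun i _ => Finset.sum_congr rfl fun j _ => by ring

lemma posSemidef_diffCovMatrix (hφ₁ : 0 < φ₁) (hφ₂ : 0 < φ₂) (hφ₂' : φ₂ < 1) (n : ℕ) :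
    (diffCovMatrix φ₁ φ₂ n).PosSemidef := by
  refine Matrix.PosSemidef.of_dotProduct_mulVec_nonneg ?_ fun u => ?_
  · ext i j
    simp only [diffCovMatrix, conjTranspose_apply, Matrix.of_apply, star_trivial]
    rw [← diffCov_neg, neg_sub]
  · rw [star_trivial, dotProduct_diffCovMatrix]
    exact sum_diffCov_nonneg hφ₁ hφ₂ hφ₂' (fun i : DiffIndex n => i.1 + 1)
      (fun i => gridPoint i.2) u

lemma exists_dotProduct_diffCovMatrix_le (hφ₁ : 0 < φ₁) (hφ₂ : 0 < φ₂) (hφ₂' : φ₂ < 1) :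
    ∃ κ : ℝ, 0 < κ ∧ ∀ n (u : DiffIndex n → ℝ),
      u ⬝ᵥ (diffCovMatrix φ₁ φ₂ n *ᵥ u) ≤ κ * ∑ i, u i ^ 2 := by
  obtain ⟨κ, hκ, h⟩ := exists_sum_diffCov_le hφ₁ hφ₂ hφ₂'
  refine ⟨κ, hκ, fun n u => ?_⟩
  rw [dotProduct_diffCovMatrix]
  refine h (fun i : DiffIndex n => i.1) (fun i => gridPoint i.2) ?_ u
  rintro ⟨a, s⟩ ⟨b, t⟩ hst
  simp only [Prod.mk.injEq] at hst
  obtain ⟨rfl, h2⟩ := hst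
  rw [Subtype.ext (gridPoint_injective h2)]

/-- The point of the plane with coordinates `δ t`. -/
def scaledPoint (δ : ℝ) (t : ℕ × ℕ) : Plane := !₂[δ * t.1, δ * t.2]

/-- The corners of the unit square, as natural numbers. -/
def natCorner : Fin 4 → ℕ × ℕ := ![(0, 0), (1, 0), (0, 1), (1, 1)]

lemma gridPoint_add_natCorner (t : ℕ × ℕ) (r : ℕ) (p : Fin 4) :
    gridPoint (t + r • natCorner p) = gridPoint t + (r : ℤ) • corner p := by
  fin_cases p <;> simp [gridPoint, natCorner, corner]

lemma bilinDiff_eq_sum (r : ℕ) (x : ℕ × ℕ → ℝ) (t : ℕ × ℕ) :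
    bilinDiff r x t = ∑ p, cornerSign p * x (t + r • natCorner p) := by
  simp [bilinDiff, Fin.sum_univ_four, cornerSign, natCorner, Prod.add_def]
  ring

lemma scaledPoint_sub (δ : ℝ) (s t : ℕ × ℕ) :
    scaledPoint δ s - scaledPoint δ t = δ • latticePoint (gridPoint s - gridPoint t) := by
  ext i; fin_cases i <;> simp [scaledPoint, gridPoint, latticePoint] <;> ring

lemma add_smul_natCorner_mem_grid {n r : ℕ} {t : ℕ × ℕ} (ht : t ∈ grid (n - 2 * r)) (p : Fin 4) :
    t + r • natCorner p ∈ grid n := by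
  rw [mem_grid] at ht ⊢
  fin_cases p <;> simp [natCorner] <;> omega

/-- The coefficients of the bilinear difference with step `r` at the grid point `t`. -/
def diffCoeff (δ : ℝ) (r : ℕ) (t : ℕ × ℕ) : Plane →₀ ℝ :=
  ∑ p, Finsupp.single (scaledPoint δ (t + r • natCorner p)) (cornerSign p)

variable {Ω : Type*} [MeasurableSpace Ω] {P : Measure Ω} {D : Set Plane} {X : Plane → Ω → ℝ}

/-- The vector of the normalized bilinear differences of the data `X(δ t)`, `t ∈ Λ_n`. -/
def diffVector (φ₂ δ : ℝ) (n : ℕ) (X : Plane → Ω → ℝ) (ω : Ω) : EuclideanSpace ℝ (DiffIndex n) :=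
  WithLp.toLp 2 fun i => δ ^ (-φ₂) * bilinDiff (i.1 + 1) (sample δ X ω) i.2

/-- Every combination of bilinear differences is a combination of field values with coefficients
summing to zero, to which the defining property of the field applies; the factors `δ ^ (-φ₂)` cancel
the homogeneity of the covariance. -/
lemma hasLaw_sum_mul_bilinDiff
    (hX : IsPowerLawField φ₁ φ₂ D X P) {δ : ℝ} (hδ : 0 < δ) {n : ℕ}
    (hD : ∀ t ∈ grid n, scaledPoint δ t ∈ D) (u : DiffIndex n → ℝ) :
    HasLaw (fun ω => ∑ i, u i * (δ ^ (-φ₂) * bilinDiff (i.1 + 1) (sample δ X ω) i.2))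
      (gaussianReal 0 (u ⬝ᵥ (diffCovMatrix φ₁ φ₂ n *ᵥ u)).toNNReal) P := by
  set c : Plane →₀ ℝ := ∑ i : DiffIndex n, (u i * δ ^ (-φ₂)) • diffCoeff δ (i.1 + 1) i.2 with hc
  have hsupp : (c.support : Set Plane) ⊆ D := by
    -- Coefficients add up, and may cancel, at grid points shared by several differences; the
    -- submodule of functions supported in `D` absorbs this.
    have : c ∈ Finsupp.supported ℝ ℝ D := by
      refine Submodule.sum_mem _ fun i _ => Submodule.smul_mem _ _ (Submodule.sum_mem _ fun p _ => ?_)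
      exact Finsupp.single_mem_supported ℝ _ (hD _ (add_smul_natCorner_mem_grid i.2.2 p))
    exact (Finsupp.mem_supported ℝ c).1 this
  have hlin : ∀ g : Plane → ℝ, ∑ s ∈ c.support, c s * g s = ∑ i, (u i * δ ^ (-φ₂)) *
      ∑ p, cornerSign p * g (scaledPoint δ (i.2 + ((i.1 : ℕ) + 1) • natCorner p)) := fun g => by
    have h1 : ∑ s ∈ c.support, c s * g s = Finsupp.linearCombination ℝ g c := by
      simp [Finsupp.linearCombination_apply, Finsupp.sum]
    rw [h1, hc, map_sum]
    simp [diffCoeff, map_sum, Finsupp.linearCombination_single]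
  have hsum : ∑ s ∈ c.support, c s = 0 := by
    have := hlin fun _ => 1
    simp only [mul_one] at this
    rw [this]
    have h0 : ∑ p, cornerSign p = 0 := by simp [Fin.sum_univ_four, cornerSign]
    simp [h0]
  have hvar : ∑ s ∈ c.support, ∑ t ∈ c.support, c s * c t * genCov φ₁ φ₂ (s - t) =
      u ⬝ᵥ (diffCovMatrix φ₁ φ₂ n *ᵥ u) := by
    simp_rw [mul_assoc, ← Finset.mul_sum]
    rw [hlin fun s => ∑ t ∈ c.support, c t * genCov φ₁ φ₂ (s - t)]
    simp_rw [fun s => hlin fun t => genCov φ₁ φ₂ (s - t), scaledPoint_sub, genCov_smul hδ,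
      gridPoint_add_natCorner]
    rw [dotProduct_diffCovMatrix]
    have hδ2 : δ ^ (-φ₂) * δ ^ (-φ₂) * δ ^ (2 * φ₂) = 1 := by
      rw [← Real.rpow_add hδ, ← Real.rpow_add hδ]
      ring_nf; exact Real.rpow_zero δ
    refine Finset.sum_congr rfl fun i _ => ?_
    simp_rw [Finset.mul_sum, diffCov, Finset.mul_sum]
    rw [Finset.sum_comm]
    refine Finset.sum_congr rfl fun j _ => Finset.sum_congr rfl fun p _ =>
      Finset.sum_congr rfl fun q _ => ?_
    have hk : gridPoint i.2 + ((i.1 + 1 : ℕ) : ℤ) • corner p -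
        (gridPoint j.2 + ((j.1 + 1 : ℕ) : ℤ) • corner q) =
        gridPoint i.2 - gridPoint j.2 + ((i.1 + 1 : ℕ) : ℤ) • corner p -
          ((j.1 + 1 : ℕ) : ℤ) • corner q := by abel
    rw [hk]
    linear_combination (u i * u j * (cornerSign p * cornerSign q *
      genCov φ₁ φ₂ (latticePoint (gridPoint i.2 - gridPoint j.2 + ((i.1 + 1 : ℕ) : ℤ) • corner p -
        ((j.1 + 1 : ℕ) : ℤ) • corner q)))) * hδ2
  have h := hX c hsupp hsum
  rw [hvar] at h
  convert h using 2 with ω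
  rw [hlin fun s => X s ω]
  refine Finset.sum_congr rfl fun i _ => ?_
  rw [bilinDiff_eq_sum, mul_assoc]
  rfl

/-- The joint law of the normalized bilinear differences does not depend on the grid spacing. -/
theorem hasLaw_diffVector [IsProbabilityMeasure P] (hφ₁ : 0 < φ₁) (hφ₂ : 0 < φ₂) (hφ₂' : φ₂ < 1)
    (hX : IsPowerLawField φ₁ φ₂ D X P) {δ : ℝ} (hδ : 0 < δ) {n : ℕ}
    (hD : ∀ t ∈ grid n, scaledPoint δ t ∈ D) :
    HasLaw (diffVector φ₂ δ n X) (multivariateGaussian 0 (diffCovMatrix φ₁ φ₂ n)) P := by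
  have hlaw := hasLaw_sum_mul_bilinDiff hX hδ hD
  have hpsd := posSemidef_diffCovMatrix hφ₁ hφ₂ hφ₂' n
  have hm : AEMeasurable (diffVector φ₂ δ n X) P := by
    refine (WithLp.measurable_toLp 2 _).comp_aemeasurable (aemeasurable_pi_lambda _ fun i => ?_)
    have := (hlaw (Pi.single i 1)).aemeasurable
    simpa [Pi.single_apply] using this
  refine ⟨hm, ?_⟩
  have : IsProbabilityMeasure (P.map (diffVector φ₂ δ n X)) := Measure.isProbabilityMeasure_map hm
  -- Cramér–Wold: the characteristic function at `u` is that of the real combination with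
  -- coefficients `u`, taken at `1`.
  refine Measure.ext_of_charFun (funext fun u => ?_)
  have h1 := hlaw u.ofLp
  have h2 : charFun (P.map (diffVector φ₂ δ n X)) u = charFun (P.map fun ω =>
      ∑ i, u i * (δ ^ (-φ₂) * bilinDiff (i.1 + 1) (sample δ X ω) i.2)) 1 := by
    rw [charFun_apply, charFun_apply_real, integral_map hm (by fun_prop),
      integral_map h1.aemeasurable (by fun_prop)]
    refine integral_congr_ae (ae_of_all _ fun ω => ?_)
    simp [diffVector, PiLp.inner_apply]
  rw [h2, h1.map_eq, charFun_gaussianReal, charFun_multivariateGaussian hpsd]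
  have h0 : 0 ≤ u.ofLp ⬝ᵥ (diffCovMatrix φ₁ φ₂ n *ᵥ u.ofLp) := by
    simpa using hpsd.dotProduct_mulVec_nonneg u.ofLp
  simp [Real.coe_toNNReal _ h0]

end PowerLaw
end

open scoped ENNReal NNReal
noncomputable section
namespace PowerLaw

variable {φ₁ φ₂ : ℝ}

/-! ### Quadratic variations as quadratic forms -/

/-- The weights of the linear combination of the quadratic variations with coefficients `θ`. -/
def qvWeight (n : ℕ) (θ : Fin 2 → ℝ) (i : DiffIndex n) : ℝ :=
  θ i.1 / ((n - 2 * ((i.1 : ℕ) + 1) : ℕ) : ℝ) ^ 2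

/-- The quadratic variation with step `a + 1`, as a function of the bilinear differences. -/
def qvForm (n : ℕ) (a : Fin 2) (v : EuclideanSpace ℝ (DiffIndex n)) : ℝ :=
  (∑ t : {t // t ∈ grid (n - 2 * ((a : ℕ) + 1))}, v ⟨a, t⟩ ^ 2) /
    ((n - 2 * ((a : ℕ) + 1) : ℕ) : ℝ) ^ 2

lemma measurable_qvForm (n : ℕ) (a : Fin 2) : Measurable (qvForm n a) := by
  unfold qvForm; fun_prop

lemma sum_mul_qvForm (n : ℕ) (θ : Fin 2 → ℝ) (v : EuclideanSpace ℝ (DiffIndex n)) :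
    ∑ a, θ a * qvForm n a v = ∑ i, qvWeight n θ i * v i ^ 2 := by
  rw [Fintype.sum_sigma]
  refine Finset.sum_congr rfl fun a _ => ?_
  rw [qvForm, Finset.sum_div, Finset.mul_sum]
  refine Finset.sum_congr rfl fun t _ => ?_
  rw [qvWeight]; ring

/-- The vector of mean quadratic variations. -/
def meanVec (φ₁ φ₂ : ℝ) (a : Fin 2) : ℝ := meanQV φ₁ φ₂ (a + 1)

lemma natCast_sub_pos {n : ℕ} (hn : 5 ≤ n) (a : Fin 2) :
    (0 : ℝ) < ((n - 2 * ((a : ℕ) + 1) : ℕ) : ℝ) := by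
  have := a.2
  have h : 0 < n - 2 * ((a : ℕ) + 1) := by omega
  exact_mod_cast h

lemma sum_qvWeight_mul (hφ₁ : 0 < φ₁) (hφ₂ : 0 < φ₂) (hφ₂' : φ₂ < 1) {n : ℕ} (hn : 5 ≤ n)
    (θ : Fin 2 → ℝ) :
    ∑ i, qvWeight n θ i * diffCovMatrix φ₁ φ₂ n i i = ∑ a, θ a * meanVec φ₁ φ₂ a := by
  rw [Fintype.sum_sigma]
  refine Finset.sum_congr rfl fun a _ => ?_
  have := natCast_sub_pos hn a
  simp only [qvWeight, diffCovMatrix, Matrix.of_apply, sub_self, meanVec,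
    ← meanQV_eq_diffCov hφ₁ hφ₂ hφ₂', Finset.sum_const, Finset.card_univ, Fintype.card_coe,
    card_grid, nsmul_eq_mul, Nat.cast_pow]
  field_simp

/-- Half the variance of the linear combination of quadratic variations. -/
def qvHalfVar (φ₁ φ₂ : ℝ) (n : ℕ) (θ : Fin 2 → ℝ) : ℝ :=
  ∑ i, ∑ j, qvWeight n θ i * qvWeight n θ j * diffCovMatrix φ₁ φ₂ n i j ^ 2

lemma qvHalfVar_eq (n : ℕ) (θ : Fin 2 → ℝ) :
    qvHalfVar φ₁ φ₂ n θ = ∑ a : Fin 2, ∑ b : Fin 2, θ a * θ b *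
      ((((n - 2 * ((a : ℕ) + 1) : ℕ) : ℝ) ^ 2)⁻¹ * (((n - 2 * ((b : ℕ) + 1) : ℕ) : ℝ) ^ 2)⁻¹ *
        ∑ s ∈ grid (n - 2 * ((a : ℕ) + 1)), ∑ t ∈ grid (n - 2 * ((b : ℕ) + 1)),
          diffCov φ₁ φ₂ (a + 1) (b + 1) (gridPoint s - gridPoint t) ^ 2) := by
  rw [qvHalfVar, Fintype.sum_sigma]
  refine Finset.sum_congr rfl fun a _ => ?_
  simp_rw [Fintype.sum_sigma]
  rw [Finset.sum_comm]
  refine Finset.sum_congr rfl fun b _ => ?_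
  simp only [diffCovMatrix, Matrix.of_apply, qvWeight]
  rw [← Finset.sum_coe_sort (grid (n - 2 * ((a : ℕ) + 1))), Finset.mul_sum, Finset.mul_sum]
  refine Finset.sum_congr rfl fun s _ => ?_
  rw [← Finset.sum_coe_sort (grid (n - 2 * ((b : ℕ) + 1))), Finset.mul_sum, Finset.mul_sum]
  refine Finset.sum_congr rfl fun t _ => ?_
  ring

lemma tendsto_mul_inv_sub_sq (c : ℕ) :
    Tendsto (fun n : ℕ => (n : ℝ) ^ 2 * (((n - c : ℕ) : ℝ) ^ 2)⁻¹) atTop (𝓝 1) := by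
  have h2 : Tendsto (fun n : ℕ => ((1 - (c : ℝ) / n) ^ 2)⁻¹) atTop (𝓝 1) := by
    have := (((tendsto_const_div_atTop_nhds_zero_nat (c : ℝ)).const_sub 1).pow 2).inv₀ (by norm_num)
    simpa using this
  refine h2.congr' (eventually_atTop.2 ⟨c + 1, fun n hn => ?_⟩)
  have hn0 : (n : ℝ) ≠ 0 := by
    have : n ≠ 0 := by omega
    exact_mod_cast this
  have hc : (n : ℝ) - c ≠ 0 := by
    have : (c : ℝ) + 1 ≤ n := by exact_mod_cast hn
    linarith
  simp only
  rw [Nat.cast_sub (by omega)]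
  field_simp

/-- The covariances depend only on differences of grid points, so `tendsto_sum_grid_div` turns the
double sums into the series of squared covariances, whose sum is given by `hasSum_covQV`. -/
lemma tendsto_sq_mul_qvHalfVar (hφ₁ : 0 < φ₁) (hφ₂ : 0 < φ₂) (hφ₂' : φ₂ < 1) (θ : Fin 2 → ℝ) :
    Tendsto (fun n : ℕ => 2 * ((n : ℝ) ^ 2 * qvHalfVar φ₁ φ₂ n θ)) atTop
      (𝓝 (θ ⬝ᵥ (covQV φ₁ φ₂ *ᵥ θ))) := by
  have key : ∀ a b : Fin 2, Tendsto (fun n : ℕ => 2 * ((n : ℝ) ^ 2 * (θ a * θ b *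
      ((((n - 2 * ((a : ℕ) + 1) : ℕ) : ℝ) ^ 2)⁻¹ * (((n - 2 * ((b : ℕ) + 1) : ℕ) : ℝ) ^ 2)⁻¹ *
        ∑ s ∈ grid (n - 2 * ((a : ℕ) + 1)), ∑ t ∈ grid (n - 2 * ((b : ℕ) + 1)),
          diffCov φ₁ φ₂ (a + 1) (b + 1) (gridPoint s - gridPoint t) ^ 2)))) atTop
      (𝓝 (θ a * (covQV φ₁ φ₂ a b * θ b))) := fun a b => by
    have h := hasSum_covQV hφ₁ hφ₂ hφ₂' a b
    have h1 := tendsto_sum_grid_div h.summable (2 * ((a : ℕ) + 1)) (2 * ((b : ℕ) + 1))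
    rw [h.tsum_eq] at h1
    have h2 := (((tendsto_mul_inv_sub_sq (2 * ((a : ℕ) + 1))).mul
      (tendsto_mul_inv_sub_sq (2 * ((b : ℕ) + 1)))).mul h1).const_mul (θ a * θ b)
    rw [one_mul, one_mul] at h2
    refine (h2.congr' (eventually_atTop.2 ⟨1, fun n hn => ?_⟩)).trans_eq (by congr 1; ring)
    have hn0 : (n : ℝ) ≠ 0 := by
      have : n ≠ 0 := by omega
      exact_mod_cast this
    simp_rw [← Finset.mul_sum]
    field_simp
  have h := tendsto_finsetSum Finset.univ fun a _ => tendsto_finsetSum Finset.univ fun b _ => key a b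
  simp_rw [← Finset.mul_sum, ← qvHalfVar_eq] at h
  exact h

lemma abs_qvWeight_le {n : ℕ} (hn : 5 ≤ n) (θ : Fin 2 → ℝ) (i : DiffIndex n) :
    |qvWeight n θ i| ≤ (|θ 0| + |θ 1|) * (25 / (n : ℝ) ^ 2) := by
  have h1 : |θ i.1| ≤ |θ 0| + |θ 1| := by
    rcases Fin.exists_fin_two.1 ⟨i.1, rfl⟩ with h | h <;> rw [h] <;>
      linarith [abs_nonneg (θ 0), abs_nonneg (θ 1)]
  have h5 : (5 : ℝ) ≤ n := by exact_mod_cast hn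
  -- The inequality `n - 4 ≥ n / 5` is exactly `n ≥ 5`; squaring it produces the constant `25`.
  have h2 : (n : ℝ) / 5 ≤ ((n - 2 * ((i.1 : ℕ) + 1) : ℕ) : ℝ) := by
    have := i.1.2
    have h3 : n - 4 ≤ n - 2 * ((i.1 : ℕ) + 1) := by omega
    have h4 : ((n - 4 : ℕ) : ℝ) = n - 4 := by rw [Nat.cast_sub (by omega)]; norm_num
    calc (n : ℝ) / 5 ≤ n - 4 := by linarith
      _ ≤ _ := by rw [← h4]; exact_mod_cast h3
  rw [qvWeight, abs_div, abs_of_nonneg (sq_nonneg (((n - 2 * ((i.1 : ℕ) + 1) : ℕ) : ℝ))),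
    div_eq_mul_inv]
  refine mul_le_mul h1 ?_ (by positivity) (by positivity)
  calc ((((n - 2 * ((i.1 : ℕ) + 1) : ℕ) : ℝ)) ^ 2)⁻¹ ≤ (((n : ℝ) / 5) ^ 2)⁻¹ := by gcongr
    _ = _ := by field_simp; norm_num

/-- A linear combination of the quadratic variations has the law of a diagonal quadratic form in
independent standard Gaussian variables, with small coefficients. -/
theorem exists_map_sum_mul_qvForm (hφ₁ : 0 < φ₁) (hφ₂ : 0 < φ₂) (hφ₂' : φ₂ < 1) :
    ∃ κ : ℝ, 0 < κ ∧ ∀ (n : ℕ), 5 ≤ n → ∀ θ : Fin 2 → ℝ, ∃ l : DiffIndex n → ℝ,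
      ∑ i, l i = ∑ a, θ a * meanVec φ₁ φ₂ a ∧ ∑ i, l i ^ 2 = qvHalfVar φ₁ φ₂ n θ ∧
      (∀ i, |l i| ≤ κ * (|θ 0| + |θ 1|) / (n : ℝ) ^ 2) ∧
      (multivariateGaussian 0 (diffCovMatrix φ₁ φ₂ n)).map (fun v => ∑ a, θ a * qvForm n a v) =
        (gaussianPi (DiffIndex n)).map (fun z => ∑ i, l i * z i ^ 2) := by
  obtain ⟨κ, hκ, h⟩ := exists_dotProduct_diffCovMatrix_le hφ₁ hφ₂ hφ₂'
  refine ⟨25 * κ, by positivity, fun n hn θ => ?_⟩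
  obtain ⟨l, h1, h2, h3, h4⟩ := exists_map_sum_mul_sq_eq
    (posSemidef_diffCovMatrix hφ₁ hφ₂ hφ₂' n) (qvWeight n θ)
  refine ⟨l, ?_, h2, fun i => ?_, ?_⟩
  · rw [h1, sum_qvWeight_mul hφ₁ hφ₂ hφ₂' hn]
  · refine (h3 κ _ ?_ (h n) (abs_qvWeight_le hn θ) i).trans (le_of_eq ?_)
    · positivity
    · ring
  · simp_rw [sum_mul_qvForm]
    exact h4

end PowerLaw
end

/-! ### Normalized quadratic variations of the fixed-domain sample: limit law, exponential and
negative moments -/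

open scoped ENNReal NNReal
noncomputable section
namespace PowerLaw

variable {φ₁ φ₂ : ℝ} {Ω : Type*} [MeasurableSpace Ω] {P : Measure Ω}
  {X : Plane → Ω → ℝ}

omit [MeasurableSpace Ω] in
lemma rpow_mul_quadVar_eq {δ : ℝ} (hδ : 0 < δ) (n : ℕ) (a : Fin 2) (X : Plane → Ω → ℝ) (ω : Ω) :
    δ ^ (-(2 * φ₂)) * quadVar n (a + 1) (sample δ X ω) = qvForm n a (diffVector φ₂ δ n X ω) := by
  have h : δ ^ (-(2 * φ₂)) = (δ ^ (-φ₂)) ^ 2 := by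
    rw [← Real.rpow_two, ← Real.rpow_mul hδ.le]; ring_nf
  rw [quadVar, qvForm, card_grid, ← Finset.sum_coe_sort]
  simp only [diffVector, mul_pow, ← Finset.mul_sum, h, Nat.cast_pow]
  ring

lemma scaledPoint_mem_unitSquare {n : ℕ} {t : ℕ × ℕ} (ht : t ∈ grid n) :
    scaledPoint ((n : ℝ)⁻¹) t ∈ unitSquare := by
  have ht' := mem_grid.1 ht
  have hn : (0 : ℝ) < n := by
    have : 0 < n := by omega
    exact_mod_cast this
  have h : ∀ k < n, (n : ℝ)⁻¹ * k ∈ Set.Icc (0 : ℝ) 1 := fun k hk => by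
    refine ⟨by positivity, ?_⟩
    rw [inv_mul_le_one₀ hn]
    exact_mod_cast hk.le
  intro i
  fin_cases i
  · exact h _ ht'.1
  · exact h _ ht'.2

lemma scaledPoint_mem_integerLattice (t : ℕ × ℕ) : scaledPoint 1 t ∈ integerLattice := by
  intro i
  fin_cases i
  · exact ⟨t.1, by simp [scaledPoint]⟩
  · exact ⟨t.2, by simp [scaledPoint]⟩

/-- The quadratic variations of the fixed-domain sample, normalized to the unit lattice. -/
def normQV (φ₂ : ℝ) (X : Plane → Ω → ℝ) (n : ℕ) (a : Fin 2) (ω : Ω) : ℝ :=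
  (n : ℝ) ^ (2 * φ₂) * quadVar n (a + 1) (sample ((n : ℝ)⁻¹) X ω)

omit [MeasurableSpace Ω] in
lemma normQV_eq {n : ℕ} (hn : n ≠ 0) (a : Fin 2) (ω : Ω) :
    normQV φ₂ X n a ω = qvForm n a (diffVector φ₂ ((n : ℝ)⁻¹) n X ω) := by
  have hn0 : (0 : ℝ) < n := by exact_mod_cast Nat.pos_of_ne_zero hn
  rw [normQV, ← rpow_mul_quadVar_eq (inv_pos.2 hn0), Real.inv_rpow hn0.le, ← Real.rpow_neg hn0.le,
    neg_neg]

section Law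

variable [IsProbabilityMeasure P] (hφ₁ : 0 < φ₁) (hφ₂ : 0 < φ₂) (hφ₂' : φ₂ < 1)
  (hX : IsPowerLawField φ₁ φ₂ unitSquare X P)

include hφ₁ hφ₂ hφ₂' hX

lemma hasLaw_diffVector_unitSquare {n : ℕ} (hn : n ≠ 0) :
    HasLaw (diffVector φ₂ ((n : ℝ)⁻¹) n X) (multivariateGaussian 0 (diffCovMatrix φ₁ φ₂ n)) P :=
  hasLaw_diffVector hφ₁ hφ₂ hφ₂' hX
    (inv_pos.2 (by exact_mod_cast Nat.pos_of_ne_zero hn)) fun _ ht => scaledPoint_mem_unitSquare ht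

lemma aemeasurable_normQV (n : ℕ) (a : Fin 2) : AEMeasurable (normQV φ₂ X n a) P := by
  rcases eq_or_ne n 0 with rfl | hn
  · unfold normQV quadVar
    simp [grid]
  · have h := (hasLaw_diffVector_unitSquare hφ₁ hφ₂ hφ₂' hX hn).aemeasurable
    have h2 : normQV φ₂ X n a = fun ω => qvForm n a (diffVector φ₂ ((n : ℝ)⁻¹) n X ω) :=
      funext fun ω => normQV_eq hn a ω
    rw [h2]
    exact (measurable_qvForm n a).comp_aemeasurable h

lemma exists_identDistrib_sum_normQV :
    ∃ κ : ℝ, 0 < κ ∧ ∀ (n : ℕ), 5 ≤ n → ∀ θ : Fin 2 → ℝ, ∃ l : DiffIndex n → ℝ,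
      ∑ i, l i = ∑ a, θ a * meanVec φ₁ φ₂ a ∧ ∑ i, l i ^ 2 = qvHalfVar φ₁ φ₂ n θ ∧
      (∀ i, |l i| ≤ κ * (|θ 0| + |θ 1|) / (n : ℝ) ^ 2) ∧
      IdentDistrib (fun ω => ∑ a, θ a * normQV φ₂ X n a ω) (fun z => ∑ i, l i * z i ^ 2) P
        (gaussianPi (DiffIndex n)) := by
  obtain ⟨κ, hκ, h⟩ := exists_map_sum_mul_qvForm hφ₁ hφ₂ hφ₂'
  refine ⟨κ, hκ, fun n hn θ => ?_⟩
  obtain ⟨l, h1, h2, h3, h4⟩ := h n hn θ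
  have hm : AEMeasurable (fun ω => ∑ a, θ a * normQV φ₂ X n a ω) P :=
    Finset.aemeasurable_fun_sum _ fun a _ =>
      (aemeasurable_normQV hφ₁ hφ₂ hφ₂' hX n a).const_mul (θ a)
  refine ⟨l, h1, h2, h3, ⟨hm, (by fun_prop : Measurable fun z : DiffIndex n → ℝ =>
    ∑ i, l i * z i ^ 2).aemeasurable, ?_⟩⟩
  have hlaw := hasLaw_diffVector_unitSquare hφ₁ hφ₂ hφ₂' hX (n := n) (by omega)
  have hmq : Measurable fun v : EuclideanSpace ℝ (DiffIndex n) => ∑ a, θ a * qvForm n a v :=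
    Finset.measurable_fun_sum _ fun a _ => (measurable_qvForm n a).const_mul (θ a)
  rw [← h4, ← hlaw.map_eq, AEMeasurable.map_map_of_aemeasurable hmq.aemeasurable hlaw.aemeasurable]
  congr 1
  ext ω
  simp only [Function.comp_apply]
  exact Finset.sum_congr rfl fun a _ => by rw [normQV_eq (by omega)]

/-- Multiplied by `n`, the coefficients of the diagonal form are `O(1/n)`, while twice the sum of
their squares converges; these are the hypotheses of `tendsto_integral_exp_sum`. -/
lemma tendsto_integral_exp_normQV (θ : Fin 2 → ℝ) :
    Tendsto (fun n : ℕ => ∫ ω, Complex.exp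
      ((∑ a, θ a * (n * (normQV φ₂ X n a ω - meanVec φ₁ φ₂ a)) : ℝ) * Complex.I) ∂P) atTop
      (𝓝 (Complex.exp (-(θ ⬝ᵥ (covQV φ₁ φ₂ *ᵥ θ) / 2 : ℝ)))) := by
  obtain ⟨κ, hκ, h⟩ := exists_identDistrib_sum_normQV hφ₁ hφ₂ hφ₂' hX
  choose! l h1 h2 h3 h4 using h
  have hclt := tendsto_integral_exp_sum (ι := DiffIndex) (fun n i => (n : ℝ) * l n θ i)
    (m := fun n => κ * (|θ 0| + |θ 1|) / n) (tendsto_const_div_atTop_nhds_zero_nat _)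
    (eventually_atTop.2 ⟨5, fun n hn i => ?_⟩) (v := θ ⬝ᵥ (covQV φ₁ φ₂ *ᵥ θ)) ?_
  · refine hclt.congr' (eventually_atTop.2 ⟨5, fun n hn => ?_⟩)
    set m := ∑ a, θ a * meanVec φ₁ φ₂ a
    have hid := (h4 n hn θ).comp (u := fun x : ℝ => Complex.exp ((n * (x - m) : ℝ) * Complex.I))
      (by fun_prop)
    have hint := hid.integral_eq
    simp only [Function.comp_def] at hint
    refine Eq.trans ?_ (hint.symm.trans ?_)
    · refine integral_congr_ae (ae_of_all _ fun z => ?_)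
      simp only
      rw [show m = ∑ i, l n θ i from (h1 n hn θ).symm, ← Finset.sum_sub_distrib, Finset.mul_sum]
      congr 3
      exact Finset.sum_congr rfl fun i _ => by ring
    · refine integral_congr_ae (ae_of_all _ fun ω => ?_)
      simp only [m]
      rw [← Finset.sum_sub_distrib, Finset.mul_sum]
      congr 3
      exact Finset.sum_congr rfl fun i _ => by ring
  · have hn0 : (0 : ℝ) < n := by
      have : 0 < n := by omega
      exact_mod_cast this
    rw [abs_mul, abs_of_pos hn0]
    calc _ ≤ (n : ℝ) * (κ * (|θ 0| + |θ 1|) / (n : ℝ) ^ 2) := by gcongr; exact h3 n hn θ i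
      _ = _ := by field_simp
  · refine (tendsto_sq_mul_qvHalfVar hφ₁ hφ₂ hφ₂' θ).congr' (eventually_atTop.2 ⟨5, fun n hn => ?_⟩)
    rw [← h2 n hn θ]
    simp only [mul_pow, Finset.mul_sum]

lemma exists_integral_exp_normQV_le :
    ∃ s : ℝ, 0 < s ∧ ∃ B : ℝ, ∀ n : ℕ, 5 ≤ n → ∀ a,
      Integrable (fun ω => Real.exp (s * |n * (normQV φ₂ X n a ω - meanVec φ₁ φ₂ a)|)) P ∧
      ∫ ω, Real.exp (s * |n * (normQV φ₂ X n a ω - meanVec φ₁ φ₂ a)|) ∂P ≤ B := by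
  obtain ⟨κ, hκ, h⟩ := exists_identDistrib_sum_normQV hφ₁ hφ₂ hφ₂' hX
  -- Chosen so that the coefficients `s n l_i` stay within `1/4`, the range of
  -- `integral_exp_sum_le`.
  set s : ℝ := 1 / (4 * κ) with hs_def
  have hs : 0 < s := by positivity
  have hbd : ∀ a : Fin 2, ∃ B : ℝ, ∀ n : ℕ,
      2 * ((n : ℝ) ^ 2 * qvHalfVar φ₁ φ₂ n (Pi.single a 1)) ≤ B := fun a => by
    obtain ⟨B, hB⟩ := (tendsto_sq_mul_qvHalfVar hφ₁ hφ₂ hφ₂' (Pi.single a 1)).bddAbove_range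
    exact ⟨B, fun n => hB ⟨n, rfl⟩⟩
  choose B hB using hbd
  refine ⟨s, hs, 2 * Real.exp (2 * s ^ 2 * (|B 0| + |B 1|)), fun n hn a => ?_⟩
  have hn1 : (1 : ℝ) ≤ n := by
    have : 1 ≤ n := by omega
    exact_mod_cast this
  obtain ⟨l, h1, h2, h3, h4⟩ := h n hn (Pi.single a 1)
  have e1 : ∑ b, (Pi.single a 1 : Fin 2 → ℝ) b * meanVec φ₁ φ₂ b = meanVec φ₁ φ₂ a := by
    simp [Pi.single_apply]
  have e2 : ∀ ω, ∑ b, (Pi.single a 1 : Fin 2 → ℝ) b * normQV φ₂ X n b ω = normQV φ₂ X n a ω := by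
    simp [Pi.single_apply]
  have e3 : |(Pi.single a 1 : Fin 2 → ℝ) 0| + |(Pi.single a 1 : Fin 2 → ℝ) 1| = 1 := by
    fin_cases a <;> simp
  simp only [e1, e2, e3, mul_one] at h1 h3 h4
  -- The two signs are treated separately and then joined by `e^{|x|} ≤ e^x + e^{-x}`.
  have key : ∀ ε : ℝ, |ε| = 1 →
      Integrable (fun ω => Real.exp (ε * s * (n * (normQV φ₂ X n a ω - meanVec φ₁ φ₂ a)))) P ∧
      ∫ ω, Real.exp (ε * s * (n * (normQV φ₂ X n a ω - meanVec φ₁ φ₂ a))) ∂P ≤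
        Real.exp (2 * s ^ 2 * (|B 0| + |B 1|)) := fun ε hε => by
    have hl : ∀ i, |ε * s * n * l i| ≤ 1 / 4 := fun i => by
      rw [abs_mul, abs_mul, abs_mul, hε, one_mul, abs_of_pos hs, abs_of_pos (by linarith)]
      calc s * n * |l i| ≤ s * n * (κ / (n : ℝ) ^ 2) := by gcongr; exact h3 i
        _ = 1 / 4 / n := by rw [hs_def]; field_simp
        _ ≤ 1 / 4 := div_le_self (by norm_num) hn1
    have hg := integral_exp_sum_le hl
    have hid := h4.comp (u := fun x : ℝ => Real.exp (ε * s * (n * (x - meanVec φ₁ φ₂ a))))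
      (by fun_prop)
    have e4 : (fun x : ℝ => Real.exp (ε * s * (n * (x - meanVec φ₁ φ₂ a)))) ∘
        (fun z : DiffIndex n → ℝ => ∑ i, l i * z i ^ 2) =
        fun z => Real.exp (∑ i, ε * s * n * l i * (z i ^ 2 - 1)) := by
      ext z
      simp only [Function.comp_apply]
      rw [← h1, ← Finset.sum_sub_distrib, Finset.mul_sum, Finset.mul_sum]
      congr 1
      exact Finset.sum_congr rfl fun i _ => by ring
    rw [e4] at hid
    refine ⟨hid.integrable_iff.2 hg.1, ?_⟩
    have h5 := hid.integral_eq
    simp only [Function.comp_def] at h5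
    rw [h5]
    refine hg.2.trans (Real.exp_le_exp.2 ?_)
    have e5 : ∑ i, (ε * s * n * l i) ^ 2 = s ^ 2 * ((n : ℝ) ^ 2 * qvHalfVar φ₁ φ₂ n (Pi.single a 1)) := by
      rw [← h2, Finset.mul_sum, Finset.mul_sum]
      refine Finset.sum_congr rfl fun i _ => ?_
      have : ε ^ 2 = 1 := by rw [← sq_abs, hε]; norm_num
      rw [mul_pow, mul_pow, mul_pow, this]; ring
    have h6 := hB a n
    have h7 : B a ≤ |B 0| + |B 1| := by
      rcases Fin.exists_fin_two.1 ⟨a, rfl⟩ with ha | ha <;> rw [ha]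
      · linarith [le_abs_self (B 0), abs_nonneg (B 1)]
      · linarith [le_abs_self (B 1), abs_nonneg (B 0)]
    rw [e5]
    nlinarith [sq_nonneg s]
  obtain ⟨i1, b1⟩ := key 1 (by simp)
  obtain ⟨i2, b2⟩ := key (-1) (by simp)
  have hle : ∀ ω, Real.exp (s * |n * (normQV φ₂ X n a ω - meanVec φ₁ φ₂ a)|) ≤
      Real.exp (1 * s * (n * (normQV φ₂ X n a ω - meanVec φ₁ φ₂ a))) +
        Real.exp (-1 * s * (n * (normQV φ₂ X n a ω - meanVec φ₁ φ₂ a))) := fun ω => by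
    rcases abs_cases (n * (normQV φ₂ X n a ω - meanVec φ₁ φ₂ a)) with hc | hc
    · rw [hc.1, one_mul]
      exact le_add_of_nonneg_right (Real.exp_pos _).le
    · rw [hc.1, show s * -(n * (normQV φ₂ X n a ω - meanVec φ₁ φ₂ a)) =
        -1 * s * (n * (normQV φ₂ X n a ω - meanVec φ₁ φ₂ a)) by ring]
      exact le_add_of_nonneg_left (Real.exp_pos _).le
  have hm := aemeasurable_normQV hφ₁ hφ₂ hφ₂' hX n a
  have hi : Integrable (fun ω => Real.exp (s * |n * (normQV φ₂ X n a ω - meanVec φ₁ φ₂ a)|)) P := by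
    refine (i1.add i2).mono' ?_ (ae_of_all _ fun ω => ?_)
    · exact AEMeasurable.aestronglyMeasurable (by fun_prop)
    · rw [Real.norm_of_nonneg (Real.exp_pos _).le]; exact hle ω
  refine ⟨hi, (integral_mono hi (i1.add i2) hle).trans ?_⟩
  rw [integral_add' i1 i2]
  linarith

lemma ae_sum_normQV_ne_zero (θ : Fin 2 → ℝ) (hθ : ∑ a, θ a * meanVec φ₁ φ₂ a ≠ 0) {n : ℕ}
    (hn : 5 ≤ n) : ∀ᵐ ω ∂P, ∑ a, θ a * normQV φ₂ X n a ω ≠ 0 := by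
  obtain ⟨κ, hκ, h⟩ := exists_identDistrib_sum_normQV hφ₁ hφ₂ hφ₂' hX
  obtain ⟨l, h1, -, -, h4⟩ := h n hn θ
  exact h4.symm.ae_snd (p := fun x => x ≠ 0) (measurableSet_singleton 0).compl
    (ae_sum_mul_sq_ne_zero l (by rw [h1]; exact hθ))

/-- The number of terms of the diagonal form is at most `2 n²`, so the bound is polynomial. The
power `n²` is generous, but it suffices against the exponential tails. -/
lemma exists_lintegral_rpow_normQV_le (θ : Fin 2 → ℝ) (hθ : ∑ a, θ a * meanVec φ₁ φ₂ a ≠ 0) :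
    ∃ K : ℝ≥0, ∀ n : ℕ, 5 ≤ n →
      ∫⁻ ω, ENNReal.ofReal (|∑ a, θ a * normQV φ₂ X n a ω| ^ (-(1 / 4) : ℝ)) ∂P ≤ K * (n : ℝ≥0∞) ^ 2 := by
  obtain ⟨κ, hκ, h⟩ := exists_identDistrib_sum_normQV hφ₁ hφ₂ hφ₂' hX
  obtain ⟨K, hK⟩ := exists_lintegral_abs_sum_rpow_le_card
  set m := ∑ a, θ a * meanVec φ₁ φ₂ a with hm
  have hm0 : 0 < |m| := abs_pos.2 hθ
  refine ⟨K * (2 * |m| ^ (-(1 / 4) : ℝ)).toNNReal, fun n hn => ?_⟩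
  obtain ⟨l, h1, -, -, h4⟩ := h n hn θ
  have hid := h4.comp (u := fun x : ℝ => ENNReal.ofReal (|x| ^ (-(1 / 4) : ℝ))) (by fun_prop)
  have e := hid.lintegral_eq
  simp only [Function.comp_def] at e
  rw [e]
  refine (hK l (by rw [h1]; exact hθ)).trans ?_
  rw [h1, ENNReal.coe_mul, mul_assoc]
  refine mul_le_mul' le_rfl ?_
  have hcard : (Fintype.card (DiffIndex n) : ℝ) ≤ 2 * (n : ℝ) ^ 2 := by
    have : Fintype.card (DiffIndex n) ≤ 2 * n ^ 2 := by
      rw [Fintype.card_sigma, Fin.sum_univ_two, Fintype.card_coe, Fintype.card_coe, card_grid,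
        card_grid, show 2 * n ^ 2 = n ^ 2 + n ^ 2 by ring]
      exact add_le_add (Nat.pow_le_pow_left (Nat.sub_le _ _) 2)
        (Nat.pow_le_pow_left (Nat.sub_le _ _) 2)
    exact_mod_cast this
  have hn0 : (1 : ℝ) ≤ n := by
    have : 1 ≤ n := by omega
    exact_mod_cast this
  have hcard0 : (0 : ℝ) < Fintype.card (DiffIndex n) := by
    have : Nonempty (DiffIndex n) := ⟨⟨0, ⟨(0, 0), mem_grid.2 (by constructor <;> simp <;> omega)⟩⟩⟩
    exact_mod_cast Fintype.card_pos
  -- The coerced `toNNReal` in the constant is `ENNReal.ofReal` by definition, so the claim becomes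
  -- one between real numbers.
  rw [show ((n : ℝ≥0∞) ^ 2) = ENNReal.ofReal ((n : ℝ) ^ 2) by
    rw [ENNReal.ofReal_pow (by positivity), ENNReal.ofReal_natCast],
    ← ENNReal.ofReal.eq_1, ← ENNReal.ofReal_mul (by positivity)]
  refine ENNReal.ofReal_le_ofReal ?_
  calc (|m| / Fintype.card (DiffIndex n)) ^ (-(1 / 4) : ℝ)
      ≤ (|m| / (2 * (n : ℝ) ^ 2)) ^ (-(1 / 4) : ℝ) :=
        Real.rpow_le_rpow_of_nonpos (by positivity) (by gcongr) (by norm_num)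
    _ = |m| ^ (-(1 / 4) : ℝ) * (2 * (n : ℝ) ^ 2) ^ ((1 : ℝ) / 4) := by
        rw [Real.div_rpow hm0.le (by positivity), Real.rpow_neg (by positivity : 0 ≤ 2 * (n : ℝ) ^ 2),
          div_inv_eq_mul]
    _ ≤ |m| ^ (-(1 / 4) : ℝ) * (2 * (n : ℝ) ^ 2) ^ (1 : ℝ) := by
        gcongr
        · nlinarith
        · norm_num
    _ = _ := by rw [Real.rpow_one]; ring

end Law

/-! ### A pathwise bound on the ratio of the two quadratic variations -/

omit [MeasurableSpace Ω] in
lemma normQV_nonneg (n : ℕ) (a : Fin 2) (ω : Ω) : 0 ≤ normQV φ₂ X n a ω := by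
  unfold normQV quadVar; positivity

lemma bilinDiff_two (x : ℕ × ℕ → ℝ) (t : ℕ × ℕ) :
    bilinDiff 2 x t = ∑ p, bilinDiff 1 x (t + natCorner p) := by
  simp [bilinDiff, Fin.sum_univ_four, natCorner, Prod.add_def]
  ring_nf

/-- A step-two cell consists of four unit cells: Cauchy–Schwarz costs a factor `4`, and each of the
four shifted sums is at most the full one. -/
lemma sum_sq_bilinDiff_two_le (n : ℕ) (x : ℕ × ℕ → ℝ) :
    ∑ t ∈ grid (n - 4), bilinDiff 2 x t ^ 2 ≤ 16 * ∑ t ∈ grid (n - 2), bilinDiff 1 x t ^ 2 := by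
  have h1 : ∀ t, bilinDiff 2 x t ^ 2 ≤ 4 * ∑ p, bilinDiff 1 x (t + natCorner p) ^ 2 := fun t => by
    rw [bilinDiff_two]
    have := sq_sum_le_card_mul_sum_sq (s := Finset.univ)
      (f := fun p => bilinDiff 1 x (t + natCorner p))
    simpa using this
  have h2 : ∀ p, ∑ t ∈ grid (n - 4), bilinDiff 1 x (t + natCorner p) ^ 2 ≤
      ∑ t ∈ grid (n - 2), bilinDiff 1 x t ^ 2 := fun p => by
    rw [← Finset.sum_image (s := grid (n - 4)) (g := fun t => t + natCorner p)
      (f := fun t => bilinDiff 1 x t ^ 2) fun a _ b _ hab => add_right_cancel hab]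
    refine Finset.sum_le_sum_of_subset_of_nonneg (fun t ht => ?_) fun _ _ _ => sq_nonneg _
    obtain ⟨s, hs, rfl⟩ := Finset.mem_image.1 ht
    rw [mem_grid] at hs ⊢
    fin_cases p <;> simp [natCorner] <;> omega
  calc _ ≤ ∑ t ∈ grid (n - 4), 4 * ∑ p, bilinDiff 1 x (t + natCorner p) ^ 2 :=
        Finset.sum_le_sum fun t _ => h1 t
    _ = 4 * ∑ p, ∑ t ∈ grid (n - 4), bilinDiff 1 x (t + natCorner p) ^ 2 := by
        rw [← Finset.mul_sum, Finset.sum_comm]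
    _ ≤ 4 * ∑ _p : Fin 4, ∑ t ∈ grid (n - 2), bilinDiff 1 x t ^ 2 := by
        gcongr with p; exact h2 p
    _ = _ := by simp; ring

/-- For `n ≥ 8`, `((n - 2) / (n - 4))² ≤ 9/4`, and `16 · 9/4 = 36`. -/
lemma quadVar_two_le {n : ℕ} (hn : 8 ≤ n) (x : ℕ × ℕ → ℝ) :
    quadVar n 2 x ≤ 36 * quadVar n 1 x := by
  have h := sum_sq_bilinDiff_two_le n x
  have h8 : (8 : ℝ) ≤ n := by exact_mod_cast hn
  have c1 : (((n - 2 : ℕ)) : ℝ) = n - 2 := by rw [Nat.cast_sub (by omega)]; norm_num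
  have c2 : (((n - 4 : ℕ)) : ℝ) = n - 4 := by rw [Nat.cast_sub (by omega)]; norm_num
  simp only [quadVar, card_grid, Nat.cast_pow, mul_one, Nat.reduceMul, c1, c2]
  set A := ∑ t ∈ grid (n - 2), bilinDiff 1 x t ^ 2
  have hA : 0 ≤ A := Finset.sum_nonneg fun _ _ => sq_nonneg _
  rw [div_le_iff₀ (by nlinarith)]
  refine h.trans ?_
  rw [mul_div_assoc', div_mul_eq_mul_div, le_div_iff₀ (by nlinarith)]
  nlinarith [mul_nonneg hA (by nlinarith : 0 ≤ 36 * ((n : ℝ) - 4) ^ 2 - 16 * ((n : ℝ) - 2) ^ 2)]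

omit [MeasurableSpace Ω] in
lemma normQV_one_le {n : ℕ} (hn : 8 ≤ n) (ω : Ω) :
    normQV φ₂ X n 1 ω ≤ 36 * normQV φ₂ X n 0 ω := by
  have h := quadVar_two_le hn (sample ((n : ℝ)⁻¹) X ω)
  have h0 : (0 : ℝ) ≤ (n : ℝ) ^ (2 * φ₂) := by positivity
  simp only [normQV, Fin.val_one, Fin.val_zero, zero_add, Nat.reduceAdd]
  nlinarith

end PowerLaw
end

open scoped ENNReal NNReal
noncomputable section
namespace PowerLaw

variable {φ₁ φ₂ : ℝ}

/-! ### The moment map -/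

/-- Euler's sequence converges to `Γ` at every real number, poles included, with the default value
there. -/
lemma measurable_Gamma : Measurable Real.Gamma := by
  refine measurable_of_tendsto_metrizable (f := fun n s => Real.GammaSeq s n) (fun n => ?_)
    (tendsto_pi_nhds.2 fun s => Real.GammaSeq_tendsto_Gamma s)
  unfold Real.GammaSeq
  fun_prop

lemma measurable_aOne : Measurable aOne := by
  have := measurable_Gamma
  unfold aOne
  fun_prop

lemma measurable_momentMap : Measurable momentMap := by
  have h := measurable_aOne
  refine measurable_pi_lambda _ fun i => ?_
  fin_cases i <;> simp [momentMap, Real.logb] <;> fun_prop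

/-- With `momentMap_smul_one`, this says that a rescaling of the data only multiplies the scale
estimator by a known factor. -/
lemma momentMap_smul_zero {c : ℝ} (hc : c ≠ 0) (y : Fin 2 → ℝ) :
    momentMap (c • y) 0 = c * momentMap y 0 := by
  simp [momentMap, mul_div_mul_left _ _ hc, mul_div_assoc]

lemma momentMap_smul_one {c : ℝ} (hc : c ≠ 0) (y : Fin 2 → ℝ) :
    momentMap (c • y) 1 = momentMap y 1 := by
  simp [momentMap, mul_div_mul_left _ _ hc]

lemma meanVec_eq : meanVec φ₁ φ₂ = ![meanQV φ₁ φ₂ 1, meanQV φ₁ φ₂ 2] := by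
  ext a; fin_cases a <;> simp [meanVec]

section

variable (hφ₁ : 0 < φ₁) (hφ₂ : 0 < φ₂) (hφ₂' : φ₂ < 1)

include hφ₁ hφ₂ hφ₂'

lemma meanVec_zero_pos : 0 < meanVec φ₁ φ₂ 0 := by
  simpa [meanVec] using meanQV_one_pos hφ₁ hφ₂ hφ₂'

lemma meanVec_one_div : meanVec φ₁ φ₂ 1 / meanVec φ₁ φ₂ 0 = 4 ^ φ₂ := by
  have h := meanVec_zero_pos hφ₁ hφ₂ hφ₂'
  rw [div_eq_iff h.ne']
  simpa [meanVec] using meanQV_two hφ₁ hφ₂ hφ₂'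

lemma meanVec_one_pos : 0 < meanVec φ₁ φ₂ 1 := by
  have h := meanVec_zero_pos hφ₁ hφ₂ hφ₂'
  have h2 := meanVec_one_div hφ₁ hφ₂ hφ₂'
  rw [div_eq_iff h.ne'] at h2
  rw [h2]; positivity

lemma half_logb_meanVec : 1 / 2 * Real.logb 2 (meanVec φ₁ φ₂ 1 / meanVec φ₁ φ₂ 0) = φ₂ := by
  rw [meanVec_one_div hφ₁ hφ₂ hφ₂', show (4 : ℝ) = 2 ^ (2 : ℝ) by norm_num,
    ← Real.rpow_mul (by norm_num), Real.logb_rpow (by norm_num) (by norm_num)]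
  ring

lemma momentMap_meanVec_zero : momentMap (meanVec φ₁ φ₂) 0 = φ₁ := by
  have h := aOne_pos hφ₂ hφ₂'
  simp only [momentMap, Matrix.cons_val_zero, half_logb_meanVec hφ₁ hφ₂ hφ₂']
  rw [meanVec_eq, Matrix.cons_val_zero, meanQV_one hφ₁ hφ₂ hφ₂']
  field_simp

lemma momentMap_meanVec_one : momentMap (meanVec φ₁ φ₂) 1 = φ₂ := by
  simp only [momentMap, Matrix.cons_val_one, Matrix.cons_val_fin_one,
    half_logb_meanVec hφ₁ hφ₂ hφ₂']

omit hφ₁ in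
lemma differentiableAt_aOne : DifferentiableAt ℝ aOne φ₂ := by
  have hG : DifferentiableAt ℝ (fun s => Real.Gamma (-s)) φ₂ := by
    refine DifferentiableAt.comp (g := Real.Gamma) φ₂ (Real.differentiableAt_Gamma fun m h => ?_)
      differentiableAt_id.neg
    have h' : φ₂ = m := by simpa using h
    rcases m with _ | m
    · simp at h'; linarith
    · push_cast at h'; linarith [Nat.cast_nonneg (α := ℝ) m]
  have hne : Real.Gamma (-φ₂) ≠ 0 := by linarith [neg_Gamma_neg_pos hφ₂ hφ₂']
  unfold aOne
  refine (hG.abs hne).mul ?_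
  refine (differentiableAt_const _).sub ((differentiableAt_const _).mul ?_)
  exact (Real.hasStrictDerivAt_const_rpow (by norm_num) φ₂).hasDerivAt.differentiableAt

lemma differentiableAt_momentMap : DifferentiableAt ℝ momentMap (meanVec φ₁ φ₂) := by
  have h0 := meanVec_zero_pos hφ₁ hφ₂ hφ₂'
  have h1 := meanVec_one_pos hφ₁ hφ₂ hφ₂'
  have hlog : DifferentiableAt ℝ (fun y : Fin 2 → ℝ => 1 / 2 * Real.logb 2 (y 1 / y 0))
      (meanVec φ₁ φ₂) := by
    unfold Real.logb
    have : meanVec φ₁ φ₂ 1 / meanVec φ₁ φ₂ 0 ≠ 0 := by positivity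
    have h0' := h0.ne'
    fun_prop (disch := assumption)
  rw [differentiableAt_pi]
  intro i
  fin_cases i
  · simp only [momentMap, Fin.zero_eta, Matrix.cons_val_zero]
    have hd0 : DifferentiableAt ℝ (fun y : Fin 2 → ℝ => y 0) (meanVec φ₁ φ₂) := by fun_prop
    simp only [div_eq_mul_inv (_ : ℝ) (aOne _)]
    refine hd0.mul (DifferentiableAt.fun_inv ?_ ?_)
    · have := differentiableAt_aOne hφ₂ hφ₂'
      rw [← half_logb_meanVec hφ₁ hφ₂ hφ₂'] at this
      exact DifferentiableAt.comp (g := aOne) _ this hlog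
    · rw [half_logb_meanVec hφ₁ hφ₂ hφ₂']
      exact (aOne_pos hφ₂ hφ₂').ne'
  · simpa [momentMap] using hlog

end

/-- Differentiability is what allows the matrix of partial derivatives to represent the Fréchet
derivative. -/
lemma jacobian_mulVec {F : (Fin 2 → ℝ) → Fin 2 → ℝ} {q : Fin 2 → ℝ} (hF : DifferentiableAt ℝ F q)
    (v : Fin 2 → ℝ) : jacobian F q *ᵥ v = fderiv ℝ F q v := by
  have h : ∀ i j, jacobian F q i j = fderiv ℝ F q (Pi.single j 1) i := fun i j => by
    have h1 : HasDerivAt (fun s => F (Function.update q j s)) (fderiv ℝ F q (Pi.single j 1)) (q j) := by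
      have h2 := hasDerivAt_update q j (q j)
      have h3 : HasFDerivAt F (fderiv ℝ F q) (Function.update q j (q j)) := by
        rw [Function.update_eq_self]; exact hF.hasFDerivAt
      exact h3.comp_hasDerivAt _ h2
    exact ((hasDerivAt_pi.1 h1) i).deriv
  ext i
  have hv : v = v 0 • Pi.single 0 1 + v 1 • Pi.single 1 1 := by
    ext k; fin_cases k <;> simp
  simp only [Matrix.mulVec, dotProduct, Fin.sum_univ_two, h]
  conv_rhs => rw [hv]
  simp only [map_add, map_smul, Pi.add_apply, Pi.smul_apply, smul_eq_mul]
  ring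

/-- The ratio of estimator to parameter for the scale, together with the roughness estimator, as a
function of the normalized quadratic variations. -/
def ratioMap (φ₁ : ℝ) (y : Fin 2 → ℝ) : Fin 2 → ℝ := ![momentMap y 0 / φ₁, momentMap y 1]

lemma ratioMap_eq (y : Fin 2 → ℝ) : ratioMap φ₁ y = Matrix.diagonal ![1 / φ₁, 1] *ᵥ momentMap y := by
  ext i; fin_cases i <;> simp [ratioMap, Matrix.mulVec_diagonal]; ring

lemma measurable_ratioMap : Measurable (ratioMap φ₁) := by
  have h := measurable_pi_iff.1 measurable_momentMap
  refine measurable_pi_lambda _ fun i => ?_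
  fin_cases i <;> simp only [ratioMap]
  · exact (h 0).div_const φ₁
  · exact h 1

section

variable (hφ₁ : 0 < φ₁) (hφ₂ : 0 < φ₂) (hφ₂' : φ₂ < 1)

include hφ₁ hφ₂ hφ₂'

lemma ratioMap_meanVec : ratioMap φ₁ (meanVec φ₁ φ₂) = ![1, φ₂] := by
  rw [ratioMap, momentMap_meanVec_zero hφ₁ hφ₂ hφ₂', momentMap_meanVec_one hφ₁ hφ₂ hφ₂',
    div_self hφ₁.ne']

lemma ratioMap_sub_isLittleO :
    (fun y => ratioMap φ₁ y - ![1, φ₂] - ratioJacobian φ₁ φ₂ *ᵥ (y - meanVec φ₁ φ₂)) =o[𝓝 (meanVec φ₁ φ₂)]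
      fun y => y - meanVec φ₁ φ₂ := by
  have hd := differentiableAt_momentMap hφ₁ hφ₂ hφ₂'
  have h1 := hd.hasFDerivAt.isLittleO
  let D : (Fin 2 → ℝ) →L[ℝ] (Fin 2 → ℝ) :=
    LinearMap.toContinuousLinearMap (Matrix.diagonal ![1 / φ₁, 1]).mulVecLin
  refine ((D.isBigO_comp _ _).trans_isLittleO h1).congr_left fun y => ?_
  rw [← ratioMap_meanVec hφ₁ hφ₂ hφ₂', ratioMap_eq, ratioMap_eq, ratioJacobian, ← meanVec_eq,
    ← Matrix.mulVec_mulVec, jacobian_mulVec hd]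
  simp [D, Matrix.mulVec_sub]

lemma ratioJacobian_one_zero : ratioJacobian φ₁ φ₂ 1 0 = -(2 * Real.log 2 * meanVec φ₁ φ₂ 0)⁻¹ := by
  have h0 := meanVec_zero_pos hφ₁ hφ₂ hφ₂'
  have h1 := meanVec_one_pos hφ₁ hφ₂ hφ₂'
  have hl : 0 < Real.log 2 := Real.log_pos (by norm_num)
  rw [ratioJacobian, ← meanVec_eq, Matrix.diagonal_mul]
  simp only [jacobian, momentMap, Matrix.of_apply, Matrix.cons_val_one, Matrix.cons_val_fin_one,
    one_mul, Function.update_self, Real.logb, ne_eq, one_ne_zero, not_false_eq_true, Function.update_of_ne]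
  have h : HasDerivAt (fun s => 1 / 2 * (Real.log (meanVec φ₁ φ₂ 1 / s) / Real.log 2))
      (-(2 * Real.log 2 * meanVec φ₁ φ₂ 0)⁻¹) (meanVec φ₁ φ₂ 0) := by
    have h2 : HasDerivAt (fun s => meanVec φ₁ φ₂ 1 / s) _ (meanVec φ₁ φ₂ 0) :=
      (hasDerivAt_const _ _).fun_div (hasDerivAt_id _) h0.ne'
    convert! ((h2.log (by simp; constructor <;> positivity)).div_const (Real.log 2)).const_mul (1 / 2 : ℝ)
      using 1
    simp
    field_simp
  exact h.deriv

lemma ratioJacobian_one_one : ratioJacobian φ₁ φ₂ 1 1 = (2 * Real.log 2 * meanVec φ₁ φ₂ 1)⁻¹ := by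
  have h0 := meanVec_zero_pos hφ₁ hφ₂ hφ₂'
  have h1 := meanVec_one_pos hφ₁ hφ₂ hφ₂'
  have hl : 0 < Real.log 2 := Real.log_pos (by norm_num)
  rw [ratioJacobian, ← meanVec_eq, Matrix.diagonal_mul]
  simp only [jacobian, momentMap, Matrix.of_apply, Matrix.cons_val_one, Matrix.cons_val_fin_one,
    one_mul, Function.update_self, Real.logb, ne_eq, zero_ne_one, not_false_eq_true, Function.update_of_ne]
  have h : HasDerivAt (fun s => 1 / 2 * (Real.log (s / meanVec φ₁ φ₂ 0) / Real.log 2))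
      (2 * Real.log 2 * meanVec φ₁ φ₂ 1)⁻¹ (meanVec φ₁ φ₂ 1) := by
    have h2 : HasDerivAt (fun s => s / meanVec φ₁ φ₂ 0) _ (meanVec φ₁ φ₂ 1) :=
      (hasDerivAt_id _).div_const _
    convert! ((h2.log (by simp; constructor <;> positivity)).div_const (Real.log 2)).const_mul (1 / 2 : ℝ)
      using 1
    simp
    field_simp
  exact h.deriv

end

end PowerLaw
end

open scoped ENNReal NNReal
noncomputable section
namespace PowerLaw

variable {φ₁ φ₂ : ℝ}

/-! ### The limiting covariance matrix -/

lemma continuous_bSymbol (l : Fin 2) : Continuous (bSymbol l) := by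
  unfold bSymbol
  fin_cases l
  · exact continuous_const
  · change Continuous fun w : Plane => 16 * Real.cos (w 0 / 2) ^ 2 * Real.cos (w 1 / 2) ^ 2
    fun_prop

lemma abs_bSymbol_le (l : Fin 2) (w : Plane) : |bSymbol l w| ≤ 16 := by
  have h : ∀ x : ℝ, |Real.cos x ^ 2| ≤ 1 := fun x => by
    rw [abs_of_nonneg (sq_nonneg _)]; exact Real.cos_sq_le_one x
  fin_cases l
  · simp [bSymbol]
  · simp only [bSymbol, Fin.mk_one, Matrix.cons_val_one, Matrix.cons_val_fin_one, abs_mul]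
    have h0 := h (w 0 / 2)
    have h1 := h (w 1 / 2)
    rw [abs_of_pos (by norm_num : (0 : ℝ) < 16)]
    nlinarith [abs_nonneg (Real.cos (w 0 / 2) ^ 2), abs_nonneg (Real.cos (w 1 / 2) ^ 2)]

section

variable (hφ₁ : 0 < φ₁) (hφ₂ : 0 < φ₂) (hφ₂' : φ₂ < 1)

include hφ₁ hφ₂ hφ₂'

lemma integrableOn_bSymbol_mul (l m : Fin 2) : IntegrableOn (fun w =>
    bSymbol l w * bSymbol m w * (‖symbol 1 w‖ ^ 2 * latticeDensity φ₁ φ₂ w) ^ 2) torus := by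
  obtain ⟨B, hB, h⟩ := exists_norm_symbol_sq_mul_latticeDensity_le hφ₁ hφ₂ hφ₂' 1
  have m1 := measurable_latticeDensity hφ₁ hφ₂
  have m2 := (continuous_symbol 1).measurable
  have m3 := (continuous_bSymbol l).measurable
  have m4 := (continuous_bSymbol m).measurable
  refine integrableOn_torus_of_bound (B := 16 * 16 * B ^ 2) ?_ fun w hw => ?_
  · exact Measurable.aestronglyMeasurable (by fun_prop)
  · have h0 : 0 ≤ ‖symbol 1 w‖ ^ 2 * latticeDensity φ₁ φ₂ w :=
      mul_nonneg (sq_nonneg _) (latticeDensity_nonneg hφ₁ hφ₂ w)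
    rw [norm_mul, norm_mul, norm_pow, Real.norm_of_nonneg h0]
    gcongr
    · exact abs_bSymbol_le l w
    · exact abs_bSymbol_le m w
    · exact h w hw

lemma dotProduct_covQV (θ : Fin 2 → ℝ) : θ ⬝ᵥ (covQV φ₁ φ₂ *ᵥ θ) =
    2 * torusIntegral fun w => (θ 0 * bSymbol 0 w + θ 1 * bSymbol 1 w) ^ 2 *
      (‖symbol 1 w‖ ^ 2 * latticeDensity φ₁ φ₂ w) ^ 2 := by
  have hi := integrableOn_bSymbol_mul hφ₁ hφ₂ hφ₂'
  have e : ∀ w, (θ 0 * bSymbol 0 w + θ 1 * bSymbol 1 w) ^ 2 *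
      (‖symbol 1 w‖ ^ 2 * latticeDensity φ₁ φ₂ w) ^ 2 = ∑ l : Fin 2, ∑ m : Fin 2, θ l * θ m *
        (bSymbol l w * bSymbol m w * (‖symbol 1 w‖ ^ 2 * latticeDensity φ₁ φ₂ w) ^ 2) := fun w => by
    simp only [Fin.sum_univ_two]; ring
  simp only [e, torusIntegral]
  rw [integral_finsetSum _ fun l _ => integrable_finsetSum _ fun m _ => (hi l m).const_mul _]
  simp_rw [integral_finsetSum Finset.univ fun m _ => (hi _ m).const_mul _, integral_const_mul]
  simp only [dotProduct, Matrix.mulVec, covQV, Matrix.of_apply, torusIntegral, Fin.sum_univ_two]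
  ring

lemma posSemidef_covQV : (covQV φ₁ φ₂).PosSemidef := by
  refine Matrix.PosSemidef.of_dotProduct_mulVec_nonneg ?_ fun θ => ?_
  · ext l m
    simp only [Matrix.conjTranspose_apply, star_trivial, covQV, Matrix.of_apply,
      mul_comm (bSymbol m _)]
  · rw [star_trivial, dotProduct_covQV hφ₁ hφ₂ hφ₂']
    refine mul_nonneg zero_le_two (mul_nonneg (by positivity) ?_)
    exact integral_nonneg fun w => by positivity

lemma posSemidef_limitCov : (limitCov φ₁ φ₂).PosSemidef := by
  have h := (posSemidef_covQV hφ₁ hφ₂ hφ₂').mul_mul_conjTranspose_same (ratioJacobian φ₁ φ₂)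
  rwa [Matrix.conjTranspose_eq_transpose_of_trivial] at h

omit hφ₂' in
lemma norm_symbol_sq_mul_latticeDensity_pos {w : Plane} (hw : w ∈ torus)
    (h : ∀ i, Real.pi / 2 < w i) : 0 < ‖symbol 1 w‖ ^ 2 * latticeDensity φ₁ φ₂ w := by
  have hpi := Real.pi_pos
  have hf : ∀ i, 1 - Complex.exp (Complex.I * (1 : ℕ) * (w i : ℂ)) ≠ 0 := fun i h0 => by
    have h1 := congrArg Complex.re h0
    have h2 : (Complex.exp (Complex.I * (1 : ℕ) * (w i : ℂ))).re = Real.cos (w i) := by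
      rw [show Complex.I * (1 : ℕ) * (w i : ℂ) = w i * Complex.I by push_cast; ring,
        Complex.exp_ofReal_mul_I_re]
    rw [Complex.sub_re, h2] at h1
    have := Real.cos_nonpos_of_pi_div_two_le_of_le (h i).le (by linarith [(hw i).2])
    simp at h1
    linarith
  have hs : 0 < ‖symbol 1 w‖ := norm_pos_iff.2 (mul_ne_zero (hf 0) (hf 1))
  have hw0 : 0 < ‖w‖ := norm_pos_iff.2 fun h0 => by
    have := h 0
    rw [h0] at this
    simp at this
    linarith
  have hp : 0 < planeDensity φ₁ φ₂ w := by
    rw [planeDensity_eq]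
    exact mul_pos (densityConst_pos hφ₁ hφ₂) (Real.rpow_pos_of_pos hw0 _)
  exact mul_pos (by positivity) (hp.trans_le (planeDensity_le_latticeDensity hφ₁ hφ₂ hw))

/-- Near the corner `(π, π)` one has `b₂ ≤ 1`, so `θ₀ b₁ + θ₁ b₂ ≤ θ₀ + θ₁ < 0` on an open subset of
the torus where the density of the differences is positive. -/
lemma dotProduct_covQV_pos {θ : Fin 2 → ℝ} (h1 : 0 < θ 1) (h : θ 1 < -θ 0) :
    0 < θ ⬝ᵥ (covQV φ₁ φ₂ *ᵥ θ) := by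
  have hpi := Real.pi_gt_three
  have hi := integrableOn_bSymbol_mul hφ₁ hφ₂ hφ₂'
  rw [dotProduct_covQV hφ₁ hφ₂ hφ₂', torusIntegral]
  refine mul_pos two_pos (mul_pos (by positivity) ?_)
  rw [setIntegral_pos_iff_support_of_nonneg_ae (ae_of_all _ fun w => by positivity)]
  · let U : Set Plane := {w | ∀ i, w i ∈ Set.Ioo (Real.pi - 1 / 4) Real.pi}
    have hU : IsOpen U := by
      simp only [U, Set.ofPred_forall]
      exact isOpen_iInter_of_finite fun i => isOpen_Ioo.preimage (by fun_prop)
    have hne : U.Nonempty := ⟨!₂[Real.pi - 1 / 8, Real.pi - 1 / 8], fun i => by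
      fin_cases i <;> simp <;> norm_num⟩
    refine (hU.measure_pos volume hne).trans_le (measure_mono fun w hw => ?_)
    have hwt : w ∈ torus := fun i => ⟨by linarith [(hw i).1], (hw i).2.le⟩
    refine ⟨?_, hwt⟩
    have hF := norm_symbol_sq_mul_latticeDensity_pos hφ₁ hφ₂ hwt fun i => by linarith [(hw i).1]
    -- As `w 0` is within `1/4` of `π`, this cosine is the sine of an angle below `1/8`, whence `b₂
    -- ≤ 16 / 64`.
    have hcos : Real.cos (w 0 / 2) ^ 2 ≤ (1 / 8) ^ 2 := by
      have e : Real.cos (w 0 / 2) = Real.sin (Real.pi / 2 - w 0 / 2) := by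
        rw [Real.sin_pi_div_two_sub]
      have hw0 := hw 0
      have e1 : 0 ≤ Real.sin (Real.pi / 2 - w 0 / 2) :=
        Real.sin_nonneg_of_nonneg_of_le_pi (by linarith [hw0.2]) (by linarith [hw0.1])
      have e2 := Real.sin_le (x := Real.pi / 2 - w 0 / 2) (by linarith [hw0.2])
      rw [e]
      exact pow_le_pow_left₀ e1 (by linarith [hw0.1]) 2
    have hb : bSymbol 1 w ≤ 1 := by
      simp only [bSymbol, Matrix.cons_val_one, Matrix.cons_val_fin_one]
      nlinarith [Real.cos_sq_le_one (w 1 / 2), sq_nonneg (Real.cos (w 1 / 2)),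
        sq_nonneg (Real.cos (w 0 / 2))]
    have hb0 : bSymbol 0 w = 1 := rfl
    rw [Function.mem_support]
    have hne : θ 0 * bSymbol 0 w + θ 1 * bSymbol 1 w ≠ 0 := by
      rw [hb0]; nlinarith
    positivity
  · have e : (fun w => (θ 0 * bSymbol 0 w + θ 1 * bSymbol 1 w) ^ 2 *
      (‖symbol 1 w‖ ^ 2 * latticeDensity φ₁ φ₂ w) ^ 2) = fun w => ∑ l : Fin 2, ∑ m : Fin 2, θ l * θ m *
        (bSymbol l w * bSymbol m w * (‖symbol 1 w‖ ^ 2 * latticeDensity φ₁ φ₂ w) ^ 2) := by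
      ext w; simp only [Fin.sum_univ_two]; ring
    rw [e]
    exact integrable_finsetSum _ fun l _ => integrable_finsetSum _ fun m _ => (hi l m).const_mul _

omit hφ₁ hφ₂ hφ₂' in
lemma dotProduct_limitCov (θ : Fin 2 → ℝ) : θ ⬝ᵥ (limitCov φ₁ φ₂ *ᵥ θ) =
    ((ratioJacobian φ₁ φ₂)ᵀ *ᵥ θ) ⬝ᵥ (covQV φ₁ φ₂ *ᵥ ((ratioJacobian φ₁ φ₂)ᵀ *ᵥ θ)) := by
  rw [limitCov, ← Matrix.mulVec_mulVec, ← Matrix.mulVec_mulVec, Matrix.dotProduct_mulVec,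
    ← Matrix.mulVec_transpose]

/-- The second row of the Jacobian is `(-1/q₁, 1/q₂) / (2 log 2)`, and `q₂ = 4^φ₂ q₁ > q₁` gives the
sign pattern required by `dotProduct_covQV_pos`. -/
lemma limitCov_one_one_pos : 0 < limitCov φ₁ φ₂ 1 1 := by
  have h0 := meanVec_zero_pos hφ₁ hφ₂ hφ₂'
  have h1 := meanVec_one_pos hφ₁ hφ₂ hφ₂'
  have hl : 0 < Real.log 2 := Real.log_pos (by norm_num)
  have hlt : meanVec φ₁ φ₂ 0 < meanVec φ₁ φ₂ 1 := by
    rw [← one_lt_div h0, meanVec_one_div hφ₁ hφ₂ hφ₂']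
    exact Real.one_lt_rpow (by norm_num) hφ₂
  have e := dotProduct_limitCov (φ₁ := φ₁) (φ₂ := φ₂) (Pi.single 1 1)
  rw [Matrix.mulVec_single_one, single_one_dotProduct] at e
  simp only [Matrix.col_apply] at e
  rw [e]
  have e2 : ∀ i, ((ratioJacobian φ₁ φ₂)ᵀ *ᵥ Pi.single 1 1) i = ratioJacobian φ₁ φ₂ 1 i := fun i => by
    rw [Matrix.mulVec_single_one]; rfl
  refine dotProduct_covQV_pos hφ₁ hφ₂ hφ₂' ?_ ?_
  · rw [e2, ratioJacobian_one_one hφ₁ hφ₂ hφ₂']; positivity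
  · rw [e2, e2, ratioJacobian_one_zero hφ₁ hφ₂ hφ₂', ratioJacobian_one_one hφ₁ hφ₂ hφ₂', neg_neg]
    gcongr

end

end PowerLaw
end

open scoped ENNReal NNReal
noncomputable section
namespace PowerLaw

variable {φ₁ φ₂ : ℝ} {Ω : Type*} {X : Plane → Ω → ℝ}

/-! ### The estimators as functions of the normalized quadratic variations -/

lemma momentMap_sample {δ : ℝ} (hδ : 0 < δ) (n : ℕ) (X : Plane → Ω → ℝ) (ω : Ω) :
    ![δ ^ (-(2 * φ₂)) * scaleEst n (sample δ X ω) / φ₁, roughEst n (sample δ X ω)] =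
      ratioMap φ₁ fun a => qvForm n a (diffVector φ₂ δ n X ω) := by
  have hc : δ ^ (-(2 * φ₂)) ≠ 0 := (Real.rpow_pos_of_pos hδ _).ne'
  have h : (fun a => qvForm n a (diffVector φ₂ δ n X ω)) =
      δ ^ (-(2 * φ₂)) • ![quadVar n 1 (sample δ X ω), quadVar n 2 (sample δ X ω)] := by
    ext a
    rw [← rpow_mul_quadVar_eq hδ]
    fin_cases a <;> simp
  rw [h, ratioMap, momentMap_smul_zero hc, momentMap_smul_one hc, scaleEst, roughEst]

lemma ratioMap_normQV {n : ℕ} (hn : n ≠ 0) (X : Plane → Ω → ℝ) (ω : Ω) :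
    ![scaleEst n (sample ((n : ℝ)⁻¹) X ω) / (φ₁ * ((n : ℝ) ^ 2) ^ (-φ₂)),
      roughEst n (sample ((n : ℝ)⁻¹) X ω)] = ratioMap φ₁ fun a => normQV φ₂ X n a ω := by
  have hn0 : (0 : ℝ) < n := by exact_mod_cast Nat.pos_of_ne_zero hn
  simp only [normQV_eq hn]
  rw [← momentMap_sample (inv_pos.2 hn0)]
  have e : ((n : ℝ)⁻¹) ^ (-(2 * φ₂)) = (((n : ℝ) ^ 2) ^ (-φ₂))⁻¹ := by
    rw [Real.inv_rpow hn0.le, ← Real.rpow_natCast, ← Real.rpow_mul hn0.le]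
    push_cast
    ring_nf
  rw [e, mul_comm φ₁, ← div_div, inv_mul_eq_div]

variable [MeasurableSpace Ω] {P : Measure Ω} [IsProbabilityMeasure P]

/-- The laws of the ratio estimators do not depend on the grid spacing. -/
theorem identDistrib_ratio (hφ₁ : 0 < φ₁) (hφ₂ : 0 < φ₂) (hφ₂' : φ₂ < 1) {Ω' : Type*}
    [MeasurableSpace Ω'] {P' : Measure Ω'} [IsProbabilityMeasure P'] {Y : Plane → Ω' → ℝ}
    (hX : IsPowerLawField φ₁ φ₂ unitSquare X P) (hY : IsPowerLawField φ₁ φ₂ integerLattice Y P')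
    {n : ℕ} (hn : n ≠ 0) :
    IdentDistrib (fun ω => (scaleEst n (sample ((n : ℝ)⁻¹) X ω) / (φ₁ * ((n : ℝ) ^ 2) ^ (-φ₂)),
        roughEst n (sample ((n : ℝ)⁻¹) X ω)))
      (fun ω => (scaleEst n (sample 1 Y ω) / φ₁, roughEst n (sample 1 Y ω))) P P' := by
  have h1 := hasLaw_diffVector_unitSquare hφ₁ hφ₂ hφ₂' hX hn
  have h2 := hasLaw_diffVector (n := n) hφ₁ hφ₂ hφ₂' hY one_pos
    fun t _ => scaledPoint_mem_integerLattice t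
  have hid := h1.identDistrib h2
  have hm : Measurable fun v => ratioMap φ₁ fun a => qvForm n a v :=
    measurable_ratioMap.comp (measurable_pi_lambda _ fun a => measurable_qvForm n a)
  have hm2 : Measurable fun y : Fin 2 → ℝ => (y 0, y 1) := by fun_prop
  have h := hid.comp (hm2.comp hm)
  convert h using 1
  · ext1 ω
    have e := ratioMap_normQV (φ₁ := φ₁) (φ₂ := φ₂) hn X ω
    simp only [normQV_eq hn] at e
    simp only [Function.comp_apply, ← e]
    simp
  · ext1 ω
    have e := momentMap_sample (φ₁ := φ₁) (φ₂ := φ₂) one_pos n Y ω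
    simp only [Function.comp_apply, ← e]
    simp

section

variable (hφ₁ : 0 < φ₁) (hφ₂ : 0 < φ₂) (hφ₂' : φ₂ < 1)
  (hX : IsPowerLawField φ₁ φ₂ unitSquare X P)

include hφ₁ hφ₂ hφ₂' hX

lemma aemeasurable_momentMap_sample (n : ℕ) : AEMeasurable (fun ω => momentMap
    ![quadVar n 1 (sample ((n : ℝ)⁻¹) X ω), quadVar n 2 (sample ((n : ℝ)⁻¹) X ω)]) P := by
  refine measurable_momentMap.comp_aemeasurable (aemeasurable_pi_lambda _ fun a => ?_)
  have h : AEMeasurable (fun ω => quadVar n (a + 1) (sample ((n : ℝ)⁻¹) X ω)) P := by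
    rcases eq_or_ne n 0 with rfl | hn
    · simp [quadVar, grid]
    · have h1 := (aemeasurable_normQV hφ₁ hφ₂ hφ₂' hX n a).const_mul (((n : ℝ) ^ (2 * φ₂))⁻¹)
      have hc : (n : ℝ) ^ (2 * φ₂) ≠ 0 := by positivity
      simpa [normQV, hc] using h1
  fin_cases a <;> simpa using h

/-! ### The central limit theorem for the linearized estimators -/

lemma tendstoInDistribution_linear :
    TendstoInDistribution (fun (n : ℕ) ω => (WithLp.toLp 2 ((n : ℝ) •
        (ratioJacobian φ₁ φ₂ *ᵥ fun a => normQV φ₂ X n a ω - meanVec φ₁ φ₂ a)) : Plane))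
      atTop id (fun _ => P) (multivariateGaussian 0 (limitCov φ₁ φ₂)) := by
  have hm : ∀ n : ℕ, AEMeasurable (fun ω => (WithLp.toLp 2 ((n : ℝ) •
      (ratioJacobian φ₁ φ₂ *ᵥ fun a => normQV φ₂ X n a ω - meanVec φ₁ φ₂ a)) : Plane)) P := by
    intro n
    have h := aemeasurable_normQV hφ₁ hφ₂ hφ₂' hX n
    refine (WithLp.measurable_toLp 2 _).comp_aemeasurable (aemeasurable_pi_lambda _ fun i => ?_)
    simp only [Matrix.mulVec, dotProduct, Pi.smul_apply, smul_eq_mul]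
    fun_prop
  refine ⟨hm, by fun_prop, ?_⟩
  -- Lévy's continuity theorem; the characteristic function of the image under the Jacobian at `t`
  -- is that of `n (Q - q)` at the transposed Jacobian applied to `t`.
  refine ProbabilityMeasure.tendsto_iff_tendsto_charFun.2 fun t => ?_
  simp only [ProbabilityMeasure.coe_mk, Measure.map_id]
  rw [charFun_multivariateGaussian (posSemidef_limitCov hφ₁ hφ₂ hφ₂')]
  convert tendsto_integral_exp_normQV hφ₁ hφ₂ hφ₂' hX ((ratioJacobian φ₁ φ₂)ᵀ *ᵥ t.ofLp) using 2 with n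
  · rw [charFun_apply, integral_map (hm n) (by fun_prop)]
    refine integral_congr_ae (ae_of_all _ fun ω => ?_)
    simp only
    congr 3
    have e : ∀ v : Fin 2 → ℝ, inner ℝ (WithLp.toLp 2 ((n : ℝ) • (ratioJacobian φ₁ φ₂ *ᵥ v)) : Plane) t =
        ∑ a, ((ratioJacobian φ₁ φ₂)ᵀ *ᵥ t.ofLp) a * (n * v a) := fun v => by
      simp [PiLp.inner_apply, Matrix.mulVec, dotProduct, Fin.sum_univ_two]
      ring
    exact e _
  · rw [← dotProduct_limitCov]
    congr 1
    simp

end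

end PowerLaw
end

open Asymptotics
open scoped ENNReal NNReal
noncomputable section
namespace PowerLaw

variable {φ₁ φ₂ : ℝ}

/-! ### The delta method -/

/-- The filter of pairs `(n, y)` with `n → ∞` and `n ‖y - q‖ ≤ M`. -/
def rootFilter (q : Fin 2 → ℝ) (M : ℝ) : Filter (ℕ × (Fin 2 → ℝ)) :=
  comap Prod.fst atTop ⊓ 𝓟 {p | ∀ a, |p.1 * (p.2 a - q a)| ≤ M}

section Law

variable {Ω : Type*} {X : Plane → Ω → ℝ} [MeasurableSpace Ω] {P : Measure Ω} [IsProbabilityMeasure P]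
  (hφ₁ : 0 < φ₁) (hφ₂ : 0 < φ₂) (hφ₂' : φ₂ < 1) (hX : IsPowerLawField φ₁ φ₂ unitSquare X P)

include hφ₁ hφ₂ hφ₂' hX

/-- Markov's inequality for the exponential moments. The bound does not depend on `n`, so `n (Q -
q)` is tight. -/
lemma exists_measure_normQV_gt_le : ∃ s : ℝ, 0 < s ∧ ∃ B : ℝ, 0 ≤ B ∧ ∀ n : ℕ, 5 ≤ n → ∀ M : ℝ,
    P {ω | ¬ ∀ a, |n * (normQV φ₂ X n a ω - meanVec φ₁ φ₂ a)| ≤ M} ≤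
      ENNReal.ofReal (B * Real.exp (-(s * M))) := by
  obtain ⟨s, hs, B, hB⟩ := exists_integral_exp_normQV_le hφ₁ hφ₂ hφ₂' hX
  refine ⟨s, hs, 2 * |B|, by positivity, fun n hn M => ?_⟩
  have h1 : ∀ a, P {ω | M ≤ |n * (normQV φ₂ X n a ω - meanVec φ₁ φ₂ a)|} ≤
      ENNReal.ofReal (|B| * Real.exp (-(s * M))) := fun a => by
    obtain ⟨hi, hb⟩ := hB n hn a
    have hmk := mul_meas_ge_le_integral_of_nonneg (μ := P)
      (ae_of_all _ fun ω => (Real.exp_pos _).le) hi (Real.exp (s * M))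
    rw [← ENNReal.ofReal_toReal (measure_ne_top P _)]
    refine ENNReal.ofReal_le_ofReal ?_
    have h2 : {ω | M ≤ |n * (normQV φ₂ X n a ω - meanVec φ₁ φ₂ a)|} ⊆
        {ω | Real.exp (s * M) ≤ Real.exp (s * |n * (normQV φ₂ X n a ω - meanVec φ₁ φ₂ a)|)} :=
      fun ω hω => Real.exp_le_exp.2 (mul_le_mul_of_nonneg_left hω hs.le)
    have h3 := measureReal_mono (μ := P) h2
    have h4 : Real.exp (s * M) * P.real {ω | M ≤ |n * (normQV φ₂ X n a ω - meanVec φ₁ φ₂ a)|} ≤ |B| :=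
      (mul_le_mul_of_nonneg_left h3 (Real.exp_pos _).le).trans (hmk.trans (hb.trans (le_abs_self B)))
    rw [Real.exp_neg, ← div_eq_mul_inv, le_div_iff₀ (Real.exp_pos _), mul_comm]
    exact h4
  have h2 : {ω | ¬ ∀ a, |n * (normQV φ₂ X n a ω - meanVec φ₁ φ₂ a)| ≤ M} ⊆
      ⋃ a, {ω | M ≤ |n * (normQV φ₂ X n a ω - meanVec φ₁ φ₂ a)|} := fun ω hω => by
    obtain ⟨a, ha⟩ := not_forall.1 hω
    exact Set.mem_iUnion.2 ⟨a, (not_le.1 ha).le⟩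
  refine (measure_mono h2).trans ((measure_iUnion_fintype_le P _).trans ?_)
  rw [Fin.sum_univ_two, mul_assoc, two_mul, ENNReal.ofReal_add (by positivity) (by positivity)]
  exact add_le_add (h1 0) (h1 1)

/-- Tightness reduces convergence in probability to deterministic limits: `M` is chosen so that `n
|Q - q| ≤ M` fails with probability at most `δ`, and on that event `g` is small for all large `n`.
-/
lemma tendstoInMeasure_of_tendsto_rootFilter {E : Type*} [SeminormedAddCommGroup E]
    {g : ℕ → (Fin 2 → ℝ) → E}
    (hg : ∀ M, Tendsto (fun p : ℕ × (Fin 2 → ℝ) => g p.1 p.2) (rootFilter (meanVec φ₁ φ₂) M) (𝓝 0)) :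
    TendstoInMeasure P (fun n ω => g n fun a => normQV φ₂ X n a ω) atTop 0 := by
  obtain ⟨s, hs, B, hB0, hB⟩ := exists_measure_normQV_gt_le hφ₁ hφ₂ hφ₂' hX
  rw [tendstoInMeasure_iff_norm]
  intro ε hε
  rw [ENNReal.tendsto_nhds_zero]
  intro δ hδ
  have hlim : Tendsto (fun M : ℝ => ENNReal.ofReal (B * Real.exp (-(s * M)))) atTop (𝓝 0) := by
    rw [← ENNReal.ofReal_zero]
    refine ENNReal.tendsto_ofReal ?_
    rw [← mul_zero B]
    refine Tendsto.const_mul B (Real.tendsto_exp_neg_atTop_nhds_zero.comp ?_)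
    exact tendsto_id.const_mul_atTop hs
  obtain ⟨M, hM⟩ := (ENNReal.tendsto_nhds_zero.1 hlim δ hδ).exists
  have h1 : ∀ᶠ p : ℕ × (Fin 2 → ℝ) in rootFilter (meanVec φ₁ φ₂) M, ‖g p.1 p.2‖ < ε := by
    have := (hg M).norm
    rw [norm_zero] at this
    exact this.eventually_lt_const hε
  rw [rootFilter, eventually_inf_principal, eventually_comap] at h1
  filter_upwards [h1, eventually_ge_atTop 5] with n hn hn5
  refine (measure_mono fun ω hω => ?_).trans ((hB n hn5 M).trans hM)
  intro hle
  have := hn (n, fun a => normQV φ₂ X n a ω) rfl hle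
  simp only [Pi.zero_apply, sub_zero, Set.mem_ofPred_eq] at hω
  linarith

end Law

section Asymptotics

variable {q : Fin 2 → ℝ} {M : ℝ}

lemma tendsto_fst_rootFilter : Tendsto (fun p : ℕ × (Fin 2 → ℝ) => (p.1 : ℝ)) (rootFilter q M) atTop :=
  tendsto_natCast_atTop_atTop.comp (tendsto_comap.mono_left inf_le_left)

lemma eventually_fst_pos_rootFilter : ∀ᶠ p in rootFilter q M, (0 : ℝ) < p.1 :=
  tendsto_fst_rootFilter.eventually_gt_atTop 0

lemma sub_isBigO_rootFilter :
    (fun p : ℕ × (Fin 2 → ℝ) => p.2 - q) =O[rootFilter q M] fun p => (p.1 : ℝ)⁻¹ := by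
  refine IsBigO.of_bound |M| ?_
  have h : ∀ᶠ p in rootFilter q M, ∀ a, |(p.1 : ℝ) * (p.2 a - q a)| ≤ M :=
    eventually_inf_principal.2 (Eventually.of_forall fun p hp => hp)
  filter_upwards [h, eventually_fst_pos_rootFilter] with p hp hp0
  rw [pi_norm_le_iff_of_nonneg (by positivity)]
  intro a
  have := hp a
  rw [abs_mul, abs_of_pos hp0] at this
  rw [Pi.sub_apply, Real.norm_eq_abs, norm_inv, Real.norm_of_nonneg hp0.le, ← div_eq_mul_inv,
    le_div_iff₀ hp0]
  linarith [le_abs_self M]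

lemma tendsto_inv_rootFilter :
    Tendsto (fun p : ℕ × (Fin 2 → ℝ) => (p.1 : ℝ)⁻¹) (rootFilter q M) (𝓝 0) :=
  tendsto_inv_atTop_zero.comp tendsto_fst_rootFilter

lemma tendsto_snd_rootFilter :
    Tendsto (fun p : ℕ × (Fin 2 → ℝ) => p.2) (rootFilter q M) (𝓝 q) :=
  tendsto_sub_nhds_zero_iff.1 (sub_isBigO_rootFilter.trans_tendsto tendsto_inv_rootFilter)

variable (hφ₁ : 0 < φ₁) (hφ₂ : 0 < φ₂) (hφ₂' : φ₂ < 1)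

include hφ₁ hφ₂ hφ₂'

/-- The linearization of the ratio estimators. -/
lemma tendsto_smul_ratioMap_sub :
    Tendsto (fun p : ℕ × (Fin 2 → ℝ) => (p.1 : ℝ) • (ratioMap φ₁ p.2 - ![1, φ₂] -
      ratioJacobian φ₁ φ₂ *ᵥ (p.2 - meanVec φ₁ φ₂))) (rootFilter (meanVec φ₁ φ₂) M) (𝓝 0) := by
  have h := ((ratioMap_sub_isLittleO hφ₁ hφ₂ hφ₂').comp_tendsto
    (tendsto_snd_rootFilter (M := M))).trans_isBigO sub_isBigO_rootFilter
  have h2 := (isBigO_refl (fun p : ℕ × (Fin 2 → ℝ) => (p.1 : ℝ))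
    (rootFilter (meanVec φ₁ φ₂) M)).smul_isLittleO h
  refine (isLittleO_one_iff ℝ).1 (h2.congr' (Eventually.of_forall fun p => rfl) ?_)
  filter_upwards [eventually_fst_pos_rootFilter] with p hp
  rw [smul_eq_mul, mul_inv_cancel₀ hp.ne']

lemma ratioMap_sub_isBigO (i : Fin 2) :
    (fun p : ℕ × (Fin 2 → ℝ) => ratioMap φ₁ p.2 i - ![1, φ₂] i)
      =O[rootFilter (meanVec φ₁ φ₂) M] fun p => (p.1 : ℝ)⁻¹ := by
  have h1 := ((ratioMap_sub_isLittleO hφ₁ hφ₂ hφ₂').comp_tendsto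
    (tendsto_snd_rootFilter (M := M))).isBigO.trans sub_isBigO_rootFilter
  let D : (Fin 2 → ℝ) →L[ℝ] (Fin 2 → ℝ) :=
    LinearMap.toContinuousLinearMap (ratioJacobian φ₁ φ₂).mulVecLin
  have h2 : (fun p : ℕ × (Fin 2 → ℝ) => ratioJacobian φ₁ φ₂ *ᵥ (p.2 - meanVec φ₁ φ₂))
      =O[rootFilter (meanVec φ₁ φ₂) M] fun p => (p.1 : ℝ)⁻¹ :=
    (D.isBigO_comp _ _).trans sub_isBigO_rootFilter
  have h3 := h1.add h2
  refine IsBigO.trans (IsBigO.of_bound 1 (Eventually.of_forall fun p => ?_)) h3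
  rw [one_mul]
  simp only [Function.comp_apply, sub_add_cancel]
  exact norm_le_pi_norm (ratioMap φ₁ p.2 - ![1, φ₂]) i

end Asymptotics

section Logarithm

variable {q : Fin 2 → ℝ} {M : ℝ}

lemma log_sq_pow_isLittleO (k : ℕ) :
    (fun p : ℕ × (Fin 2 → ℝ) => Real.log ((p.1 : ℝ) ^ 2) ^ k) =o[rootFilter q M]
      fun p => (p.1 : ℝ) := by
  have h := (Real.isLittleO_pow_log_id_atTop (n := k)).comp_tendsto (tendsto_fst_rootFilter (q := q) (M := M))
  refine (h.const_mul_left (2 ^ k)).congr_left fun p => ?_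
  rw [Real.log_pow, mul_pow]
  simp

lemma tendsto_log_sq_rootFilter :
    Tendsto (fun p : ℕ × (Fin 2 → ℝ) => Real.log ((p.1 : ℝ) ^ 2)) (rootFilter q M) atTop :=
  Real.tendsto_log_atTop.comp ((tendsto_pow_atTop two_ne_zero).comp tendsto_fst_rootFilter)

lemma exp_sub_isBigO : (fun x : ℝ => Real.exp x - 1 - x) =O[𝓝 0] fun x => x ^ 2 := by
  refine (Real.exp_sub_sum_range_isBigO_pow 2).congr_left fun x => ?_
  simp [Finset.sum_range_succ]
  ring

lemma exp_sub_one_isBigO : (fun x : ℝ => Real.exp x - 1) =O[𝓝 0] fun x => x := by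
  refine ((Real.exp_sub_sum_range_isBigO_pow 1).congr_left fun x => ?_).congr_right fun x => ?_
  · simp
  · simp

/-- The scaled remainder of the plug-in estimator `e^{L S} (1 + u)`. -/
lemma tendsto_mul_exp_mul_sub {S u : ℕ × (Fin 2 → ℝ) → ℝ}
    (hS : S =O[rootFilter q M] fun p => (p.1 : ℝ)⁻¹) (hu : u =O[rootFilter q M] fun p => (p.1 : ℝ)⁻¹) :
    Tendsto (fun p => (p.1 : ℝ) * (Real.exp (Real.log ((p.1 : ℝ) ^ 2) * S p) * (1 + u p) - 1 -
      Real.log ((p.1 : ℝ) ^ 2) * S p - u p)) (rootFilter q M) (𝓝 0) := by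
  set L : ℕ × (Fin 2 → ℝ) → ℝ := fun p => Real.log ((p.1 : ℝ) ^ 2)
  have hinv : ∀ᶠ p in rootFilter q M, (p.1 : ℝ) * (p.1 : ℝ)⁻¹ = 1 := by
    filter_upwards [eventually_fst_pos_rootFilter] with p hp
    exact mul_inv_cancel₀ hp.ne'
  have hn := isBigO_refl (fun p : ℕ × (Fin 2 → ℝ) => (p.1 : ℝ)⁻¹) (rootFilter q M)
  have hn1 := isBigO_refl (fun p : ℕ × (Fin 2 → ℝ) => (p.1 : ℝ)) (rootFilter q M)
  have hLn : ∀ k, (fun p => L p ^ k * (p.1 : ℝ)⁻¹) =o[rootFilter q M] fun _ => (1 : ℝ) := fun k =>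
    ((log_sq_pow_isLittleO k).mul_isBigO hn).congr' (Eventually.of_forall fun _ => rfl) hinv
  have hx : (fun p => L p * S p) =O[rootFilter q M] fun p => L p * (p.1 : ℝ)⁻¹ :=
    (isBigO_refl L _).mul hS
  have hx0 : Tendsto (fun p => L p * S p) (rootFilter q M) (𝓝 0) :=
    hx.trans_tendsto ((isLittleO_one_iff ℝ).1 ((hLn 1).congr_left fun p => by rw [pow_one]))
  -- The remainder is `(e^{LS} - 1) u + (e^{LS} - 1 - LS)`, of order `L / n² + L² / n²`; after
  -- multiplication by `n` it vanishes, powers of `L` being `o(n)`.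
  have h1 := (hn1.mul (((exp_sub_one_isBigO.comp_tendsto hx0).trans hx).mul hu)).congr'
    (Eventually.of_forall fun _ => rfl)
    (g₂ := fun p => L p ^ 1 * (p.1 : ℝ)⁻¹) (by
      filter_upwards [hinv] with p hp
      linear_combination L p * (p.1 : ℝ)⁻¹ * hp)
  have h2 := (hn1.mul ((exp_sub_isBigO.comp_tendsto hx0).trans (hx.pow 2))).congr'
    (Eventually.of_forall fun _ => rfl)
    (g₂ := fun p => L p ^ 2 * (p.1 : ℝ)⁻¹) (by
      filter_upwards [hinv] with p hp
      linear_combination L p ^ 2 * (p.1 : ℝ)⁻¹ * hp)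
  have h3 := (h1.trans_isLittleO (hLn 1)).add (h2.trans_isLittleO (hLn 2))
  refine (isLittleO_one_iff ℝ).1 (h3.congr_left fun p => ?_)
  simp only [Function.comp_apply]
  ring

/-- The scaled remainder of the logarithm of the plug-in estimator. -/
lemma tendsto_mul_log_exp_mul_sub {S u : ℕ × (Fin 2 → ℝ) → ℝ}
    (hu : u =O[rootFilter q M] fun p => (p.1 : ℝ)⁻¹) :
    Tendsto (fun p => (p.1 : ℝ) * (Real.log (Real.exp (Real.log ((p.1 : ℝ) ^ 2) * S p) * (1 + u p)) -
      Real.log ((p.1 : ℝ) ^ 2) * S p - u p)) (rootFilter q M) (𝓝 0) := by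
  have hu0 : Tendsto u (rootFilter q M) (𝓝 0) := hu.trans_tendsto tendsto_inv_rootFilter
  have hu1 : Tendsto (fun p => 1 + u p) (rootFilter q M) (𝓝 1) := by simpa using hu0.const_add 1
  have h1 := (Real.hasDerivAt_log one_ne_zero).isLittleO.comp_tendsto hu1
  have hu' : ((fun x => x - 1) ∘ fun p => 1 + u p) =O[rootFilter q M] fun p => (p.1 : ℝ)⁻¹ := by
    simpa [Function.comp_def] using hu
  have h2 := (isBigO_refl (fun p : ℕ × (Fin 2 → ℝ) => (p.1 : ℝ)) (rootFilter q M)).mul_isLittleO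
    (h1.trans_isBigO hu')
  -- The logarithm of the exponential factor is exactly `L S`, so only `log (1 + u) - u = o(1/n)`
  -- matters.
  refine (isLittleO_one_iff ℝ).1 (h2.congr' ?_ ?_)
  · filter_upwards [hu1.eventually_const_lt zero_lt_one] with p hp
    rw [Real.log_mul (Real.exp_pos _).ne' hp.ne', Real.log_exp]
    simp
  · filter_upwards [eventually_fst_pos_rootFilter] with p hp
    exact mul_inv_cancel₀ hp.ne'

end Logarithm

end PowerLaw
end

/-! ### Limit theorems for the estimators -/

open Asymptotics
open scoped ENNReal NNReal
noncomputable section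
namespace PowerLaw

variable {φ₁ φ₂ : ℝ} {Ω : Type*} {X : Plane → Ω → ℝ}

/-- The ratio of the plug-in scale estimator to the scale. -/
lemma plugIn_eq (hφ₁ : 0 < φ₁) {n : ℕ} (hn : n ≠ 0) (X : Plane → Ω → ℝ) (ω : Ω) :
    ((n : ℝ) ^ 2) ^ roughEst n (sample ((n : ℝ)⁻¹) X ω) * scaleEst n (sample ((n : ℝ)⁻¹) X ω) / φ₁ =
      Real.exp (Real.log ((n : ℝ) ^ 2) * (ratioMap φ₁ (fun a => normQV φ₂ X n a ω) 1 - φ₂)) *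
        ratioMap φ₁ (fun a => normQV φ₂ X n a ω) 0 := by
  have hN : (0 : ℝ) < (n : ℝ) ^ 2 := by
    have : (0 : ℝ) < n := by exact_mod_cast Nat.pos_of_ne_zero hn
    positivity
  rw [← ratioMap_normQV hn]
  simp only [Matrix.cons_val_zero, Matrix.cons_val_one, Matrix.cons_val_fin_one]
  rw [mul_sub, Real.exp_sub, ← Real.rpow_def_of_pos hN, ← Real.rpow_def_of_pos hN,
    Real.rpow_neg hN.le]
  have := (Real.rpow_pos_of_pos hN φ₂).ne'
  field_simp

lemma aemeasurable_smul_toLp [MeasurableSpace Ω] {P : Measure Ω} {v : Ω → Fin 2 → ℝ}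
    (h : ∀ i, AEMeasurable (fun ω => v ω i) P) (c : ℝ) :
    AEMeasurable (fun ω => (c • WithLp.toLp 2 (v ω) : Plane)) P := by
  have h1 : AEMeasurable (fun ω => (WithLp.toLp 2 (v ω) : Plane)) P :=
    (WithLp.measurable_toLp 2 (Fin 2 → ℝ)).comp_aemeasurable (aemeasurable_pi_lambda _ h)
  exact h1.const_smul c

variable [MeasurableSpace Ω] {P : Measure Ω} [IsProbabilityMeasure P]
  (hφ₁ : 0 < φ₁) (hφ₂ : 0 < φ₂) (hφ₂' : φ₂ < 1) (hX : IsPowerLawField φ₁ φ₂ unitSquare X P)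

include hφ₁ hφ₂ hφ₂' hX

lemma aemeasurable_scaleEst (n : ℕ) :
    AEMeasurable (fun ω => scaleEst n (sample ((n : ℝ)⁻¹) X ω)) P :=
  (measurable_pi_apply 0).comp_aemeasurable (aemeasurable_momentMap_sample hφ₁ hφ₂ hφ₂' hX n)

lemma aemeasurable_roughEst (n : ℕ) :
    AEMeasurable (fun ω => roughEst n (sample ((n : ℝ)⁻¹) X ω)) P :=
  (measurable_pi_apply 1).comp_aemeasurable (aemeasurable_momentMap_sample hφ₁ hφ₂ hφ₂' hX n)

lemma aemeasurable_plugIn (n : ℕ) :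
    AEMeasurable (fun ω => ((n : ℝ) ^ 2) ^ roughEst n (sample ((n : ℝ)⁻¹) X ω) *
      scaleEst n (sample ((n : ℝ)⁻¹) X ω)) P := by
  have h1 := aemeasurable_scaleEst hφ₁ hφ₂ hφ₂' hX n
  have h2 := aemeasurable_roughEst hφ₁ hφ₂ hφ₂' hX n
  fun_prop

/-- The delta method for the ratio estimators. -/
lemma tendstoInDistribution_of_rootFilter {f : ℕ → Ω → Plane} {h : ℕ → (Fin 2 → ℝ) → Fin 2 → ℝ}
    (hf : ∀ n, AEMeasurable (f n) P)
    (hfh : ∀ n, n ≠ 0 → ∀ ω, f n ω = WithLp.toLp 2 (h n fun a => normQV φ₂ X n a ω))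
    (hlim : ∀ M, Tendsto (fun p : ℕ × (Fin 2 → ℝ) => h p.1 p.2 -
      (p.1 : ℝ) • (ratioMap φ₁ p.2 - ![1, φ₂])) (rootFilter (meanVec φ₁ φ₂) M) (𝓝 0)) :
    TendstoInDistribution f atTop id (fun _ => P) (multivariateGaussian 0 (limitCov φ₁ φ₂)) := by
  -- Slutsky: the difference from the linearized statistic tends to zero in probability.
  refine tendstoInDistribution_of_tendstoInMeasure_sub _ _
    (tendstoInDistribution_linear hφ₁ hφ₂ hφ₂' hX) ?_ hf
  have hg : ∀ M, Tendsto (fun p : ℕ × (Fin 2 → ℝ) => (WithLp.toLp 2 (h p.1 p.2 -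
      (p.1 : ℝ) • (ratioJacobian φ₁ φ₂ *ᵥ (p.2 - meanVec φ₁ φ₂))) : Plane))
      (rootFilter (meanVec φ₁ φ₂) M) (𝓝 0) := fun M => by
    have h1 := (hlim M).add (tendsto_smul_ratioMap_sub (M := M) hφ₁ hφ₂ hφ₂')
    have h2 := ((PiLp.continuous_toLp 2 fun _ : Fin 2 => ℝ).tendsto _).comp h1
    rw [add_zero, WithLp.toLp_zero] at h2
    refine h2.congr fun p => ?_
    simp only [Function.comp_apply, smul_sub]
    congr 1
    abel
  refine (tendstoInMeasure_of_tendsto_rootFilter hφ₁ hφ₂ hφ₂' hX (g := fun n y =>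
    (WithLp.toLp 2 (h n y - (n : ℝ) • (ratioJacobian φ₁ φ₂ *ᵥ (y - meanVec φ₁ φ₂))) : Plane))
    hg).congr' ?_ (ae_eq_refl _)
  filter_upwards [eventually_ne_atTop 0] with n hn
  refine ae_of_all _ fun ω => ?_
  simp only [Pi.sub_apply, hfh n hn, ← WithLp.toLp_sub]
  rfl

theorem tendstoInDistribution_ratio :
    TendstoInDistribution (fun (n : ℕ) ω => (√((n : ℝ) ^ 2) •
      !₂[scaleEst n (sample ((n : ℝ)⁻¹) X ω) / (φ₁ * ((n : ℝ) ^ 2) ^ (-φ₂)) - 1,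
        roughEst n (sample ((n : ℝ)⁻¹) X ω) - φ₂] : Plane))
      atTop id (fun _ => P) (multivariateGaussian 0 (limitCov φ₁ φ₂)) := by
  refine tendstoInDistribution_of_rootFilter hφ₁ hφ₂ hφ₂' hX
    (h := fun n y => (n : ℝ) • (ratioMap φ₁ y - ![1, φ₂])) (fun n => ?_) (fun n hn ω => ?_) fun M => ?_
  · have h1 := aemeasurable_scaleEst hφ₁ hφ₂ hφ₂' hX n
    have h2 := aemeasurable_roughEst hφ₁ hφ₂ hφ₂' hX n
    refine aemeasurable_smul_toLp (fun i => ?_) _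
    fin_cases i <;> simp <;> fun_prop
  · rw [← ratioMap_normQV hn, Real.sqrt_sq n.cast_nonneg]
    ext i; fin_cases i <;> simp
  · simp only [sub_self]
    exact tendsto_const_nhds

theorem tendstoInDistribution_plugIn :
    TendstoInDistribution (fun (n : ℕ) ω => (√((n : ℝ) ^ 2) •
      !₂[(((n : ℝ) ^ 2) ^ roughEst n (sample ((n : ℝ)⁻¹) X ω) *
          scaleEst n (sample ((n : ℝ)⁻¹) X ω) / φ₁ - 1) -
          Real.log ((n : ℝ) ^ 2) * (roughEst n (sample ((n : ℝ)⁻¹) X ω) - φ₂),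
        roughEst n (sample ((n : ℝ)⁻¹) X ω) - φ₂] : Plane))
      atTop id (fun _ => P) (multivariateGaussian 0 (limitCov φ₁ φ₂)) := by
  refine tendstoInDistribution_of_rootFilter hφ₁ hφ₂ hφ₂' hX
    (h := fun n y => (n : ℝ) • ![Real.exp (Real.log ((n : ℝ) ^ 2) * (ratioMap φ₁ y 1 - φ₂)) *
      ratioMap φ₁ y 0 - 1 - Real.log ((n : ℝ) ^ 2) * (ratioMap φ₁ y 1 - φ₂), ratioMap φ₁ y 1 - φ₂])
    (fun n => ?_) (fun n hn ω => ?_) fun M => ?_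
  · have h1 := aemeasurable_plugIn hφ₁ hφ₂ hφ₂' hX n
    have h2 := aemeasurable_roughEst hφ₁ hφ₂ hφ₂' hX n
    refine aemeasurable_smul_toLp (fun i => ?_) _
    fin_cases i <;> simp only [Fin.zero_eta, Matrix.cons_val_zero, Fin.mk_one, Matrix.cons_val_one,
      Matrix.cons_val_fin_one] <;> fun_prop
  · rw [plugIn_eq hφ₁ hn, ← ratioMap_normQV hn, Real.sqrt_sq n.cast_nonneg]
    ext i; fin_cases i <;> simp
  · have h1 := tendsto_mul_exp_mul_sub (ratioMap_sub_isBigO (M := M) hφ₁ hφ₂ hφ₂' 1)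
      (ratioMap_sub_isBigO (M := M) hφ₁ hφ₂ hφ₂' 0)
    refine tendsto_pi_nhds.2 fun i => ?_
    fin_cases i
    · refine h1.congr fun p => ?_
      simp [-Matrix.sub_cons]
      ring
    · simp [-Matrix.sub_cons, tendsto_const_nhds]

theorem tendstoInDistribution_log :
    TendstoInDistribution (fun (n : ℕ) ω => (√((n : ℝ) ^ 2) •
      WithLp.toLp 2 (stabMatrix ((n : ℝ) ^ 2) *ᵥ
        ![Real.log (((n : ℝ) ^ 2) ^ roughEst n (sample ((n : ℝ)⁻¹) X ω) *
          scaleEst n (sample ((n : ℝ)⁻¹) X ω) / φ₁),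
        roughEst n (sample ((n : ℝ)⁻¹) X ω) - φ₂]) : Plane))
      atTop id (fun _ => P) (multivariateGaussian 0 (limitCov φ₁ φ₂)) := by
  refine tendstoInDistribution_of_rootFilter hφ₁ hφ₂ hφ₂' hX
    (h := fun n y => (n : ℝ) • (stabMatrix ((n : ℝ) ^ 2) *ᵥ
      ![Real.log (Real.exp (Real.log ((n : ℝ) ^ 2) * (ratioMap φ₁ y 1 - φ₂)) *
      ratioMap φ₁ y 0), ratioMap φ₁ y 1 - φ₂]))
    (fun n => ?_) (fun n hn ω => ?_) fun M => ?_
  · have h1 := aemeasurable_plugIn hφ₁ hφ₂ hφ₂' hX n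
    have h2 := aemeasurable_roughEst hφ₁ hφ₂ hφ₂' hX n
    refine aemeasurable_smul_toLp (fun i => ?_) _
    simp only [Matrix.mulVec, dotProduct, Fin.sum_univ_two, Matrix.cons_val_zero,
      Matrix.cons_val_one, Matrix.cons_val_fin_one]
    fun_prop
  · rw [plugIn_eq hφ₁ hn, ← ratioMap_normQV hn, Real.sqrt_sq n.cast_nonneg, WithLp.toLp_smul]
    simp
  · have h1 := tendsto_mul_log_exp_mul_sub (S := fun p => ratioMap φ₁ p.2 1 - φ₂)
      (ratioMap_sub_isBigO (M := M) hφ₁ hφ₂ hφ₂' 0)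
    refine tendsto_pi_nhds.2 fun i => ?_
    fin_cases i
    · refine h1.congr fun p => ?_
      simp [stabMatrix, -Matrix.sub_cons]
      ring
    · simp [stabMatrix, -Matrix.sub_cons, tendsto_const_nhds]

/-- Projection of the joint limit; it serves both the exact rate of the scale estimator and the
lower bound on the variance of the roughness estimator. -/
lemma tendstoInDistribution_roughEst :
    TendstoInDistribution (fun (n : ℕ) ω => (n : ℝ) * (roughEst n (sample ((n : ℝ)⁻¹) X ω) - φ₂))
      atTop id (fun _ => P) (gaussianReal 0 (limitCov φ₁ φ₂ 1 1).toNNReal) := by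
  have hmp := measurePreserving_eval_multivariateGaussian (μ := 0)
    (posSemidef_limitCov hφ₁ hφ₂ hφ₂') (i := 1)
  have h := (tendstoInDistribution_ratio hφ₁ hφ₂ hφ₂' hX).continuous_comp
    (g := fun x : Plane => x 1) (by fun_prop)
  have e : (fun (n : ℕ) ω => (n : ℝ) * (roughEst n (sample ((n : ℝ)⁻¹) X ω) - φ₂)) =
      fun (n : ℕ) => (fun x : Plane => x 1) ∘ fun ω => (√((n : ℝ) ^ 2) •
        !₂[scaleEst n (sample ((n : ℝ)⁻¹) X ω) / (φ₁ * ((n : ℝ) ^ 2) ^ (-φ₂)) - 1,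
          roughEst n (sample ((n : ℝ)⁻¹) X ω) - φ₂] : Plane) := by
    ext n ω
    simp [Real.sqrt_sq n.cast_nonneg]
  rw [e]
  refine ⟨h.forall_aemeasurable, by fun_prop, ?_⟩
  convert! h.tendsto using 3
  exact congrArg 𝓝 (Subtype.ext (Measure.map_id.trans hmp.map_eq.symm))

theorem tendstoInDistribution_plugIn_scale :
    TendstoInDistribution (fun (n : ℕ) ω => √((n : ℝ) ^ 2) / Real.log ((n : ℝ) ^ 2) *
        (((n : ℝ) ^ 2) ^ roughEst n (sample ((n : ℝ)⁻¹) X ω) *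
          scaleEst n (sample ((n : ℝ)⁻¹) X ω) / φ₁ - 1))
      atTop id (fun _ => P) (gaussianReal 0 (limitCov φ₁ φ₂ 1 1).toNNReal) := by
  refine tendstoInDistribution_of_tendstoInMeasure_sub _ _
    (tendstoInDistribution_roughEst hφ₁ hφ₂ hφ₂' hX) ?_ fun n => ?_
  · refine (tendstoInMeasure_of_tendsto_rootFilter hφ₁ hφ₂ hφ₂' hX (g := fun n y =>
      (n : ℝ) / Real.log ((n : ℝ) ^ 2) * (Real.exp (Real.log ((n : ℝ) ^ 2) *
        (ratioMap φ₁ y 1 - φ₂)) * ratioMap φ₁ y 0 - 1) - n * (ratioMap φ₁ y 1 - φ₂))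
      fun M => ?_).congr' ?_ (ae_eq_refl _)
    · have h1 := tendsto_mul_exp_mul_sub (ratioMap_sub_isBigO (M := M) hφ₁ hφ₂ hφ₂' 1)
        (ratioMap_sub_isBigO (M := M) hφ₁ hφ₂ hφ₂' 0)
      have hL := tendsto_inv_atTop_zero.comp (tendsto_log_sq_rootFilter (q := meanVec φ₁ φ₂) (M := M))
      have h2 := (isBigO_refl (fun p : ℕ × (Fin 2 → ℝ) => (p.1 : ℝ))
        (rootFilter (meanVec φ₁ φ₂) M)).mul (ratioMap_sub_isBigO (M := M) hφ₁ hφ₂ hφ₂' 0)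
      have h3 : (fun p : ℕ × (Fin 2 → ℝ) => (p.1 : ℝ) * (ratioMap φ₁ p.2 0 - ![1, φ₂] 0))
          =O[rootFilter (meanVec φ₁ φ₂) M] fun _ => (1 : ℝ) :=
        h2.congr' (Eventually.of_forall fun _ => rfl) (by
          filter_upwards [eventually_fst_pos_rootFilter] with p hp
          exact mul_inv_cancel₀ hp.ne')
      have h4 := ((h1.isBigO_one ℝ).add h3).mul_isLittleO ((isLittleO_one_iff ℝ).2 hL)
      refine (isLittleO_one_iff ℝ).1 (h4.congr' ?_ (by simp))
      filter_upwards [tendsto_log_sq_rootFilter.eventually_gt_atTop 0] with p hp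
      simp only [Function.comp_apply, Matrix.cons_val_zero, Matrix.cons_val_one,
        Matrix.cons_val_fin_one]
      field_simp
      ring
    · filter_upwards [eventually_ne_atTop 0] with n hn
      refine ae_of_all _ fun ω => ?_
      simp only [Pi.sub_apply]
      rw [plugIn_eq hφ₁ hn, Real.sqrt_sq n.cast_nonneg]
      congr 3
      rw [← ratioMap_normQV hn]
      simp
  · have h1 := aemeasurable_plugIn hφ₁ hφ₂ hφ₂' hX n
    fun_prop

end PowerLaw
end

noncomputable section
namespace PowerLaw

/-! ### Logarithmic bounds for the moment map -/

/-- On `[2, ∞)` the function `Γ` is increasing and at least `1`; a comparison with `m! ≤ m ^ m`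
gives the upper bound. -/
lemma log_Gamma_nonneg_le {x : ℝ} (hx : 2 ≤ x) :
    0 ≤ Real.log (Real.Gamma x) ∧ Real.log (Real.Gamma x) ≤ (x + 1) ^ 2 := by
  have hm := Real.Gamma_strictMonoOn_Ici.monotoneOn
  have h1 : 1 ≤ Real.Gamma x := by
    have := hm (Set.self_mem_Ici) hx hx
    rwa [Real.Gamma_two] at this
  refine ⟨Real.log_nonneg h1, ?_⟩
  set m := ⌈x⌉₊ with hm_def
  have hxm : x ≤ m := Nat.le_ceil x
  have hmx : (m : ℝ) < x + 1 := Nat.ceil_lt_add_one (by linarith)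
  have h2 : Real.Gamma x ≤ (m : ℝ) ^ m := by
    have h3 : Real.Gamma x ≤ Real.Gamma (m + 1) :=
      hm hx (Set.mem_Ici.2 (by linarith)) (by linarith)
    rw [Real.Gamma_nat_eq_factorial] at h3
    exact h3.trans (by exact_mod_cast Nat.factorial_le_pow m)
  have hm0 : (0 : ℝ) < m := by linarith
  calc Real.log (Real.Gamma x) ≤ Real.log ((m : ℝ) ^ m) := Real.log_le_log (by linarith) h2
    _ = m * Real.log m := Real.log_pow _ _
    _ ≤ m * m := by gcongr; exact Real.log_le_self hm0.le
    _ ≤ (x + 1) ^ 2 := by nlinarith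

/-- With `s = -φ` and `φ ≤ 11/4` the shifted argument exceeds `2`, so every singularity of `Γ(-φ)`
shows up as an explicit factor `k - φ`. -/
lemma Gamma_five_add {s : ℝ} (h0 : s ≠ 0) (h1 : s + 1 ≠ 0) (h2 : s + 2 ≠ 0) (h3 : s + 3 ≠ 0)
    (h4 : s + 4 ≠ 0) :
    Real.Gamma (s + 5) = (s + 4) * ((s + 3) * ((s + 2) * ((s + 1) * (s * Real.Gamma s)))) := by
  rw [← Real.Gamma_add_one h0, ← Real.Gamma_add_one h1, show s + 1 + 1 = s + 2 by ring,
    ← Real.Gamma_add_one h2, show s + 2 + 1 = s + 3 by ring, ← Real.Gamma_add_one h3,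
    show s + 3 + 1 = s + 4 by ring, ← Real.Gamma_add_one h4, show s + 4 + 1 = s + 5 by ring]

lemma abs_rpow_sub_rpow_le {x y b : ℝ} (hx : x ≤ b) (hy : y ≤ b) :
    |(4 : ℝ) ^ x - 4 ^ y| ≤ 2 * 4 ^ b * |x - y| := by
  wlog h : y ≤ x generalizing x y
  · rw [abs_sub_comm, abs_sub_comm x]
    exact this hy hx (not_le.1 h).le
  have h4 : (0 : ℝ) < 4 := by norm_num
  rw [abs_of_nonneg (sub_nonneg.2 (Real.rpow_le_rpow_of_exponent_le (by norm_num) h)),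
    abs_of_nonneg (sub_nonneg.2 h)]
  have hlog : Real.log 4 ≤ 2 := by
    rw [show (4 : ℝ) = 2 ^ 2 by norm_num, Real.log_pow]
    have := Real.log_two_lt_d9
    push_cast
    linarith
  have h1 := Real.add_one_le_exp (Real.log 4 * (y - x))
  have h2 : (4 : ℝ) ^ y = 4 ^ x * Real.exp (Real.log 4 * (y - x)) := by
    rw [← Real.rpow_def_of_pos h4, ← Real.rpow_add h4]; ring_nf
  have h3 : (4 : ℝ) ^ x ≤ 4 ^ b := Real.rpow_le_rpow_of_exponent_le (by norm_num) hx
  have hx0 : (0 : ℝ) < 4 ^ x := Real.rpow_pos_of_pos h4 x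
  calc (4 : ℝ) ^ x - 4 ^ y ≤ 4 ^ x * (Real.log 4 * (x - y)) := by
        rw [h2]; nlinarith
    _ ≤ 4 ^ b * (2 * (x - y)) := by gcongr
    _ = _ := by ring

/-- As `4^φ = y₁ / y₀`, the bound `|4^k - 4^φ| ≤ 128 |k - φ|`, with `128 = 2 · 4³`, shows that `k -
φ` can be small only if the linear form `y₁ - 4^k y₀` is small compared with `y₀`. -/
lemma abs_log_sub_le {y : Fin 2 → ℝ} (h0 : 0 < y 0) {φ : ℝ} (h4φ : (4 : ℝ) ^ φ = y 1 / y 0)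
    (hφb : φ ≤ 11 / 4) {k : ℝ} (hk0 : 0 ≤ k) (hk : k ≤ 2) (hne : (4 : ℝ) ^ k ≠ y 1 / y 0) :
    k - φ ≠ 0 ∧ |Real.log (k - φ)| ≤
      500 + |Real.log (y 0)| + |φ| + |Real.log (-(4 ^ k * y 0) + y 1)| := by
  have hkφ : k - φ ≠ 0 := fun h => hne (by rw [← h4φ, sub_eq_zero.1 h])
  have hd : -(4 ^ k * y 0) + y 1 ≠ 0 := fun h => hne (by field_simp; linarith)
  refine ⟨hkφ, ?_⟩
  have e1 := abs_rpow_sub_rpow_le (b := 3) (x := k) (y := φ) (by linarith) (by linarith)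
  have e2 : |(4 : ℝ) ^ k - 4 ^ φ| = |-(4 ^ k * y 0) + y 1| / y 0 := by
    rw [h4φ, ← abs_of_pos h0, ← abs_div, abs_of_pos h0, abs_sub_comm]
    congr 1
    field_simp
    ring
  rw [e2, div_le_iff₀ h0] at e1
  have e3 : (2 : ℝ) * 4 ^ (3 : ℝ) = 128 := by norm_num
  rw [e3] at e1
  have hpos := abs_pos.2 hkφ
  rw [← Real.log_abs (k - φ), abs_le]
  constructor
  · have e4 := Real.log_le_log (abs_pos.2 hd) e1
    rw [Real.log_mul (by positivity) h0.ne', Real.log_mul (by norm_num) hpos.ne', Real.log_abs] at e4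
    have e5 := Real.log_le_self (x := 128) (by norm_num)
    linarith [neg_abs_le (Real.log (-(4 ^ k * y 0) + y 1)), le_abs_self (Real.log (y 0)), abs_nonneg φ]
  · have e6 := Real.log_le_self hpos.le
    have e7 : |k - φ| ≤ 2 + |φ| := (abs_sub k φ).trans (by rw [abs_of_nonneg hk0]; linarith)
    linarith [abs_nonneg (Real.log (-(4 ^ k * y 0) + y 1)), abs_nonneg (Real.log (y 0))]

/-- The factors `3 - φ` and `4 - φ` stay above `1/4`, so they require no further linear form in `y`.
-/
lemma abs_log_sub_le_of_le {φ k : ℝ} (hφb : φ ≤ 11 / 4) (hk : 3 ≤ k) (hk' : k ≤ 4) :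
    k - φ ≠ 0 ∧ |Real.log (k - φ)| ≤ 4 + |φ| := by
  have hpos : 1 / 4 ≤ k - φ := by linarith
  refine ⟨by linarith, ?_⟩
  rw [abs_le]
  constructor
  · have e1 := Real.log_le_log (by norm_num) hpos
    have e2 := Real.log_le_self (x := 4) (by norm_num)
    rw [one_div, Real.log_inv] at e1
    linarith [abs_nonneg φ]
  · have e1 := Real.log_le_self (x := k - φ) (by linarith)
    linarith [neg_abs_le φ]

lemma abs_log_Gamma_neg_le {φ : ℝ} (hφb : φ ≤ 11 / 4) (n0 : 0 - φ ≠ 0) (n1 : 1 - φ ≠ 0)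
    (n2 : 2 - φ ≠ 0) (n3 : 3 - φ ≠ 0) (n4 : 4 - φ ≠ 0) : Real.Gamma (-φ) ≠ 0 ∧
    |Real.log (Real.Gamma (-φ))| ≤ (6 + |φ|) ^ 2 + |Real.log (0 - φ)| + |Real.log (1 - φ)| +
      |Real.log (2 - φ)| + |Real.log (3 - φ)| + |Real.log (4 - φ)| := by
  have hG := Gamma_five_add (s := -φ) (by simpa using n0) (by rwa [neg_add_eq_sub])
    (by rwa [neg_add_eq_sub]) (by rwa [neg_add_eq_sub]) (by rwa [neg_add_eq_sub])
  have hG5 := log_Gamma_nonneg_le (x := -φ + 5) (by linarith)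
  have hG0 : Real.Gamma (-φ) ≠ 0 := by
    intro h
    rw [h] at hG
    have : 0 < Real.Gamma (-φ + 5) := Real.Gamma_pos_of_pos (by linarith)
    simp at hG
    linarith
  refine ⟨hG0, ?_⟩
  have e := congrArg Real.log hG
  rw [show -φ + 4 = 4 - φ by ring, show -φ + 3 = 3 - φ by ring, show -φ + 2 = 2 - φ by ring,
    show -φ + 1 = 1 - φ by ring, Real.log_mul n4 (by simp_all), Real.log_mul n3 (by simp_all),
    Real.log_mul n2 (by simp_all), Real.log_mul n1 (by simp_all), Real.log_mul (by simp_all) hG0] at e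
  rw [show (0 : ℝ) - φ = -φ by ring]
  have e2 : (-φ + 5 + 1) ^ 2 ≤ (6 + |φ|) ^ 2 := by
    refine pow_le_pow_left₀ (by linarith) ?_ 2
    linarith [neg_abs_le φ]
  have := abs_le.1 (le_refl |Real.log (-φ)|)
  have := abs_le.1 (le_refl |Real.log (1 - φ)|)
  have := abs_le.1 (le_refl |Real.log (2 - φ)|)
  have := abs_le.1 (le_refl |Real.log (3 - φ)|)
  have := abs_le.1 (le_refl |Real.log (4 - φ)|)
  rw [abs_le]
  constructor
  · linarith [sq_nonneg (6 + |φ|)]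
  · linarith

/-- With `t = 2^φ`, `(8 - 4t)(2 + t) y₀ = 4 (4 y₀ - y₁)`: the zero at `φ = 1` is that of a linear
form in `y`, and `2 + t` lies between `2` and `8`. -/
lemma abs_log_sub_two_rpow_le {y : Fin 2 → ℝ} (h0 : 0 < y 0) (h1 : 0 < y 1) (h2 : y 1 ≤ 36 * y 0)
    {φ : ℝ} (h4φ : (4 : ℝ) ^ φ = y 1 / y 0) (d1 : -(4 * y 0) + y 1 ≠ 0) : 8 - 4 * (2 : ℝ) ^ φ ≠ 0 ∧
    |Real.log (8 - 4 * (2 : ℝ) ^ φ)| ≤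
      12 + |Real.log (y 0)| + |Real.log (-(4 * y 0) + y 1)| := by
  set t := (2 : ℝ) ^ φ with ht
  have ht0 : 0 < t := Real.rpow_pos_of_pos two_pos φ
  have htt : t ^ 2 * y 0 = y 1 := by
    have : t ^ 2 = 4 ^ φ := by
      rw [ht, ← Real.rpow_natCast, ← Real.rpow_mul two_pos.le, mul_comm, Real.rpow_mul two_pos.le]
      norm_num
    rw [this, h4φ]; field_simp
  have ht6 : t ≤ 6 := by
    have : t ^ 2 ≤ 36 := le_of_mul_le_mul_right (by linarith) h0
    nlinarith
  have hE : (8 - 4 * t) * ((2 + t) * y 0) = -4 * (-(4 * y 0) + y 1) := by linear_combination (-4) * htt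
  have hE0 : 8 - 4 * t ≠ 0 := fun h => by
    rw [h, zero_mul] at hE
    exact d1 (by linarith)
  refine ⟨hE0, ?_⟩
  have e := congrArg Real.log hE
  rw [Real.log_mul hE0 (by positivity), Real.log_mul (by positivity) h0.ne',
    Real.log_mul (by norm_num) d1, Real.log_neg_eq_log] at e
  have e1 := Real.log_nonneg (x := 2 + t) (by linarith)
  have e2 := Real.log_le_self (x := 2 + t) (by linarith)
  have e3 := Real.log_nonneg (x := 4) (by norm_num)
  have e4 := Real.log_le_self (x := 4) (by norm_num)
  have := abs_le.1 (le_refl |Real.log (y 0)|)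
  have := abs_le.1 (le_refl |Real.log (-(4 * y 0) + y 1)|)
  rw [abs_le]
  constructor <;> linarith

/-- The combinations of the quadratic variations whose vanishing makes the moment map singular. -/
def contrast : Fin 5 → Fin 2 → ℝ := ![![1, 0], ![0, 1], ![-1, 1], ![-4, 1], ![-16, 1]]

/-- The logarithmic size of the moment map. -/
def logSize (y : Fin 2 → ℝ) : ℝ := 1 + ∑ j, Real.log (∑ a, contrast j a * y a) ^ 2

lemma one_le_logSize (y : Fin 2 → ℝ) : 1 ≤ logSize y :=
  le_add_of_nonneg_right (Finset.sum_nonneg fun _ _ => sq_nonneg _)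

lemma logSize_eq (y : Fin 2 → ℝ) : logSize y = 1 + (Real.log (y 0) ^ 2 + Real.log (y 1) ^ 2 +
    Real.log (-y 0 + y 1) ^ 2 + Real.log (-(4 * y 0) + y 1) ^ 2 + Real.log (-(16 * y 0) + y 1) ^ 2) := by
  simp [logSize, contrast, Fin.sum_univ_five, Fin.sum_univ_two]

/-- The quantitative estimate behind `exists_abs_log_ratioMap_le`. -/
lemma abs_log_aOne_le {y : Fin 2 → ℝ} (h0 : 0 < y 0) (h1 : 0 < y 1) (h2 : y 1 ≤ 36 * y 0)
    (d0 : -y 0 + y 1 ≠ 0) (d1 : -(4 * y 0) + y 1 ≠ 0) (d2 : -(16 * y 0) + y 1 ≠ 0) {φ : ℝ}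
    (hφ : φ = 1 / 2 * Real.logb 2 (y 1 / y 0)) :
    |φ| ≤ 2 * logSize y ∧ aOne φ ≠ 0 ∧ |Real.log (aOne φ)| ≤ 2000 * logSize y := by
  have hr : 0 < y 1 / y 0 := div_pos h1 h0
  have hZ := one_le_logSize y
  have hZe := logSize_eq y
  set Z := logSize y
  set a := Real.log (y 0) with ha
  set b := Real.log (y 1) with hb
  have h4φ : (4 : ℝ) ^ φ = y 1 / y 0 := by
    rw [hφ, show (4 : ℝ) = 2 ^ (2 : ℝ) by norm_num, ← Real.rpow_mul (by norm_num),
      show 2 * (1 / 2 * Real.logb 2 (y 1 / y 0)) = Real.logb 2 (y 1 / y 0) by ring,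
      Real.rpow_logb (by norm_num) (by norm_num) hr]
  -- Here `4^φ ≤ 36`, while `4^{11/4}` has square `2^{11} = 2048 > 36²`.
  have hφb : φ ≤ 11 / 4 := by
    by_contra h
    push Not at h
    have h3 : (4 : ℝ) ^ (11 / 4 : ℝ) < 4 ^ φ := Real.rpow_lt_rpow_of_exponent_lt (by norm_num) h
    have h4 : (4 : ℝ) ^ φ ≤ 36 := by rwa [h4φ, div_le_iff₀ h0]
    have h5 : ((4 : ℝ) ^ (11 / 4 : ℝ)) ^ 2 = 2 ^ 11 := by
      rw [show (4 : ℝ) = 2 ^ (2 : ℝ) by norm_num, ← Real.rpow_mul (by norm_num), ← Real.rpow_natCast,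
        ← Real.rpow_mul (by norm_num), ← Real.rpow_natCast]
      norm_num
    have h6 : (0 : ℝ) < 4 ^ (11 / 4 : ℝ) := by positivity
    nlinarith
  have hφab : |φ| ≤ |a| + |b| := by
    have hl := Real.log_two_gt_d9
    rw [hφ, Real.logb, Real.log_div h1.ne' h0.ne', ← ha, ← hb, div_mul_div_comm, one_mul, abs_div,
      abs_of_pos (by linarith : 0 < 2 * Real.log 2), div_le_iff₀ (by linarith)]
    nlinarith [abs_sub b a, abs_nonneg a, abs_nonneg b]
  have hne0 : (4 : ℝ) ^ (0 : ℝ) ≠ y 1 / y 0 := by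
    rw [Real.rpow_zero]; intro h; exact d0 (by field_simp at h; linarith)
  have hne1 : (4 : ℝ) ^ (1 : ℝ) ≠ y 1 / y 0 := by
    rw [Real.rpow_one]; intro h; exact d1 (by field_simp at h; linarith)
  have hne2 : (4 : ℝ) ^ (2 : ℝ) ≠ y 1 / y 0 := by
    intro h; norm_num at h; exact d2 (by field_simp at h; linarith)
  obtain ⟨n0, l0⟩ := abs_log_sub_le h0 h4φ hφb le_rfl (by norm_num) hne0
  obtain ⟨n1, l1⟩ := abs_log_sub_le h0 h4φ hφb (by norm_num) (by norm_num) hne1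
  obtain ⟨n2, l2⟩ := abs_log_sub_le h0 h4φ hφb (by norm_num) le_rfl hne2
  obtain ⟨n3, l3⟩ := abs_log_sub_le_of_le (k := 3) hφb le_rfl (by norm_num)
  obtain ⟨n4, l4⟩ := abs_log_sub_le_of_le (k := 4) hφb (by norm_num) le_rfl
  norm_num only [Real.rpow_zero, Real.rpow_one, one_mul] at l0 l1 l2
  obtain ⟨hG0, hlG⟩ := abs_log_Gamma_neg_le hφb n0 n1 n2 n3 n4
  obtain ⟨hE0, hlE⟩ := abs_log_sub_two_rpow_le h0 h1 h2 h4φ d1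
  have hq : ∀ x : ℝ, |x| ≤ 1 / 2 + 1 / 2 * x ^ 2 := fun x => by
    nlinarith [sq_abs x, sq_nonneg (|x| - 1)]
  have qa := hq a
  have qb := hq b
  have q0 := hq (Real.log (-y 0 + y 1))
  have q1 := hq (Real.log (-(4 * y 0) + y 1))
  have q2 := hq (Real.log (-(16 * y 0) + y 1))
  have s0 := sq_nonneg (Real.log (-y 0 + y 1))
  have s1 := sq_nonneg (Real.log (-(4 * y 0) + y 1))
  have s2 := sq_nonneg (Real.log (-(16 * y 0) + y 1))
  -- The bound on `log Γ` is quadratic in `φ`, hence in the logarithms of the variations; this is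
  -- why `logSize` is made of squares.
  have hφ2 : (6 + |φ|) ^ 2 ≤ 72 + 4 * (a ^ 2 + b ^ 2) := by
    have e1 : (6 + |φ|) ^ 2 ≤ (6 + (|a| + |b|)) ^ 2 := by gcongr
    rw [← sq_abs a, ← sq_abs b]
    linarith [sq_nonneg (|a| - |b|), sq_nonneg (6 - (|a| + |b|))]
  refine ⟨by linarith [sq_nonneg a, sq_nonneg b], mul_ne_zero (abs_ne_zero.2 hG0) hE0, ?_⟩
  rw [aOne, Real.log_mul (abs_ne_zero.2 hG0) hE0, Real.log_abs]
  refine (abs_add_le _ _).trans ?_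
  linarith [sq_nonneg a, sq_nonneg b]

/-- The logarithms of the moment estimators are controlled by the logarithmic size. -/
theorem exists_abs_log_ratioMap_le {φ₁ : ℝ} (hφ₁ : 0 < φ₁) : ∃ C : ℝ, 0 ≤ C ∧ ∀ y : Fin 2 → ℝ, 0 ≤ y 0 →
    0 ≤ y 1 → y 1 ≤ 36 * y 0 → (∀ j, ∑ a, contrast j a * y a ≠ 0) → ratioMap φ₁ y 0 ≠ 0 ∧
      |Real.log (ratioMap φ₁ y 0)| ≤ C * logSize y ∧ |ratioMap φ₁ y 1| ≤ C * logSize y := by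
  refine ⟨2002 + |Real.log φ₁|, by positivity, fun y h0 h1 h2 hj => ?_⟩
  have c0 : y 0 ≠ 0 := by simpa [contrast] using hj 0
  have c1 : y 1 ≠ 0 := by simpa [contrast] using hj 1
  have c2 : -y 0 + y 1 ≠ 0 := by simpa [contrast] using hj 2
  have c3 : -(4 * y 0) + y 1 ≠ 0 := by simpa [contrast] using hj 3
  have c4 : -(16 * y 0) + y 1 ≠ 0 := by simpa [contrast] using hj 4
  obtain ⟨b1, b2, b3⟩ := abs_log_aOne_le (h0.lt_of_ne' c0) (h1.lt_of_ne' c1) h2 c2 c3 c4 rfl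
  have hZ := one_le_logSize y
  have hZe := logSize_eq y
  have hφ : 0 ≤ |Real.log φ₁| * (logSize y - 1) := mul_nonneg (abs_nonneg _) (by linarith)
  have e0 : ratioMap φ₁ y 0 = y 0 / aOne (1 / 2 * Real.logb 2 (y 1 / y 0)) / φ₁ := rfl
  have e1 : ratioMap φ₁ y 1 = 1 / 2 * Real.logb 2 (y 1 / y 0) := rfl
  rw [e0, e1]
  refine ⟨div_ne_zero (div_ne_zero c0 b2) hφ₁.ne', ?_, ?_⟩
  · rw [Real.log_div (div_ne_zero c0 b2) hφ₁.ne', Real.log_div c0 b2]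
    have ha : |Real.log (y 0)| ≤ logSize y := by
      nlinarith [sq_abs (Real.log (y 0)), sq_nonneg (|Real.log (y 0)| - 1), sq_nonneg (Real.log (y 1)),
        sq_nonneg (Real.log (-y 0 + y 1)), sq_nonneg (Real.log (-(4 * y 0) + y 1)),
        sq_nonneg (Real.log (-(16 * y 0) + y 1))]
    refine (abs_sub _ _).trans ((add_le_add_left (abs_sub _ _) _).trans ?_)
    linarith
  · linarith [mul_nonneg (abs_nonneg (Real.log φ₁)) (by linarith : 0 ≤ logSize y)]

end PowerLaw
end

open scoped ENNReal NNReal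
noncomputable section
namespace PowerLaw

/-! ### Sequences with polynomially bounded expectations -/

/-- The functions `f n`, `n ≥ 8`, are integrable, with integrals at most of the order `n ^ k`. -/
def MomentBdd {Ω : Type*} [MeasurableSpace Ω] (P : Measure Ω) (k : ℕ) (f : ℕ → Ω → ℝ) : Prop :=
  ∃ K : ℝ, 0 ≤ K ∧ ∀ n : ℕ, 8 ≤ n → Integrable (f n) P ∧ ∫ ω, f n ω ∂P ≤ K * (n : ℝ) ^ k

namespace MomentBdd

variable {Ω : Type*} [MeasurableSpace Ω] {P : Measure Ω} {k : ℕ} {f g : ℕ → Ω → ℝ}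

lemma add (hf : MomentBdd P k f) (hg : MomentBdd P k g) : MomentBdd P k fun n ω => f n ω + g n ω := by
  obtain ⟨K, hK0, hK⟩ := hf
  obtain ⟨L, hL0, hL⟩ := hg
  refine ⟨K + L, by positivity, fun n hn => ⟨(hK n hn).1.add (hL n hn).1, ?_⟩⟩
  rw [integral_add (hK n hn).1 (hL n hn).1, add_mul]
  exact add_le_add (hK n hn).2 (hL n hn).2

lemma const_mul (hf : MomentBdd P k f) {c : ℝ} (hc : 0 ≤ c) : MomentBdd P k fun n ω => c * f n ω := by
  obtain ⟨K, hK0, hK⟩ := hf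
  refine ⟨c * K, by positivity, fun n hn => ⟨(hK n hn).1.const_mul c, ?_⟩⟩
  rw [integral_const_mul, mul_assoc]
  exact mul_le_mul_of_nonneg_left (hK n hn).2 hc

lemma sum {ι : Type*} {s : Finset ι} {F : ι → ℕ → Ω → ℝ} (hF : ∀ i ∈ s, MomentBdd P k (F i)) :
    MomentBdd P k fun n ω => ∑ i ∈ s, F i n ω := by
  classical
  induction s using Finset.induction_on with
  | empty => exact ⟨0, le_rfl, fun n _ => by simp⟩
  | insert i s hi ih =>
    simp only [Finset.sum_insert hi]
    exact (hF i (Finset.mem_insert_self i s)).add (ih fun j hj => hF j (Finset.mem_insert_of_mem hj))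

lemma const [IsProbabilityMeasure P] (c : ℝ) : MomentBdd P k fun _ _ => c := by
  refine ⟨|c|, abs_nonneg c, fun n hn => ⟨integrable_const c, ?_⟩⟩
  have hn1 : (1 : ℝ) ≤ n := by
    have : 1 ≤ n := by omega
    exact_mod_cast this
  simp only [integral_const, probReal_univ, smul_eq_mul, one_mul]
  exact (le_abs_self c).trans (le_mul_of_one_le_right (abs_nonneg c) (one_le_pow₀ hn1))

lemma mono (hg : MomentBdd P k g) (hf : ∀ n, 8 ≤ n → AEMeasurable (f n) P) (hf0 : ∀ n ω, 0 ≤ f n ω)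
    (hfg : ∀ n, 8 ≤ n → ∀ᵐ ω ∂P, f n ω ≤ g n ω) : MomentBdd P k f := by
  obtain ⟨K, hK0, hK⟩ := hg
  have hi : ∀ n, 8 ≤ n → Integrable (f n) P := fun n hn => by
    refine (hK n hn).1.mono' (hf n hn).aestronglyMeasurable ?_
    filter_upwards [hfg n hn] with ω hω
    rwa [Real.norm_of_nonneg (hf0 n ω)]
  exact ⟨K, hK0, fun n hn =>
    ⟨hi n hn, (integral_mono_ae (hi n hn) (hK n hn).1 (hfg n hn)).trans (hK n hn).2⟩⟩

lemma of_zero (hf : MomentBdd P 0 f) (k : ℕ) : MomentBdd P k f := by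
  obtain ⟨K, hK0, hK⟩ := hf
  refine ⟨K, hK0, fun n hn => ⟨(hK n hn).1, (hK n hn).2.trans ?_⟩⟩
  have hn1 : (1 : ℝ) ≤ n := by
    have : 1 ≤ n := by omega
    exact_mod_cast this
  rw [pow_zero]
  exact mul_le_mul_of_nonneg_left (one_le_pow₀ hn1) hK0

lemma div_pow (hf : MomentBdd P k f) : MomentBdd P 0 fun n ω => f n ω / (n : ℝ) ^ k := by
  obtain ⟨K, hK0, hK⟩ := hf
  refine ⟨K, hK0, fun n hn => ⟨(hK n hn).1.div_const _, ?_⟩⟩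
  have hn1 : (0 : ℝ) < n := by
    have : 0 < n := by omega
    exact_mod_cast this
  rw [integral_div, div_le_iff₀ (by positivity), pow_zero, mul_one]
  exact (hK n hn).2

lemma of_lintegral {K : ℝ≥0} (hf : ∀ n, 8 ≤ n → AEMeasurable (f n) P) (hf0 : ∀ n ω, 0 ≤ f n ω)
    (h : ∀ n : ℕ, 8 ≤ n → ∫⁻ ω, ENNReal.ofReal (f n ω) ∂P ≤ K * (n : ℝ≥0∞) ^ k) : MomentBdd P k f := by
  refine ⟨K, K.2, fun n hn => ?_⟩
  have hlt : (K : ℝ≥0∞) * (n : ℝ≥0∞) ^ k = ENNReal.ofReal (K * (n : ℝ) ^ k) := by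
    rw [ENNReal.ofReal_mul NNReal.zero_le_coe, ENNReal.ofReal_pow (by positivity), ENNReal.ofReal_natCast,
      ENNReal.ofReal_coe_nnreal]
  have h1 := h n hn
  rw [hlt] at h1
  refine ⟨⟨(hf n hn).aestronglyMeasurable, ?_⟩, ?_⟩
  · rw [hasFiniteIntegral_iff_ofReal (ae_of_all _ (hf0 n))]
    exact h1.trans_lt ENNReal.ofReal_lt_top
  · rw [integral_eq_lintegral_of_nonneg_ae (ae_of_all _ (hf0 n)) (hf n hn).aestronglyMeasurable]
    exact ENNReal.toReal_le_of_le_ofReal (by positivity) h1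

end MomentBdd

/-! ### Moments of the logarithmic size -/

/-- From `log t ≤ t^α / α`, with `α = 1/8` for `t ≥ 1` and with `α = 1/32` at `t⁻¹` for `t ≤ 1`; the
latter yields the negative power `1/4` available for quadratic forms. -/
lemma log_pow_eight_le {x : ℝ} (hx : x ≠ 0) :
    Real.log x ^ 8 ≤ 32 ^ 8 * (|x| ^ (-(1 / 4) : ℝ) + |x|) := by
  have ht := abs_pos.2 hx
  rw [← Real.log_abs]
  set t := |x|
  have hp : 0 < t ^ (-(1 / 4) : ℝ) := Real.rpow_pos_of_pos ht _
  rcases le_total 0 (Real.log t) with h | h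
  · have h1 : Real.log t ^ 8 ≤ (t ^ (1 / 8 : ℝ) / (1 / 8)) ^ 8 :=
      pow_le_pow_left₀ h (Real.log_le_rpow_div ht.le (by norm_num)) 8
    have h2 : (t ^ (1 / 8 : ℝ)) ^ 8 = t := by
      rw [← Real.rpow_natCast, ← Real.rpow_mul ht.le]; norm_num
    rw [div_pow, h2] at h1
    norm_num at h1 ⊢
    linarith
  · have h0 : 0 ≤ -Real.log t := by linarith
    have h3 := Real.log_le_rpow_div (inv_nonneg.2 ht.le) (by norm_num : (0 : ℝ) < 1 / 32)
    rw [Real.log_inv] at h3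
    have h1 := pow_le_pow_left₀ h0 h3 8
    have h2 : (t⁻¹ ^ (1 / 32 : ℝ)) ^ 8 = t ^ (-(1 / 4) : ℝ) := by
      rw [← Real.rpow_natCast, ← Real.rpow_mul (inv_nonneg.2 ht.le), Real.inv_rpow ht.le,
        Real.rpow_neg ht.le]
      norm_num
    rw [div_pow, h2, Even.neg_pow (by decide)] at h1
    norm_num at h1 ⊢
    linarith

/-- With `S = ∑ F_j`: `(1 + S)⁴ ≤ 8 (1 + S⁴)` and `S⁴ ≤ 5³ ∑ F_j⁴`, whence `1000 = 8 · 125`. -/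
lemma logSize_pow_four_le (y : Fin 2 → ℝ) :
    logSize y ^ 4 ≤ 8 + 1000 * ∑ j, Real.log (∑ a, contrast j a * y a) ^ 8 := by
  rw [logSize]
  set F : Fin 5 → ℝ := fun j => Real.log (∑ a, contrast j a * y a) ^ 2
  have h0 : ∀ j ∈ Finset.univ, 0 ≤ F j := fun j _ => sq_nonneg _
  have h1 := pow_sum_div_card_le_sum_pow h0 3
  have h2 := add_pow_le (zero_le_one' ℝ) (Finset.sum_nonneg h0) 4
  have h3 : ∑ j, F j ^ (3 + 1) = ∑ j, Real.log (∑ a, contrast j a * y a) ^ 8 :=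
    Finset.sum_congr rfl fun j _ => by simp only [F]; ring
  rw [h3, div_le_iff₀ (by simp), Finset.card_univ, Fintype.card_fin] at h1
  norm_num only [one_pow] at h1 h2
  linarith

lemma measurable_logSize : Measurable logSize := by
  unfold logSize; fun_prop

lemma abs_contrast_le (j : Fin 5) (a : Fin 2) : |contrast j a| ≤ 16 := by
  fin_cases j <;> fin_cases a <;> (simp [contrast]; try norm_num)

section Law

variable {φ₁ φ₂ : ℝ} {Ω : Type*} {X : Plane → Ω → ℝ}
variable [MeasurableSpace Ω] {P : Measure Ω} [IsProbabilityMeasure P]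
  (hφ₁ : 0 < φ₁) (hφ₂ : 0 < φ₂) (hφ₂' : φ₂ < 1) (hX : IsPowerLawField φ₁ φ₂ unitSquare X P)

include hφ₁ hφ₂ hφ₂'

/-- At the mean `q₂ / q₁ = 4^φ₂` lies strictly between `1` and `4`, away from the critical ratios
`1`, `4` and `16`. -/
lemma sum_contrast_mul_meanVec_ne_zero (j : Fin 5) : ∑ a, contrast j a * meanVec φ₁ φ₂ a ≠ 0 := by
  have h0 := meanVec_zero_pos hφ₁ hφ₂ hφ₂'
  have h := meanVec_one_div hφ₁ hφ₂ hφ₂'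
  rw [div_eq_iff h0.ne'] at h
  have h1 : (1 : ℝ) < 4 ^ φ₂ := Real.one_lt_rpow (by norm_num) hφ₂
  have h2 : (4 : ℝ) ^ φ₂ < 4 := by
    have := Real.rpow_lt_rpow_of_exponent_lt (x := 4) (by norm_num) hφ₂'
    rwa [Real.rpow_one] at this
  rw [Fin.sum_univ_two, h]
  fin_cases j <;> simp [contrast] <;> first | (constructor <;> linarith) | linarith | nlinarith

include hX

lemma momentBdd_exp : ∃ s : ℝ, 0 < s ∧ ∀ a, MomentBdd P 0 fun n ω =>
    Real.exp (s * |n * (normQV φ₂ X n a ω - meanVec φ₁ φ₂ a)|) := by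
  obtain ⟨s, hs, B, hB⟩ := exists_integral_exp_normQV_le hφ₁ hφ₂ hφ₂' hX
  refine ⟨s, hs, fun a => ⟨|B|, abs_nonneg B, fun n hn => ?_⟩⟩
  obtain ⟨h1, h2⟩ := hB n (by omega) a
  exact ⟨h1, by simpa using h2.trans (le_abs_self B)⟩

/-- Eighth powers of the logarithms are bounded by a negative and a positive moment of each form;
the growth `n²` comes from the negative ones. -/
lemma momentBdd_logSize_pow_four : MomentBdd P 2 fun n ω => logSize (fun a => normQV φ₂ X n a ω) ^ 4 := by
  obtain ⟨s, hs, hE⟩ := momentBdd_exp hφ₁ hφ₂ hφ₂' hX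
  have hm := aemeasurable_normQV hφ₁ hφ₂ hφ₂' hX
  have hj : ∀ j : Fin 5, MomentBdd P 2 fun n ω =>
      |∑ a, contrast j a * normQV φ₂ X n a ω| ^ (-(1 / 4) : ℝ) := fun j => by
    obtain ⟨K, hK⟩ := exists_lintegral_rpow_normQV_le hφ₁ hφ₂ hφ₂' hX (contrast j)
      (sum_contrast_mul_meanVec_ne_zero hφ₁ hφ₂ hφ₂' j)
    refine MomentBdd.of_lintegral (K := K) (fun n _ => ?_) (fun n ω => by positivity)
      fun n hn => hK n (by omega)
    have := hm n
    fun_prop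
  have hQ : MomentBdd P 2 fun n ω => ∑ a, (|meanVec φ₁ φ₂ a| +
      s⁻¹ * Real.exp (s * |n * (normQV φ₂ X n a ω - meanVec φ₁ φ₂ a)|)) :=
    MomentBdd.sum fun a _ => (MomentBdd.const _).add (((hE a).of_zero 2).const_mul (inv_nonneg.2 hs.le))
  have hdom := (MomentBdd.const (P := P) (k := 2) 8).add ((MomentBdd.sum (s := Finset.univ) fun j _ =>
    ((hj j).add (hQ.const_mul (by norm_num : (0 : ℝ) ≤ 16))).const_mul
      (by norm_num : (0 : ℝ) ≤ 32 ^ 8)).const_mul (by norm_num : (0 : ℝ) ≤ 1000))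
  refine hdom.mono (fun n _ => ?_) (fun n ω => by positivity) fun n hn => ?_
  · exact (measurable_logSize.comp_aemeasurable (aemeasurable_pi_lambda _ fun a => hm n a)).pow_const 4
  · have hne := ae_all_iff.2 fun j => ae_sum_normQV_ne_zero hφ₁ hφ₂ hφ₂' hX (contrast j)
      (sum_contrast_mul_meanVec_ne_zero hφ₁ hφ₂ hφ₂' j) (by omega : 5 ≤ n)
    have hn1 : (1 : ℝ) ≤ n := by
      have : 1 ≤ n := by omega
      exact_mod_cast this
    filter_upwards [hne] with ω hω
    refine (logSize_pow_four_le _).trans ?_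
    gcongr with j
    refine (log_pow_eight_le (hω j)).trans ?_
    gcongr
    refine (Finset.abs_sum_le_sum_abs _ _).trans ?_
    rw [Finset.mul_sum]
    refine Finset.sum_le_sum fun a _ => ?_
    rw [abs_mul]
    refine mul_le_mul (abs_contrast_le j a) ?_ (abs_nonneg _) (by norm_num)
    have h1 : |normQV φ₂ X n a ω - meanVec φ₁ φ₂ a| ≤
        |n * (normQV φ₂ X n a ω - meanVec φ₁ φ₂ a)| := by
      rw [abs_mul, Nat.abs_cast]
      exact le_mul_of_one_le_left (abs_nonneg _) hn1
    have h2 := Real.add_one_le_exp (s * |n * (normQV φ₂ X n a ω - meanVec φ₁ φ₂ a)|)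
    have h3 : |n * (normQV φ₂ X n a ω - meanVec φ₁ φ₂ a)| ≤
        s⁻¹ * Real.exp (s * |n * (normQV φ₂ X n a ω - meanVec φ₁ φ₂ a)|) := by
      rw [inv_mul_eq_div, le_div_iff₀ hs]
      linarith
    have h4 := abs_sub_abs_le_abs_sub (normQV φ₂ X n a ω) (meanVec φ₁ φ₂ a)
    linarith

end Law

end PowerLaw
end

/-! ### Second moments of the log ratio and of the roughness estimator -/

open scoped ENNReal NNReal
noncomputable section
namespace PowerLaw

variable {φ₁ φ₂ : ℝ}

lemma exists_abs_log_ratioMap_le_sum (hφ₁ : 0 < φ₁) (hφ₂ : 0 < φ₂) (hφ₂' : φ₂ < 1) :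
    ∃ ε : ℝ, 0 < ε ∧ ∃ C : ℝ, 0 ≤ C ∧ ∀ y : Fin 2 → ℝ, (∀ a, |y a - meanVec φ₁ φ₂ a| ≤ ε) →
      |Real.log (ratioMap φ₁ y 0)| ≤ C * ∑ a, |y a - meanVec φ₁ φ₂ a| := by
  have hq : ratioMap φ₁ (meanVec φ₁ φ₂) 0 = 1 := by rw [ratioMap_meanVec hφ₁ hφ₂ hφ₂']; rfl
  have hd : DifferentiableAt ℝ (fun y => Real.log (ratioMap φ₁ y 0)) (meanVec φ₁ φ₂) := by
    refine DifferentiableAt.log ?_ (by rw [hq]; exact one_ne_zero)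
    have := differentiableAt_pi.1 (differentiableAt_momentMap hφ₁ hφ₂ hφ₂') 0
    simp only [ratioMap, Matrix.cons_val_zero, div_eq_mul_inv]
    exact this.mul_const _
  obtain ⟨C, hC0, hC⟩ := hd.isBigO_sub.exists_nonneg
  obtain ⟨ε, hε, h⟩ := Metric.eventually_nhds_iff_ball.1 hC.bound
  refine ⟨ε / 2, by positivity, C, hC0, fun y hy => ?_⟩
  have hn : ‖y - meanVec φ₁ φ₂‖ ≤ ∑ a, |y a - meanVec φ₁ φ₂ a| := by
    rw [pi_norm_le_iff_of_nonneg (Finset.sum_nonneg fun _ _ => abs_nonneg _)]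
    exact fun a => Finset.single_le_sum (f := fun a => |y a - meanVec φ₁ φ₂ a|)
      (fun _ _ => abs_nonneg _) (Finset.mem_univ a)
  have hyb : y ∈ Metric.ball (meanVec φ₁ φ₂) ε := by
    rw [mem_ball_iff_norm]
    refine lt_of_le_of_lt ?_ (half_lt_self hε)
    rw [pi_norm_le_iff_of_nonneg (by positivity)]
    exact hy
  have h2 := h y hyb
  rw [hq, Real.log_one, sub_zero, Real.norm_eq_abs] at h2
  exact h2.trans (mul_le_mul_of_nonneg_left hn hC0)

section Law

variable {Ω : Type*} {X : Plane → Ω → ℝ}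
variable [MeasurableSpace Ω] {P : Measure Ω} [IsProbabilityMeasure P]
  (hφ₁ : 0 < φ₁) (hφ₂ : 0 < φ₂) (hφ₂' : φ₂ < 1) (hX : IsPowerLawField φ₁ φ₂ unitSquare X P)

include hφ₁ hφ₂ hφ₂' hX

lemma aemeasurable_ratioMap (n : ℕ) (i : Fin 2) :
    AEMeasurable (fun ω => ratioMap φ₁ (fun a => normQV φ₂ X n a ω) i) P :=
  (measurable_pi_iff.1 measurable_ratioMap i).comp_aemeasurable
    (aemeasurable_pi_lambda _ fun a => aemeasurable_normQV hφ₁ hφ₂ hφ₂' hX n a)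

lemma exists_ae_abs_log_ratioMap_le : ∃ C : ℝ, 0 ≤ C ∧ ∀ n : ℕ, 8 ≤ n → ∀ᵐ ω ∂P,
    ratioMap φ₁ (fun a => normQV φ₂ X n a ω) 0 ≠ 0 ∧
    |Real.log (ratioMap φ₁ (fun a => normQV φ₂ X n a ω) 0)| ≤
      C * logSize (fun a => normQV φ₂ X n a ω) ∧
    |ratioMap φ₁ (fun a => normQV φ₂ X n a ω) 1| ≤ C * logSize (fun a => normQV φ₂ X n a ω) := by
  obtain ⟨C, hC0, hC⟩ := exists_abs_log_ratioMap_le hφ₁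
  refine ⟨C, hC0, fun n hn => ?_⟩
  have hne := ae_all_iff.2 fun j => ae_sum_normQV_ne_zero hφ₁ hφ₂ hφ₂' hX (contrast j)
    (sum_contrast_mul_meanVec_ne_zero hφ₁ hφ₂ hφ₂' j) (by omega : 5 ≤ n)
  filter_upwards [hne] with ω hω
  exact hC _ (normQV_nonneg n 0 ω) (normQV_nonneg n 1 ω) (normQV_one_le hn ω) hω

lemma memLp_logSize {n : ℕ} (hn : 8 ≤ n) : MemLp (fun ω => logSize fun a => normQV φ₂ X n a ω) 2 P := by
  obtain ⟨K, -, hK⟩ := momentBdd_logSize_pow_four hφ₁ hφ₂ hφ₂' hX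
  have hm : AEMeasurable (fun ω => logSize fun a => normQV φ₂ X n a ω) P :=
    measurable_logSize.comp_aemeasurable
      (aemeasurable_pi_lambda _ fun a => aemeasurable_normQV hφ₁ hφ₂ hφ₂' hX n a)
  rw [memLp_two_iff_integrable_sq hm.aestronglyMeasurable]
  refine (hK n hn).1.mono' (hm.pow_const 2).aestronglyMeasurable (ae_of_all _ fun ω => ?_)
  rw [Real.norm_of_nonneg (sq_nonneg _)]
  exact pow_le_pow_right₀ (one_le_logSize _) (by norm_num)

lemma memLp_log_ratioMap {n : ℕ} (hn : 8 ≤ n) :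
    MemLp (fun ω => Real.log (ratioMap φ₁ (fun a => normQV φ₂ X n a ω) 0)) 2 P := by
  obtain ⟨C, hC0, hC⟩ := exists_ae_abs_log_ratioMap_le hφ₁ hφ₂ hφ₂' hX
  refine ((memLp_logSize hφ₁ hφ₂ hφ₂' hX hn).const_mul C).mono
    (Real.measurable_log.comp_aemeasurable
      (aemeasurable_ratioMap hφ₁ hφ₂ hφ₂' hX n 0)).aestronglyMeasurable ?_
  filter_upwards [hC n hn] with ω hω
  exact hω.2.1.trans (le_abs_self _)

lemma memLp_ratioMap_one {n : ℕ} (hn : 8 ≤ n) :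
    MemLp (fun ω => ratioMap φ₁ (fun a => normQV φ₂ X n a ω) 1) 2 P := by
  obtain ⟨C, hC0, hC⟩ := exists_ae_abs_log_ratioMap_le hφ₁ hφ₂ hφ₂' hX
  refine ((memLp_logSize hφ₁ hφ₂ hφ₂' hX hn).const_mul C).mono
    (aemeasurable_ratioMap hφ₁ hφ₂ hφ₂' hX n 1).aestronglyMeasurable ?_
  filter_upwards [hC n hn] with ω hω
  exact hω.2.2.trans (le_abs_self _)

lemma memLp_roughEst {n : ℕ} (hn : 8 ≤ n) :
    MemLp (fun ω => roughEst n (sample ((n : ℝ)⁻¹) X ω)) 2 P := by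
  have h := memLp_ratioMap_one hφ₁ hφ₂ hφ₂' hX hn
  simp only [← ratioMap_normQV (by omega : n ≠ 0)] at h
  exact h

/-- Near the mean the logarithm `R` is at most linear in `Q - q`, and `n (Q - q)` has bounded
exponential moments. Away from the mean some `n |Q - q|` exceeds `n ε`, so `n⁶` is dominated by an
exponential; with `2 (n R)² ≤ n⁶ + R⁴ / n²` and a bound of order `n²` for the fourth moment of the
dominating `logSize`, this region contributes a bounded amount. -/
lemma momentBdd_sq_log_ratioMap : MomentBdd P 0 fun n ω =>
    (n * Real.log (ratioMap φ₁ (fun a => normQV φ₂ X n a ω) 0)) ^ 2 := by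
  obtain ⟨ε, hε, C, hC0, hC⟩ := exists_abs_log_ratioMap_le_sum hφ₁ hφ₂ hφ₂'
  obtain ⟨D, hD0, hD⟩ := exists_ae_abs_log_ratioMap_le hφ₁ hφ₂ hφ₂' hX
  obtain ⟨s, hs, hE⟩ := momentBdd_exp hφ₁ hφ₂ hφ₂' hX
  have hZ := (momentBdd_logSize_pow_four hφ₁ hφ₂ hφ₂' hX).div_pow
  have hS := MomentBdd.sum (s := Finset.univ) fun a _ => hE a
  -- The constants come from `x^k / k! ≤ e^x` with `k = 2` near the mean and `k = 6`, `6! = 720`,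
  -- away from it.
  have hdom := (hS.const_mul (c := 4 * C ^ 2 / s ^ 2 + 720 / (s * ε) ^ 6) (by positivity)).add
    (hZ.const_mul (c := D ^ 4) (by positivity))
  refine hdom.mono (fun n _ => ?_) (fun n ω => sq_nonneg _) fun n hn => ?_
  · have := aemeasurable_ratioMap hφ₁ hφ₂ hφ₂' hX n 0
    fun_prop
  have hn0 : (0 : ℝ) < n := by
    have : 0 < n := by omega
    exact_mod_cast this
  filter_upwards [hD n hn] with ω hω
  set R := Real.log (ratioMap φ₁ (fun a => normQV φ₂ X n a ω) 0)
  set Z := logSize fun a => normQV φ₂ X n a ω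
  set u : Fin 2 → ℝ := fun a => |n * (normQV φ₂ X n a ω - meanVec φ₁ φ₂ a)| with hu
  have hE0 : ∀ a, 0 ≤ Real.exp (s * u a) := fun a => (Real.exp_pos _).le
  have hS0 : 0 ≤ ∑ a, Real.exp (s * u a) := Finset.sum_nonneg fun a _ => hE0 a
  have hZ0 : 0 ≤ D ^ 4 * (Z ^ 4 / (n : ℝ) ^ 2) := by positivity
  by_cases hgood : ∀ a, |normQV φ₂ X n a ω - meanVec φ₁ φ₂ a| ≤ ε
  · have h1 := hC _ hgood
    have h2 : |n * R| ≤ C * ∑ a, u a := by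
      simp only [hu, abs_mul, Nat.abs_cast, ← Finset.mul_sum]
      calc (n : ℝ) * |R| ≤ n * (C * ∑ a, |normQV φ₂ X n a ω - meanVec φ₁ φ₂ a|) := by gcongr
        _ = _ := by ring
    have h3 : ∀ a, u a ^ 2 ≤ 2 / s ^ 2 * Real.exp (s * u a) := fun a => by
      have h4 := Real.pow_div_factorial_le_exp (x := s * u a) (by positivity) 2
      rw [div_mul_eq_mul_div, le_div_iff₀ (by positivity)]
      simp only [Nat.factorial] at h4
      norm_num at h4
      linarith [mul_pow s (u a) 2]
    have h5 : (n * R) ^ 2 ≤ 4 * C ^ 2 / s ^ 2 * ∑ a, Real.exp (s * u a) := by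
      calc (n * R) ^ 2 = |n * R| ^ 2 := (sq_abs _).symm
        _ ≤ (C * ∑ a, u a) ^ 2 := pow_le_pow_left₀ (abs_nonneg _) h2 2
        _ = C ^ 2 * (u 0 + u 1) ^ 2 := by rw [mul_pow, Fin.sum_univ_two]
        _ ≤ C ^ 2 * (2 * (2 / s ^ 2 * Real.exp (s * u 0) + 2 / s ^ 2 * Real.exp (s * u 1))) := by
            gcongr
            linarith [h3 0, h3 1, sq_nonneg (u 0 - u 1)]
        _ = _ := by rw [Fin.sum_univ_two]; ring
    have h6 : 0 ≤ 720 / (s * ε) ^ 6 * ∑ a, Real.exp (s * u a) := by positivity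
    rw [add_mul]
    linarith
  · push Not at hgood
    obtain ⟨a, ha⟩ := hgood
    have h1 : (n : ℝ) ^ 6 ≤ 720 / (s * ε) ^ 6 * ∑ a, Real.exp (s * u a) := by
      have h2 : n * ε ≤ u a := by
        simp only [hu, abs_mul, Nat.abs_cast]
        gcongr
      have h3 := Real.pow_div_factorial_le_exp (x := s * (n * ε)) (by positivity) 6
      have h4 : Real.exp (s * (n * ε)) ≤ ∑ a, Real.exp (s * u a) :=
        (Real.exp_le_exp.2 (mul_le_mul_of_nonneg_left h2 hs.le)).trans
          (Finset.single_le_sum (f := fun a => Real.exp (s * u a)) (fun a _ => hE0 a)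
            (Finset.mem_univ a))
      rw [div_mul_eq_mul_div, le_div_iff₀ (by positivity)]
      simp only [Nat.factorial] at h3
      norm_num at h3
      have h5 : (s * (n * ε)) ^ 6 = (n : ℝ) ^ 6 * (s * ε) ^ 6 := by ring
      linarith
    have h2 : R ^ 4 ≤ D ^ 4 * Z ^ 4 := by
      rw [← mul_pow, ← Even.pow_abs (by decide : Even 4) R]
      exact pow_le_pow_left₀ (abs_nonneg _) hω.2.1 4
    have h3 : (n * R) ^ 2 ≤ (n : ℝ) ^ 6 + R ^ 4 / (n : ℝ) ^ 2 := by
      have e : (n : ℝ) ^ 6 + R ^ 4 / (n : ℝ) ^ 2 - 2 * (n * R) ^ 2 = ((n : ℝ) ^ 3 - R ^ 2 / n) ^ 2 := by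
        field_simp
        ring
      linarith [sq_nonneg ((n : ℝ) ^ 3 - R ^ 2 / n), sq_nonneg (n * R)]
    have h4 : R ^ 4 / (n : ℝ) ^ 2 ≤ D ^ 4 * (Z ^ 4 / (n : ℝ) ^ 2) := by
      rw [mul_div_assoc']
      gcongr
    have h6 : 0 ≤ 4 * C ^ 2 / s ^ 2 * ∑ a, Real.exp (s * u a) := by positivity
    rw [add_mul]
    linarith

/-- Weak convergence alone still bounds the variance below: the Gaussian limit charges both `(1, ∞)`
and `(-∞, -1)`, and, whatever the sign of the mean, one of these events forces a deviation of at
least `1` from it, so Chebyshev's inequality applies. -/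
lemma exists_le_variance_roughEst : ∃ c : ℝ, 0 < c ∧ ∀ᶠ n : ℕ in atTop,
    c ≤ (n : ℝ) ^ 2 * Var[fun ω => roughEst n (sample ((n : ℝ)⁻¹) X ω); P] := by
  have hlim := tendstoInDistribution_roughEst hφ₁ hφ₂ hφ₂' hX
  set v := (limitCov φ₁ φ₂ 1 1).toNNReal
  have hv : v ≠ 0 := (Real.toNNReal_pos.2 (limitCov_one_one_pos hφ₁ hφ₂ hφ₂')).ne'
  have hopen : ∀ U : Set ℝ, IsOpen U → U.Nonempty → ∃ c : ℝ, 0 < c ∧ ∀ᶠ n : ℕ in atTop,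
      ENNReal.ofReal c ≤ P {ω | (n : ℝ) * (roughEst n (sample ((n : ℝ)⁻¹) X ω) - φ₂) ∈ U} := by
    intro U hU hne
    have hpos : gaussianReal 0 v U ≠ 0 := fun h =>
      (hU.measure_pos volume hne).ne' (gaussianReal_absolutelyContinuous' 0 hv h)
    have h1 := ProbabilityMeasure.le_liminf_measure_open_of_tendsto hlim.tendsto hU
    simp only [ProbabilityMeasure.coe_mk, Measure.map_id] at h1
    obtain ⟨c, hc0, hc⟩ := ENNReal.lt_iff_exists_nnreal_btwn.1 (pos_iff_ne_zero.2 hpos)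
    refine ⟨c, by exact_mod_cast hc0, (eventually_lt_of_lt_liminf (hc.trans_le h1)).mono fun n hn => ?_⟩
    rw [ENNReal.ofReal_coe_nnreal]
    rw [Measure.map_apply_of_aemeasurable (hlim.forall_aemeasurable n) hU.measurableSet] at hn
    exact hn.le
  obtain ⟨c1, hc1, h1⟩ := hopen (Set.Ioi 1) isOpen_Ioi ⟨2, by norm_num⟩
  obtain ⟨c2, hc2, h2⟩ := hopen (Set.Iio (-1)) isOpen_Iio ⟨-2, by norm_num⟩
  refine ⟨min c1 c2, lt_min hc1 hc2, ?_⟩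
  filter_upwards [h1, h2, eventually_ge_atTop 8] with n hn1 hn2 hn
  set Y : Ω → ℝ := fun ω => (n : ℝ) * (roughEst n (sample ((n : ℝ)⁻¹) X ω) - φ₂) with hY
  have hT := memLp_roughEst hφ₁ hφ₂ hφ₂' hX hn
  have hYL : MemLp Y 2 P := (hT.sub (memLp_const φ₂)).const_mul (n : ℝ)
  have hvar : Var[Y; P] = (n : ℝ) ^ 2 * Var[fun ω => roughEst n (sample ((n : ℝ)⁻¹) X ω); P] := by
    rw [hY, variance_const_mul, variance_sub_const hT.aestronglyMeasurable]
  have hch := meas_ge_le_variance_div_sq hYL one_pos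
  rw [one_pow, div_one, hvar] at hch
  have hfin : ∀ c, ENNReal.ofReal c ≤ P {ω | 1 ≤ |Y ω - P[Y]|} →
      c ≤ (n : ℝ) ^ 2 * Var[fun ω => roughEst n (sample ((n : ℝ)⁻¹) X ω); P] := fun c hc =>
    (ENNReal.ofReal_le_ofReal_iff (mul_nonneg (by positivity) (variance_nonneg _ _))).1 (hc.trans hch)
  rcases le_total P[Y] 0 with hm | hm
  · refine (min_le_left _ _).trans (hfin c1 (hn1.trans (measure_mono fun ω hω => ?_)))
    have h3 : 1 < Y ω := hω
    exact (by linarith : 1 ≤ Y ω - P[Y]).trans (le_abs_self _)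
  · refine (min_le_right _ _).trans (hfin c2 (hn2.trans (measure_mono fun ω hω => ?_)))
    have h3 : Y ω < -1 := hω
    exact (by linarith : 1 ≤ -(Y ω - P[Y])).trans (neg_le_abs _)

end Law

end PowerLaw
end

noncomputable section
namespace PowerLaw

/-! ### Correlation with a dominating component -/

section Corr

variable {Ω : Type*} [MeasurableSpace Ω] {P : Measure Ω} [IsProbabilityMeasure P] {V R : Ω → ℝ}

/-- Cauchy–Schwarz, from the discriminant of `t ↦ Var[t V + R]`. -/
lemma abs_covariance_le (hV : MemLp V 2 P) (hR : MemLp R 2 P) :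
    |cov[V, R; P]| ≤ √Var[V; P] * √Var[R; P] := by
  have h : ∀ t : ℝ, 0 ≤ Var[V; P] * (t * t) + 2 * cov[V, R; P] * t + Var[R; P] := fun t => by
    have h1 := variance_fun_add (hV.const_mul t) hR
    rw [variance_const_mul, covariance_const_mul_left] at h1
    have h2 := variance_nonneg (fun ω => t * V ω + R ω) P
    linarith
  have h1 := discrim_le_zero h
  rw [discrim] at h1
  rw [← Real.sqrt_mul (variance_nonneg V P)]
  refine Real.abs_le_sqrt ?_
  linarith

lemma corr_le_one (hV : MemLp V 2 P) (hR : MemLp R 2 P) : corr V R P ≤ 1 :=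
  div_le_one_of_le₀ ((le_abs_self _).trans (abs_covariance_le hV hR)) (by positivity)

/-- A variable dominated by a multiple of `V` has correlation with `V` close to one. -/
lemma one_sub_le_corr (hV : MemLp V 2 P) (hR : MemLp R 2 P) {L : ℝ} (hL : 0 < L)
    (hv : 0 < √Var[V; P]) (hr : √Var[R; P] < L * √Var[V; P]) :
    1 - 2 * √Var[R; P] / (L * √Var[V; P]) ≤ corr (fun ω => L * V ω + R ω) V P := by
  have hLV := hV.const_mul L
  have hU : MemLp (fun ω => L * V ω + R ω) 2 P := hLV.add hR
  have hRV := abs_le.1 (abs_covariance_le hR hV)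
  have hcov : cov[fun ω => L * V ω + R ω, V; P] = L * √Var[V; P] ^ 2 + cov[R, V; P] := by
    have h1 := covariance_add_left hLV hR hV
    rw [covariance_const_mul_left, covariance_self hV.aemeasurable] at h1
    rw [Real.sq_sqrt (variance_nonneg V P)]
    exact h1
  have hvar : √Var[fun ω => L * V ω + R ω; P] ≤ L * √Var[V; P] + √Var[R; P] := by
    refine Real.sqrt_le_iff.2 ⟨by positivity, ?_⟩
    rw [variance_fun_add hLV hR, variance_const_mul, covariance_const_mul_left, covariance_comm]
    have h1 := Real.sq_sqrt (variance_nonneg V P)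
    have h2 := Real.sq_sqrt (variance_nonneg R P)
    nlinarith [hRV.2]
  have hpos : 0 < cov[fun ω => L * V ω + R ω, V; P] := by
    rw [hcov]; nlinarith [hRV.1]
  have hu : 0 < √Var[fun ω => L * V ω + R ω; P] := by
    have h1 := hpos.trans_le ((le_abs_self _).trans (abs_covariance_le hU hV))
    exact pos_of_mul_pos_left h1 hv.le
  have hr0 := Real.sqrt_nonneg Var[R; P]
  set v := √Var[V; P]
  set r := √Var[R; P]
  set u := √Var[fun ω => L * V ω + R ω; P]
  have hLv : 0 < L * v := by positivity
  -- The covariance is at least `v (L v - r)` and the standard deviation of `L V + R` at most `L v +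
  -- r`; the resulting quotient is `1 - 2 r / (L v + r)`.
  have e1 : 1 - 2 * r / (L * v) ≤ (L * v - r) / (L * v + r) := by
    rw [le_div_iff₀ (by positivity), sub_mul, div_mul_eq_mul_div, sub_le_iff_le_add, one_mul,
      ← sub_le_iff_le_add', le_div_iff₀ hLv]
    nlinarith
  have e2 : (L * v - r) / (L * v + r) ≤ (L * v - r) / u :=
    div_le_div_of_nonneg_left (by linarith) hu hvar
  refine (e1.trans e2).trans ?_
  rw [corr, hcov, div_le_div_iff₀ hu (by positivity)]
  nlinarith [hRV.1, mul_nonneg hu.le (by linarith [hRV.1] : 0 ≤ cov[R, V; P] + r * v)]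

omit [IsProbabilityMeasure P] in
lemma corr_congr_left {U U' : Ω → ℝ} (h : U =ᵐ[P] U') : corr U V P = corr U' V P := by
  have h1 : cov[U, V; P] = cov[U', V; P] := by
    unfold covariance
    rw [integral_congr_ae h]
    refine integral_congr_ae ?_
    filter_upwards [h] with ω hω
    rw [hω]
  rw [corr, corr, h1, variance_congr h]

end Corr

/-! ### Asymptotically perfect correlation of log scale and roughness -/

section Law

variable {φ₁ φ₂ : ℝ} {Ω : Type*} {X : Plane → Ω → ℝ}
variable [MeasurableSpace Ω] {P : Measure Ω} [IsProbabilityMeasure P]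
  (hφ₁ : 0 < φ₁) (hφ₂ : 0 < φ₂) (hφ₂' : φ₂ < 1) (hX : IsPowerLawField φ₁ φ₂ unitSquare X P)

include hφ₁ hφ₂ hφ₂' hX

/-- The roughness estimator enters with the factor `log N`, and the only other random term is the
logarithm of `τ̂₁/τ₁`. The identity needs a nonzero ratio, which holds almost surely. -/
lemma log_plugIn_ae_eq {n : ℕ} (hn : 8 ≤ n) :
    (fun ω => Real.log (((n : ℝ) ^ 2) ^ roughEst n (sample ((n : ℝ)⁻¹) X ω) *
      scaleEst n (sample ((n : ℝ)⁻¹) X ω))) =ᵐ[P]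
    fun ω => Real.log ((n : ℝ) ^ 2) * roughEst n (sample ((n : ℝ)⁻¹) X ω) +
      (Real.log (ratioMap φ₁ (fun a => normQV φ₂ X n a ω) 0) +
        (Real.log φ₁ - Real.log ((n : ℝ) ^ 2) * φ₂)) := by
  obtain ⟨C, hC0, hC⟩ := exists_ae_abs_log_ratioMap_le hφ₁ hφ₂ hφ₂' hX
  filter_upwards [hC n hn] with ω hω
  have h := plugIn_eq (φ₂ := φ₂) hφ₁ (by omega : n ≠ 0) X ω
  rw [div_eq_iff hφ₁.ne'] at h
  rw [h, Real.log_mul (mul_ne_zero (Real.exp_pos _).ne' hω.1) hφ₁.ne',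
    Real.log_mul (Real.exp_pos _).ne' hω.1, Real.log_exp]
  have e : ratioMap φ₁ (fun a => normQV φ₂ X n a ω) 1 = roughEst n (sample ((n : ℝ)⁻¹) X ω) := by
    rw [← ratioMap_normQV (by omega : n ≠ 0)]; rfl
  rw [e]
  ring

lemma memLp_log_plugIn {n : ℕ} (hn : 8 ≤ n) :
    MemLp (fun ω => Real.log (((n : ℝ) ^ 2) ^ roughEst n (sample ((n : ℝ)⁻¹) X ω) *
      scaleEst n (sample ((n : ℝ)⁻¹) X ω))) 2 P :=
  (memLp_congr_ae (log_plugIn_ae_eq hφ₁ hφ₂ hφ₂' hX hn)).2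
    (((memLp_roughEst hφ₁ hφ₂ hφ₂' hX hn).const_mul _).add
      ((memLp_log_ratioMap hφ₁ hφ₂ hφ₂' hX hn).add (memLp_const _)))

/-- The logarithm of the scale estimator and the roughness estimator are asymptotically perfectly
correlated. -/
theorem tendsto_corr_log_plugIn :
    Tendsto (fun n : ℕ => corr (fun ω => Real.log (((n : ℝ) ^ 2) ^
      roughEst n (sample ((n : ℝ)⁻¹) X ω) * scaleEst n (sample ((n : ℝ)⁻¹) X ω)))
        (fun ω => roughEst n (sample ((n : ℝ)⁻¹) X ω)) P) atTop (𝓝 1) := by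
  obtain ⟨c, hc, hvar⟩ := exists_le_variance_roughEst hφ₁ hφ₂ hφ₂' hX
  obtain ⟨K, hK0, hK⟩ := momentBdd_sq_log_ratioMap hφ₁ hφ₂ hφ₂' hX
  -- From `n² Var[R] ≤ K` and `n² Var[V] ≥ c`, this bounds the ratio of the standard deviations of
  -- `R` and `V` uniformly in `n`.
  set ρ := √(K / c)
  have hL : Tendsto (fun n : ℕ => Real.log ((n : ℝ) ^ 2)) atTop atTop :=
    Real.tendsto_log_atTop.comp ((tendsto_pow_atTop two_ne_zero).comp tendsto_natCast_atTop_atTop)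
  have hlow : Tendsto (fun n : ℕ => 1 - 2 * ρ / Real.log ((n : ℝ) ^ 2)) atTop (𝓝 1) := by
    simpa using (hL.const_div_atTop (2 * ρ)).const_sub 1
  refine tendsto_of_tendsto_of_tendsto_of_le_of_le' hlow tendsto_const_nhds ?_ ?_
  · filter_upwards [hvar, hL.eventually_gt_atTop ρ, hL.eventually_gt_atTop 0,
      eventually_ge_atTop 8] with n hv hLρ hL0 hn
    have hn0 : (0 : ℝ) < (n : ℝ) ^ 2 := by
      have : (0 : ℝ) < n := by exact_mod_cast (by omega : 0 < n)
      positivity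
    set V : Ω → ℝ := fun ω => roughEst n (sample ((n : ℝ)⁻¹) X ω)
    set R : Ω → ℝ := fun ω => Real.log (ratioMap φ₁ (fun a => normQV φ₂ X n a ω) 0) with hR_def
    set d := Real.log φ₁ - Real.log ((n : ℝ) ^ 2) * φ₂
    have hVL : MemLp V 2 P := memLp_roughEst hφ₁ hφ₂ hφ₂' hX hn
    have hRL : MemLp R 2 P := memLp_log_ratioMap hφ₁ hφ₂ hφ₂' hX hn
    have hRd : Var[fun ω => R ω + d; P] = Var[R; P] := variance_add_const hRL.aestronglyMeasurable d
    have hVpos : 0 < Var[V; P] := pos_of_mul_pos_right (hc.trans_le hv) hn0.le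
    have hvpos : 0 < √Var[V; P] := Real.sqrt_pos.2 hVpos
    have hRle : (n : ℝ) ^ 2 * Var[R; P] ≤ K := by
      have h1 := (hK n hn).2
      simp only [mul_pow, integral_const_mul, pow_zero, mul_one] at h1
      refine (mul_le_mul_of_nonneg_left ?_ hn0.le).trans h1
      exact variance_le_expectation_sq hRL.aestronglyMeasurable
    have hr : √Var[R; P] ≤ ρ * √Var[V; P] := by
      rw [← Real.sqrt_mul (by positivity)]
      refine Real.sqrt_le_sqrt ?_
      rw [div_mul_eq_mul_div, le_div_iff₀ hc]
      refine le_of_mul_le_mul_left ?_ hn0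
      nlinarith [variance_nonneg R P, mul_le_mul_of_nonneg_left hv hK0,
        mul_le_mul_of_nonneg_right hRle hc.le]
    rw [corr_congr_left (log_plugIn_ae_eq hφ₁ hφ₂ hφ₂' hX hn)]
    refine le_trans ?_ (one_sub_le_corr hVL (hRL.add (memLp_const d)) hL0 hvpos ?_)
    · simp only [Pi.add_def, hRd]
      refine sub_le_sub_left ?_ 1
      rw [div_le_div_iff₀ (by positivity) hL0]
      nlinarith
    · simp only [Pi.add_def, hRd]
      refine hr.trans_lt ?_
      gcongr
  · filter_upwards [eventually_ge_atTop 8] with n hn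
    exact corr_le_one (memLp_log_plugIn hφ₁ hφ₂ hφ₂' hX hn) (memLp_roughEst hφ₁ hφ₂ hφ₂' hX hn)

end Law

end PowerLaw
end

theorem mainTheorem3 {Ω : Type*} [MeasurableSpace Ω] (P : Measure Ω) [IsProbabilityMeasure P]
    (φ₁ φ₂ : ℝ) (hφ₁ : 0 < φ₁) (hφ₂ : 0 < φ₂) (hφ₂' : φ₂ < 1)
    (X : Plane → Ω → ℝ) (hX : IsPowerLawField φ₁ φ₂ unitSquare X P)
    (N τ₁ : ℕ → ℝ) (hN : ∀ n, N n = (n : ℝ) ^ 2) (hτ₁ : ∀ n, τ₁ n = φ₁ * N n ^ (-φ₂))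
    -- the estimators computed from the `n × n` sample `X(t/n)`, `t ∈ {0, …, n-1}²`
    (τ₁hat τ₂hat : ℕ → Ω → ℝ)
    (hτ₁hat : ∀ n ω, τ₁hat n ω = scaleEst n (sample ((n : ℝ)⁻¹) X ω))
    (hτ₂hat : ∀ n ω, τ₂hat n ω = roughEst n (sample ((n : ℝ)⁻¹) X ω)) :
    -- exact equality in law with the unit-lattice (increasing-domain) ratios
    (∀ (Ω' : Type*) (_ : MeasurableSpace Ω') (P' : Measure Ω') (_ : IsProbabilityMeasure P')
        (Y : Plane → Ω' → ℝ), IsPowerLawField φ₁ φ₂ integerLattice Y P' →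
        ∀ n : ℕ, 5 ≤ n →
          IdentDistrib (fun ω => (τ₁hat n ω / τ₁ n, τ₂hat n ω))
            (fun ω => (scaleEst n (sample 1 Y ω) / φ₁, roughEst n (sample 1 Y ω))) P P') ∧
    -- the limiting covariance is a covariance matrix, with a nondegenerate roughness component
    (limitCov φ₁ φ₂).PosSemidef ∧ 0 < limitCov φ₁ φ₂ 1 1 ∧
    -- ratio CLT
    TendstoInDistribution
      (fun n ω => (√(N n) • !₂[τ₁hat n ω / τ₁ n - 1, τ₂hat n ω - φ₂] : Plane))
      atTop id (fun _ => P) (multivariateGaussian 0 (limitCov φ₁ φ₂)) ∧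
    -- plug-in form
    TendstoInDistribution
      (fun n ω => (√(N n) • !₂[(N n ^ τ₂hat n ω * τ₁hat n ω / φ₁ - 1)
          - Real.log (N n) * (τ₂hat n ω - φ₂), τ₂hat n ω - φ₂] : Plane))
      atTop id (fun _ => P) (multivariateGaussian 0 (limitCov φ₁ φ₂)) ∧
    -- stabilized log form
    TendstoInDistribution
      (fun n ω => (√(N n) • WithLp.toLp 2 (stabMatrix (N n) *ᵥ
          ![Real.log (N n ^ τ₂hat n ω * τ₁hat n ω / φ₁), τ₂hat n ω - φ₂]) : Plane))
      atTop id (fun _ => P) (multivariateGaussian 0 (limitCov φ₁ φ₂)) ∧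
    -- exact rate `N^(-1/2) log N` of the estimator `N^τ₂hat * τ₁hat` of the scale `φ₁`
    TendstoInDistribution
      (fun n ω => √(N n) / Real.log (N n) * (N n ^ τ₂hat n ω * τ₁hat n ω / φ₁ - 1))
      atTop id (fun _ => P) (gaussianReal 0 (limitCov φ₁ φ₂ 1 1).toNNReal) ∧
    -- the correlation of the log scale estimator and the roughness estimator tends to 1
    (∀ᶠ n in atTop, MemLp (fun ω => Real.log (N n ^ τ₂hat n ω * τ₁hat n ω)) 2 P ∧
      MemLp (τ₂hat n) 2 P) ∧
    Tendsto (fun n => corr (fun ω => Real.log (N n ^ τ₂hat n ω * τ₁hat n ω)) (τ₂hat n) P)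
      atTop (𝓝 1) := by
  obtain rfl : N = fun n : ℕ => (n : ℝ) ^ 2 := funext hN
  obtain rfl : τ₁ = fun n : ℕ => φ₁ * ((n : ℝ) ^ 2) ^ (-φ₂) := funext hτ₁
  obtain rfl : τ₁hat = fun n ω => scaleEst n (sample ((n : ℝ)⁻¹) X ω) :=
    funext fun n => funext (hτ₁hat n)
  obtain rfl : τ₂hat = fun n ω => roughEst n (sample ((n : ℝ)⁻¹) X ω) :=
    funext fun n => funext (hτ₂hat n)
  refine ⟨fun Ω' _ P' _ Y hY n hn => identDistrib_ratio (n := n) hφ₁ hφ₂ hφ₂' hX hY (by omega),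
    posSemidef_limitCov hφ₁ hφ₂ hφ₂', limitCov_one_one_pos hφ₁ hφ₂ hφ₂',
    tendstoInDistribution_ratio hφ₁ hφ₂ hφ₂' hX, tendstoInDistribution_plugIn hφ₁ hφ₂ hφ₂' hX,
    tendstoInDistribution_log hφ₁ hφ₂ hφ₂' hX, tendstoInDistribution_plugIn_scale hφ₁ hφ₂ hφ₂' hX,
    (eventually_ge_atTop 8).mono fun n hn => ⟨memLp_log_plugIn hφ₁ hφ₂ hφ₂' hX hn,
      memLp_roughEst hφ₁ hφ₂ hφ₂' hX hn⟩, tendsto_corr_log_plugIn hφ₁ hφ₂ hφ₂' hX⟩
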